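/- Let $n\ge 2$ and $\rho=8(n-1)$. Let $T,X\subseteq\mathbb R$ be open intervals, and let $u=(u_1,u_2)$, $h=(h_1,h_2)$ be smooth functions of $(t,x)\in T\times X$ with values in $\mathbb C^{n-1}\oplus\mathbb C^{n-1}$ (row vectors; $x\cdot y=xy^{\rm t}$). Put $C(x,y)=x\bar y^{\rm t}-y\bar x^{\rm t}$, $A(x,y)=x\bar y^{\rm t}+y\bar x^{\rm t}$, $S(x,y)=xy^{\rm t}+yx^{\rm t}$, $\mathbf C(x,y)=\bar x^{\rm t}y-\bar y^{\rm t}x$, $\mathbf A(x,y)=x^{\rm t}\bar y-\bar y^{\rm t}x$, $\mathbf S(x,y)=x^{\rm t}\bar y+\bar y^{\rm t}x$, and $|h|^2=|h_1|^2+|h_2|^2$ with $|x|^2=\tfrac12A(x,x)$. **The $-1$ flow.** The $-1$ flow attached to $SU(2n)/Sp(n)$ is $u_t=h$, $\mathcal J(h)=0$, that is, there are $H_1\in\mathfrak u(n-1)$ and $H_2\in\mathfrak{so}(n-1,\mathbb C)$ (the antiderivatives in the nonlocal operator $\mathcal J$) with $$\partial_xH_1=\sqrt\rho\,\big(\mathbf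 C(ih_1,u_1)+\mathbf C(ih_2,u_2)^{\rm t}\big),\qquad \partial_xH_2=\sqrt\rho\,\big(-\mathbf A(u_2,ih_1)+\mathbf A(ih_2,u_1)\big),$$ $$i\sqrt\rho\,\partial_xh_1=(\operatorname{tr}H_1)u_1+u_1H_1+u_2\bar H_2,\qquad i\sqrt\rho\,\partial_xh_2=(\operatorname{tr}H_1)u_2-u_2\bar H_1+u_1H_2 .$$ **(1) Conservation law.** Every solution satisfies $\partial_x\big(|h|^2+\tfrac1{2\rho}(h_\parallel^2+|H_1|^2+|H_2|^2)\big)=0$, where $h_\parallel=-i\operatorname{tr}H_1$, $|H_1|^2=-\operatorname{tr}(H_1^2)$, $|H_2|^2=-\operatorname{tr}(\bar H_2H_2)$. **(2) Reduction and normalization.** Consider the ansatz $$H_1=\tfrac12\alpha\big(\mathbf C(h_1,ih_1)+\mathbf C(h_2,ih_2)^{\rm t}\big)+i\beta I_{n-1},\qquad H_2=\gamma\,\mathbf A(h_2,ih_1)$$ with real smooth $\gamma=\alpha$, with real $\beta=\beta(t)$, with $\alpha^2|h|^2+n\beta\alpha+\rho=0$ and with $2\alpha|h|^2+n\beta\neq0$.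 The conserved quantity then equals $n(\beta/4)^2$. With $c(t)=-n\beta/(2\sqrt\rho)\ne0$ and $\tilde h=h/c$, the ansatz scales to the same ansatz for $\tilde h$ with coefficients $\tilde\alpha=c\alpha$ and $\tilde\beta=\beta/c=-2\sqrt\rho/n$. There is one sign $\varepsilon=\pm1$ such that $|\tilde h|<1$ (and $\tilde h\ne0$ if $\varepsilon=1$) and $\tilde\alpha=\sqrt\rho\,/\big(1-\varepsilon\sqrt{1-|\tilde h|^2}\big)$, which is $\sqrt\rho\,\big(1+\varepsilon\sqrt{1-|\tilde h|^2}\big)/|\tilde h|^2$ where $\tilde h\neq0$. The system $\mathcal J(h)=0$ with this ansatz is equivalent to $\tilde h_x=F_\varepsilon(u,\tilde h)$, where $F_\varepsilon(u,v)$ is the pair $$\frac{1+\varepsilon\sqrt{1-|v|^2}}{|v|^2}\Big((u_1\cdot\bar v_1+u_2\cdot\bar v_2)v_1+(u_1\cdot v_2-u_2\cdot v_1)\bar v_2\Big)-\big(1-\varepsilon\sqrt{1-|v|^2}\big)u_1,$$ $$\frac{1+\varepsilon\sqrt{1-|v|^2}}{|v|^2}\Big((u_1\cdot\bar v_1+u_2\cdot\bar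 v_2)v_2-(u_1\cdot v_2-u_2\cdot v_1)\bar v_1\Big)-\big(1-\varepsilon\sqrt{1-|v|^2}\big)u_2$$ (read as $-2u$ at $v=0$ when $\varepsilon=-1$). If $u_t=h$ solves the $-1$ flow with this ansatz, then after any reparametrization $t=\theta(\tau)$ with $\theta'(\tau)=1/c(\theta(\tau))$ the function $u$ satisfies the vector sine-Gordon system $u_{\tau x}=F_\varepsilon(u,u_\tau)$. **(3) Vector SG system.** Let $\varepsilon=\pm1$, $|u_t|<1$, and $u_t\ne0$ if $\varepsilon=1$. Then $u$ solves the hyperbolic system $u_{tx}=F_\varepsilon(u,u_t)$ if and only if it solves the $-1$ flow with $h=u_t$ and $H_1,H_2$ given by the ansatz with $\beta=-2\sqrt\rho/n$, $\alpha=\gamma=\sqrt\rho\,/\big(1-\varepsilon\sqrt{1-|h|^2}\big)$. It is also equivalent to $u=U_\varepsilon(h,h_x)$ with $h=u_t$, where $U_\varepsilon(h,h_x)$ is the pair $$-k h_{1,x}+k^2(a h_1+b\bar h_2),\quad -k h_{2,x}+k^2(a h_2-b\bar h_1),\qquad k=\frac1{1-\varepsilon\sqrt{1-|h|^2}},$$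 $$a=\frac{\bar h_1\cdot h_{1,x}+\bar h_2\cdot h_{2,x}}{2\varepsilon\sqrt{1-|h|^2}},\qquad b=\frac{h_2\cdot h_{1,x}-h_1\cdot h_{2,x}}{2\varepsilon\sqrt{1-|h|^2}} .$$ **(4) Invariance.** The system $u_{tx}=F_\varepsilon(u,u_t)$ and $|\cdot|^2$ are invariant under $Sp(1)\times Sp(n-1)$, acting by $(u_1,u_2)\mapsto(cu_1+d\bar u_2,\;cu_2-d\bar u_1)$ with $|c|^2+|d|^2=1$, and by $(u_1,u_2)\mapsto(u_1\bar C^{\rm t}+u_2\bar D^{\rm t},\;-u_1D^{\rm t}+u_2C^{\rm t})$ with $\begin{pmatrix}C&D\\-\bar D&\bar C\end{pmatrix}$ unitary. **(5) Hamiltonian structure.** Let $\mathcal H$ be the nonlocal operator $w=(w_1,w_2)\mapsto \partial_xw+B(u,V)$, where $V=(\varpi_1,\varpi_2,W_1,W_2)$ has $\varpi_1\in i\mathbb R$, $\varpi_2\in\mathbb C$, $W_1\in\mathfrak u(n-1)$, $W_2$ complex symmetric, $$B(u,V)=\big(-\varpi_1u_1+\varpi_2\bar u_2+u_1W_1-u_2\bar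 W_2,\;-\varpi_1u_2-\varpi_2\bar u_1+u_2\bar W_1+u_1W_2\big),$$ and $\partial_xV=G(u,w)$ has the components $C(u_1,w_1)+C(u_2,w_2)$, $-S(u_1,w_2)+S(u_2,w_1)$, $\mathbf C(u_1,w_1)+\overline{\mathbf C(u_2,w_2)}$, $\overline{\mathbf S(u_1,w_2)}-\mathbf S(u_2,w_1)$; a choice of $V$ is a choice of the antiderivatives $\partial_x^{-1}$. Then $\mathcal H$ is a Hamiltonian operator: on elements $(w,V)$ of its domain with compact support it is skew for the pairing $\int_X\sum_lA(\cdot_l,\cdot_l)\,dx$ and satisfies the Jacobi identity $\int_X\sum_l A\big((w^{1})_l,(\mathcal H'[\mathcal Hw^{2}]w^{3})_l\big)dx+\text{cyclic}=0$, where $\mathcal H'[f]w=B(f,V)+B(u,Z)$, $\partial_xZ=G(f,w)$, is the Fréchet derivative of $\mathcal Hw$ in the direction $f$. Let $\kappa\neq0$ and $$H^{(-1)}=\kappa\,\varepsilon\sqrt{1-|h_1|^2-|h_2|^2}\qquad(\text{so } H^{(-1)}=\pm8\sqrt{1-|h_1|^2-|h_2|^2}\text{ for }\kappa=8),$$ where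 $h$ (with $|h|<1$, and $h\ne0$ if $\varepsilon=1$) is determined by $u=U_\varepsilon(h,h_x)$. A variational derivative $\delta H^{(-1)}/\delta u$ is a smooth $w$ on $X$ with $$\delta\int_X H^{(-1)}dx=\kappa\int_X\sum_{l=1,2}A(w_l,\delta u_l)\,dx$$ for all smooth variations of $u=U_\varepsilon(h,h_x)$ induced by admissible smooth variations of $h$ with compact support in $X$. (With respect to the pairing $\int\sum_lA(\cdot_l,\cdot_l)dx$ itself, $\kappa=1$, the Hamiltonian is thus $\pm\sqrt{1-|h_1|^2-|h_2|^2}$; the constant $8$ goes with the pairing $8\int\sum_lA(\cdot_l,\cdot_l)dx$.) For every smooth $h(x)$ as above and $u=U_\varepsilon(h,h_x)$, such a $w$ exists, and every such $w$ satisfies $h=\mathcal H(w)$ for a suitable choice of the antiderivatives. In particular every solution as in (3) of the vector SG system has the Hamiltonian form $u_t=\mathcal H\big(\delta H^{(-1)}/\delta u\big)$ with $h=u_t$. -/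

import Mathlib

open scoped Matrix ContDiff
open MeasureTheory

attribute [local instance] Matrix.normedAddCommGroup Matrix.normedSpace

namespace VectorSG

noncomputable section

/-- Row vectors in `ℂ^(n-1)`. -/
abbrev Vec (n : ℕ) : Type := Fin (n - 1) → ℂ

/-- Pairs of row vectors, the coordinates on `𝔪_⊥` and on `𝔥_⊥`. -/
abbrev Fld (n : ℕ) : Type := Vec n × Vec n

/-- Complex `(n-1) × (n-1)` matrices. -/
abbrev Mat (n : ℕ) : Type := Matrix (Fin (n - 1)) (Fin (n - 1)) ℂ

/-- Entrywise complex conjugate of a matrix (no transpose). For vectors this is `star`. -/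
def mconj {n : ℕ} (M : Mat n) : Mat n := M.map star

/-! ### Inner and outer products -/

/-- `x ȳᵗ - y x̄ᵗ`. -/
def inC {n : ℕ} (x y : Vec n) : ℂ := x ⬝ᵥ star y - y ⬝ᵥ star x

/-- `x ȳᵗ + y x̄ᵗ = 2 Re ⟨x, y⟩`, as a real number. -/
def inA {n : ℕ} (x y : Vec n) : ℝ := 2 * (x ⬝ᵥ star y).re

/-- `x yᵗ + y xᵗ`. -/
def inS {n : ℕ} (x y : Vec n) : ℂ := x ⬝ᵥ y + y ⬝ᵥ x

/-- `x̄ᵗ y - ȳᵗ x`. -/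
def outC {n : ℕ} (x y : Vec n) : Mat n :=
  Matrix.vecMulVec (star x) y - Matrix.vecMulVec (star y) x

/-- `xᵗ ȳ - ȳᵗ x`. -/
def outA {n : ℕ} (x y : Vec n) : Mat n :=
  Matrix.vecMulVec x (star y) - Matrix.vecMulVec (star y) x

/-- `xᵗ ȳ + ȳᵗ x`. -/
def outS {n : ℕ} (x y : Vec n) : Mat n :=
  Matrix.vecMulVec x (star y) + Matrix.vecMulVec (star y) x

/-- The real pairing `A(v₁, w₁) + A(v₂, w₂)` of pairs. -/
def pairA {n : ℕ} (v w : Fld n) : ℝ := inA v.1 w.1 + inA v.2 w.2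

/-- `|h₁|² + |h₂|²`, where `|x|² = A(x, x) / 2`. -/
def nsq {n : ℕ} (h : Fld n) : ℝ := pairA h h / 2

/-- `√(1 - |h₁|² - |h₂|²)`. -/
def rad {n : ℕ} (h : Fld n) : ℝ := Real.sqrt (1 - nsq h)

/-- The constant `ρ = 8 (n - 1)`. -/
def rho (n : ℕ) : ℝ := 8 * ((n : ℝ) - 1)

/-- Time derivative of a function of `(t, x)`. -/
def Dt {E : Type*} [NormedAddCommGroup E] [NormedSpace ℝ E] (f : ℝ → ℝ → E) (t x : ℝ) : E :=
  deriv (fun s => f s x) t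

/-- Smoothness on `T × X` of a function of `(t, x)`. -/
def Smooth2 {E : Type*} [NormedAddCommGroup E] [NormedSpace ℝ E] (T X : Set ℝ)
    (f : ℝ → ℝ → E) : Prop :=
  ContDiffOn ℝ ∞ (fun p : ℝ × ℝ => f p.1 p.2) (T ×ˢ X)

/-! ### The symplectic operator `𝒥` and the `-1` flow -/

/-- `(H₁, H₂) ∈ 𝔲(n-1) ⊕ 𝔰𝔬(n-1, ℂ) ≃ 𝔪_∥`. -/
def IsMPar {n : ℕ} (H : Mat n × Mat n) : Prop := H.1ᴴ = -H.1 ∧ H.2ᵀ = -H.2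

/-- The `x`-derivative of the potentials `(H₁, H₂)` belonging to `(u, h)`. -/
def potH {n : ℕ} (u h : Fld n) : Mat n × Mat n :=
  (Real.sqrt (rho n) • (outC (Complex.I • h.1) u.1 + (outC (Complex.I • h.2) u.2)ᵀ),
    Real.sqrt (rho n) • (-outA u.2 (Complex.I • h.1) + outA (Complex.I • h.2) u.1))

/-- The value of `𝒥 h` at a point in terms of `u`, `h_x` and the potentials. -/
def valJ {n : ℕ} (u hx : Fld n) (H : Mat n × Mat n) : Fld n :=
  (hx.1 + (Complex.I / (Real.sqrt (rho n) : ℂ)) •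
      (H.1.trace • u.1 + u.1 ᵥ* H.1 + u.2 ᵥ* mconj H.2),
    hx.2 + (Complex.I / (Real.sqrt (rho n) : ℂ)) •
      (H.1.trace • u.2 - u.2 ᵥ* mconj H.1 + u.1 ᵥ* H.2))

/-- `w = 𝒥 h` on the interval `X`, where `H = (H₁, H₂)` is the choice of the antiderivatives
`D_x⁻¹` that occur in the nonlocal operator `𝒥`. -/
def IsJ {n : ℕ} (X : Set ℝ) (u h : ℝ → Fld n) (H : ℝ → Mat n × Mat n) (w : ℝ → Fld n) : Prop :=
  ∀ x ∈ X, IsMPar (H x) ∧ HasDerivAt H (potH (u x) (h x)) x ∧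
    w x = valJ (u x) (deriv h x) (H x)

/-- The `-1` flow: `u_t = h` with `𝒥 h = 0`. -/
def IsMinusOneFlow {n : ℕ} (T X : Set ℝ) (u h : ℝ → ℝ → Fld n)
    (H : ℝ → ℝ → Mat n × Mat n) : Prop :=
  (∀ t ∈ T, ∀ x ∈ X, Dt u t x = h t x) ∧ ∀ t ∈ T, IsJ X (u t) (h t) (H t) (fun _ => 0)

/-- The algebraic ansatz for `(H₁, H₂)` with real coefficients `α`, `β`, `γ`. -/
def ansatz {n : ℕ} (α β γ : ℝ) (h : Fld n) : Mat n × Mat n :=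
  ((α / 2) • (outC h.1 (Complex.I • h.1) + (outC h.2 (Complex.I • h.2))ᵀ)
      + ((β : ℂ) * Complex.I) • (1 : Mat n),
    γ • outA h.2 (Complex.I • h.1))

/-- `|h₁|² + |h₂|² + (h_∥² + |H₁|² + |H₂|²) / (2ρ)`, where `h_∥ = -i tr H₁`,
`|H₁|² = -tr (H₁²)` and `|H₂|² = -tr (H̄₂ H₂)`. -/
def conserved {n : ℕ} (h : Fld n) (H : Mat n × Mat n) : ℝ :=
  nsq h + ((-Complex.I * H.1.trace).re ^ 2 + (-(H.1 * H.1).trace).re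
    + (-(mconj H.2 * H.2).trace).re) / (2 * rho n)

/-! ### The vector sine-Gordon system -/

/-- The domain where the radical is smooth and its coefficients are finite; `ε = ±1` is the sign
of the radical. At `h = 0` only the branch `ε = -1` is regular. -/
def Adm {n : ℕ} (ε : ℝ) (h : Fld n) : Prop := nsq h < 1 ∧ (ε = 1 → h ≠ 0)

/-- `α / √ρ` in the form `1 / (1 - ε √(1 - |h|²))`, which covers `h = 0` when `ε = -1`. -/
def kap {n : ℕ} (ε : ℝ) (h : Fld n) : ℝ := 1 / (1 - ε * rad h)

theorem kap_eq {n : ℕ} {ε : ℝ} {h : Fld n} (hε : ε = 1 ∨ ε = -1) (h1 : nsq h ≤ 1)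
    (h0 : nsq h ≠ 0) : kap ε h = (1 + ε * rad h) / nsq h := by
  have hr : rad h ^ 2 = 1 - nsq h := Real.sq_sqrt (by linarith)
  have he : ε ^ 2 = 1 := by rcases hε with rfl | rfl <;> norm_num
  have hp : (1 - ε * rad h) * (1 + ε * rad h) = nsq h := by
    have : (1 - ε * rad h) * (1 + ε * rad h) = 1 - ε ^ 2 * rad h ^ 2 := by ring
    rw [this, he, hr]; ring
  have hne : 1 - ε * rad h ≠ 0 := by
    intro hz
    rw [hz, zero_mul] at hp
    exact h0 hp.symm
  unfold kap
  rw [div_eq_div_iff hne h0, one_mul, ← hp]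
  ring

/-- The right-hand side of the vector sine-Gordon system, with `h = u_t`. (At `h = 0` the quotient
by zero is multiplied by zero.) -/
def sgRHS {n : ℕ} (ε : ℝ) (u h : Fld n) : Fld n :=
  (((1 + ε * rad h) / nsq h) •
        ((u.1 ⬝ᵥ star h.1 + u.2 ⬝ᵥ star h.2) • h.1
          + (u.1 ⬝ᵥ h.2 - u.2 ⬝ᵥ h.1) • star h.2)
      - (1 - ε * rad h) • u.1,
    ((1 + ε * rad h) / nsq h) •
        ((u.1 ⬝ᵥ star h.1 + u.2 ⬝ᵥ star h.2) • h.2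
          - (u.1 ⬝ᵥ h.2 - u.2 ⬝ᵥ h.1) • star h.1)
      - (1 - ε * rad h) • u.2)

/-- `u` solves the vector sine-Gordon system `u_tx = …` on `T × X`. -/
def IsSG {n : ℕ} (ε : ℝ) (T X : Set ℝ) (u : ℝ → ℝ → Fld n) : Prop :=
  ∀ t ∈ T, ∀ x ∈ X, deriv (fun y => Dt u t y) x = sgRHS ε (u t x) (Dt u t x)

/-- The local expression of `u` through `h` and `h_x`. -/
def uOf {n : ℕ} (ε : ℝ) (h hx : Fld n) : Fld n :=
  let a : ℂ := (star h.1 ⬝ᵥ hx.1 + star h.2 ⬝ᵥ hx.2) / ((2 * ε * rad h : ℝ) : ℂ)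
  let b : ℂ := (h.2 ⬝ᵥ hx.1 - h.1 ⬝ᵥ hx.2) / ((2 * ε * rad h : ℝ) : ℂ)
  (-(kap ε h • hx.1) + kap ε h ^ 2 • (a • h.1 + b • star h.2),
    -(kap ε h • hx.2) + kap ε h ^ 2 • (a • h.2 - b • star h.1))

/-! ### The symplectic group -/

/-- `(C, D)` represents an element of the compact group `Sp(n-1)`. -/
def IsSp {n : ℕ} (C D : Mat n) : Prop :=
  Matrix.fromBlocks C D (-mconj D) (mconj C) ∈
    Matrix.unitaryGroup (Fin (n - 1) ⊕ Fin (n - 1)) ℂ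

/-- `(c, d)` represents an element of `Sp(1)`. -/
def IsSp1 (c d : ℂ) : Prop := Complex.normSq c + Complex.normSq d = 1

/-- The action of `Sp(1)` on pairs. -/
def actSp1 {n : ℕ} (c d : ℂ) (p : Fld n) : Fld n :=
  (c • p.1 + d • star p.2, c • p.2 - d • star p.1)

/-- The action of `Sp(n-1)` on pairs. -/
def actSp {n : ℕ} (C D : Mat n) (p : Fld n) : Fld n :=
  (p.1 ᵥ* Cᴴ + p.2 ᵥ* Dᴴ, -(p.1 ᵥ* Dᵀ) + p.2 ᵥ* Cᵀ)

/-! ### The Hamiltonian operator `ℋ` -/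

/-- The coordinates `(ϖ₁, ϖ₂, W₁, W₂)` on `𝔥_∥`. -/
abbrev Par (n : ℕ) : Type := (ℂ × ℂ) × (Mat n × Mat n)

/-- `(ϖ₁, ϖ₂, W₁, W₂) ∈ 𝔰𝔭(1) ⊕ 𝔰𝔭(n-1) ≃ 𝔥_∥`. -/
def IsHPar {n : ℕ} (V : Par n) : Prop :=
  V.1.1.re = 0 ∧ V.2.1ᴴ = -V.2.1 ∧ V.2.2ᵀ = V.2.2

/-- The bracket of `u ∈ 𝔥_⊥` with `V ∈ 𝔥_∥`, as an element of `𝔥_⊥`. -/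
def brB {n : ℕ} (u : Fld n) (V : Par n) : Fld n :=
  (-(V.1.1 • u.1) + V.1.2 • star u.2 + u.1 ᵥ* V.2.1 - u.2 ᵥ* mconj V.2.2,
    -(V.1.1 • u.2) - V.1.2 • star u.1 + u.2 ᵥ* mconj V.2.1 + u.1 ᵥ* V.2.2)

/-- Minus the bracket of `u` and `w` in `𝔥_⊥`, as an element of `𝔥_∥`. -/
def brG {n : ℕ} (u w : Fld n) : Par n :=
  ((inC u.1 w.1 + inC u.2 w.2, -inS u.1 w.2 + inS u.2 w.1),
    (outC u.1 w.1 + mconj (outC u.2 w.2), mconj (outS u.1 w.2) - outS u.2 w.1))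

/-- `f = ℋ w` on the interval `X`, where `V` is the choice of the antiderivatives `D_x⁻¹` that
occur in the nonlocal operator `ℋ`: `ℋ w = D_x w + brB u V` with `D_x V = brG u w`. -/
def IsHop {n : ℕ} (X : Set ℝ) (u w : ℝ → Fld n) (V : ℝ → Par n) (f : ℝ → Fld n) : Prop :=
  ∀ x ∈ X, IsHPar (V x) ∧ HasDerivAt V (brG (u x) (w x)) x ∧
    f x = deriv w x + brB (u x) (V x)

/-- `(w, V)` is a smooth element of the domain of `ℋ`, compactly supported in `X`, and
`f = ℋ w`. -/
def IsTest {n : ℕ} (X : Set ℝ) (u w : ℝ → Fld n) (V : ℝ → Par n) (f : ℝ → Fld n) : Prop :=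
  ContDiffOn ℝ ∞ w X ∧ IsHop X u w V f ∧
    ∃ K : Set ℝ, IsCompact K ∧ K ⊆ X ∧ ∀ x ∈ X \ K, w x = 0 ∧ V x = 0

/-- `Z` is a choice of the potentials in the Fréchet derivative, in the direction `f` and at fixed
`w`, of the operator `u ↦ ℋ w`; that derivative is then `brB f V + brB u Z`. -/
def IsLinPot {n : ℕ} (X : Set ℝ) (f w : ℝ → Fld n) (Z : ℝ → Par n) : Prop :=
  ∀ x ∈ X, IsHPar (Z x) ∧ HasDerivAt Z (brG (f x) (w x)) x

/-- `∫ ⟨w₁, ℋ'[ℋ w₂] w₃⟩ dx`. -/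
def jacTerm {n : ℕ} (X : Set ℝ) (u w₁ f₂ : ℝ → Fld n) (V₃ Z₂₃ : ℝ → Par n) : ℝ :=
  ∫ x in X, pairA (w₁ x) (brB (f₂ x) (V₃ x) + brB (u x) (Z₂₃ x))

/-- `ℋ` is a Hamiltonian (cosymplectic) operator at `u`: it is skew and satisfies the Jacobi
identity `∫ ⟨w₁, ℋ'[ℋ w₂] w₃⟩ dx + cyclic = 0` on compactly supported elements of its domain. -/
def IsCosymplecticAt {n : ℕ} (X : Set ℝ) (u : ℝ → Fld n) : Prop :=
  (∀ (w₁ w₂ : ℝ → Fld n) (V₁ V₂ : ℝ → Par n) (f₁ f₂ : ℝ → Fld n),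
    IsTest X u w₁ V₁ f₁ → IsTest X u w₂ V₂ f₂ →
      (∫ x in X, pairA (w₁ x) (f₂ x)) + (∫ x in X, pairA (w₂ x) (f₁ x)) = 0) ∧
  (∀ (w₁ w₂ w₃ : ℝ → Fld n) (V₁ V₂ V₃ : ℝ → Par n) (f₁ f₂ f₃ : ℝ → Fld n)
    (Z₂₃ Z₃₁ Z₁₂ : ℝ → Par n),
    IsTest X u w₁ V₁ f₁ → IsTest X u w₂ V₂ f₂ → IsTest X u w₃ V₃ f₃ →
    IsLinPot X f₂ w₃ Z₂₃ → IsLinPot X f₃ w₁ Z₃₁ → IsLinPot X f₁ w₂ Z₁₂ →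
      jacTerm X u w₁ f₂ V₃ Z₂₃ + jacTerm X u w₂ f₃ V₁ Z₃₁ + jacTerm X u w₃ f₁ V₂ Z₁₂ = 0)

/-! ### The Hamiltonian `H^(-1)` -/

/-- The density `κ ε √(1 - |h₁|² - |h₂|²)`, so `±8 √(1 - |h₁|² - |h₂|²)` for `κ = 8`. -/
def hamDensity {n : ℕ} (κ ε : ℝ) (h : Fld n) : ℝ := κ * ε * rad h

/-- `w` is a variational derivative `δH^(-1)/δu` on `X` at the field `u = uOf ε h h_x`, with
respect to the pairing `κ ∫ (A(·₁, ·₁) + A(·₂, ·₂)) dx`. The density is a function of `h`, which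
is tied to `u` by `u = uOf ε h h_x`; accordingly the variations of `u` are those induced by
variations `η` of `h` with compact support in `X`. -/
def IsVarDeriv {n : ℕ} (κ ε : ℝ) (X : Set ℝ) (h w : ℝ → Fld n) : Prop :=
  ∀ (η : ℝ → ℝ → Fld n) (K : Set ℝ),
    Smooth2 Set.univ X η → (∀ s, ∀ x ∈ X, Adm ε (η s x)) →
    (∀ x ∈ X, η 0 x = h x) →
    IsCompact K → K ⊆ X → (∀ s, ∀ x ∈ X \ K, η s x = h x) →
      HasDerivAt (fun s => ∫ x in X, (hamDensity κ ε (η s x) - hamDensity κ ε (h x)))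
        (κ * ∫ x in X, pairA (w x) (deriv (fun s => uOf ε (η s x) (deriv (η s) x)) 0)) 0

/-- `u_t = ℋ (δH^(-1)/δu)` on `T × X`, where `h` is implicitly determined by
`u = uOf ε h h_x`. -/
def IsHamiltonianFlow {n : ℕ} (κ ε : ℝ) (T X : Set ℝ) (u h : ℝ → ℝ → Fld n) : Prop :=
  (∀ t ∈ T, ∀ x ∈ X, Adm ε (h t x) ∧ u t x = uOf ε (h t x) (deriv (h t) x)) ∧
  ∀ t ∈ T, ∃ (w : ℝ → Fld n) (V : ℝ → Par n), ContDiffOn ℝ ∞ w X ∧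
    IsVarDeriv κ ε X (h t) w ∧ IsHop X (u t) w V (Dt u t)

end

end VectorSG

namespace VectorSG

noncomputable section

/-! ### The quaternionic Hermitian product -/

/-! Pairs are quaternionic row vectors: `qa u h` and `qb u h` are the two complex components of the
Hermitian product ⟨u, h⟩, and `actSp1` is left multiplication by a quaternion. Put y = 1 − ε√(1 −
|h|²), so that |h|² = 2y − y². The system becomes h_x = F(u, h) with F(u, h) = y⁻¹⟨u, h⟩h − yu. For
fixed h this is quaternion-linear and self-adjoint in u, with eigenvalue 2(1 − y) on the
quaternionic line through h and −y on its orthogonal complement. Since y ≠ 0, 1 it is invertible,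
with inverse `uOf` (`eq_sgRHS_iff`), and the Sp(1) × Sp(n−1) symmetry is visible in this form
(`sgRHS_actL`).

The conservation law holds because the potential equation and 𝒥 h = 0 are dual to each other under
an invariant form (`pairA_rhsJ`). Under the ansatz, 𝒥 h = 0 reads √ρ h_x = α⟨u, h⟩h + (α|h|² + nβ)u,
and the quadratic relation turns the last coefficient into −ρ/α. Differentiating that relation
determines α_x, after which the potential equation is automatic (`isJ_ansatz_iff`). Simplicity of
the root α says α²|h|² ≠ ρ, so one branch ε holds on the connected set T × X (`ansatz_scale_kap`,
`exists_sign`).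

For the Hamiltonian form, write w = F(q, h), which is possible for every w. A variation g of h
satisfies the linearization of h_x = F(u, h). Pairing it with q and integrating by parts shows that
w is a variational derivative exactly when q solves the adjoint linear equation q_x = `auxRHS`
(`isVarDeriv_of_auxRHS`, `hasDerivAt_auxRHS_of_isVarDeriv`). That equation is solvable on all of X
(`exists_auxRHS`). For any such q the local expression V = `brG h q` is an antiderivative of `brG u
w`, and ℋ(w) = h is then an algebraic identity (`sgRHS_brG`, `hasDerivAt_sgRHS_aux`).

ℋ is Hamiltonian because (w, V) is an element A of 𝔰𝔭(n), and f = ℋ w means A_x + [A, U] = F, with U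
and F the images of u and f. Skewness and the Jacobi identity are then integrals of total
derivatives of compactly supported trace expressions (`IsTest.skew`, `IsTest.jacobi`). -/

/-- The first component `u₁ v̄₁ᵗ + u₂ v̄₂ᵗ` of the quaternionic Hermitian product. -/
def qa {n : ℕ} (u v : Fld n) : ℂ := u.1 ⬝ᵥ star v.1 + u.2 ⬝ᵥ star v.2

/-- The second component `u₁ v₂ᵗ - u₂ v₁ᵗ` of the quaternionic Hermitian product. -/
def qb {n : ℕ} (u v : Fld n) : ℂ := u.1 ⬝ᵥ v.2 - u.2 ⬝ᵥ v.1

section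

variable {n : ℕ} (u v w : Fld n) (r : ℝ) (c d : ℂ)

theorem star_dot {m : Type*} [Fintype m] (x y : m → ℂ) :
    star (x ⬝ᵥ y) = star x ⬝ᵥ star y := by
  rw [Matrix.star_dotProduct_star, dotProduct_comm]

theorem star_qa : star (qa u v) = qa v u := by
  simp only [qa, star_add, star_dot, star_star, dotProduct_comm (star _)]

theorem conj_qa : (starRingEnd ℂ) (qa u v) = qa v u := star_qa u v

theorem qb_swap : qb u v = -qb v u := by
  simp only [qb, dotProduct_comm u.1, dotProduct_comm u.2]
  ring

theorem qb_self : qb u u = 0 := by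
  simp only [qb, dotProduct_comm u.1, sub_self]

theorem qa_add_left : qa (u + v) w = qa u w + qa v w := by
  simp only [qa, Prod.fst_add, Prod.snd_add, add_dotProduct]; ring

theorem qa_sub_left : qa (u - v) w = qa u w - qa v w := by
  simp only [qa, Prod.fst_sub, Prod.snd_sub, sub_dotProduct]; ring

theorem qa_neg_left : qa (-u) w = -qa u w := by
  simp only [qa, Prod.fst_neg, Prod.snd_neg, neg_dotProduct]; ring

theorem qa_smul_left : qa (r • u) w = r * qa u w := by
  simp only [qa, Prod.smul_fst, Prod.smul_snd, smul_dotProduct, Complex.real_smul]; ring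

theorem qb_add_left : qb (u + v) w = qb u w + qb v w := by
  simp only [qb, Prod.fst_add, Prod.snd_add, add_dotProduct]; ring

theorem qb_sub_left : qb (u - v) w = qb u w - qb v w := by
  simp only [qb, Prod.fst_sub, Prod.snd_sub, sub_dotProduct]; ring

theorem qb_neg_left : qb (-u) w = -qb u w := by
  simp only [qb, Prod.fst_neg, Prod.snd_neg, neg_dotProduct]; ring

theorem qb_smul_left : qb (r • u) w = r * qb u w := by
  simp only [qb, Prod.smul_fst, Prod.smul_snd, smul_dotProduct, Complex.real_smul]; ring

/-- Together with `qb_act_left` this is ⟨pu, w⟩ = p⟨u, w⟩ for a quaternion p, by (c + dj)(a + bj) =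
(ca − d b̄) + (cb + d ā)j. -/
theorem qa_act_left : qa (actSp1 c d u) w = c * qa u w - d * star (qb u w) := by
  simp only [qa, qb, actSp1, add_dotProduct, sub_dotProduct, smul_dotProduct, smul_eq_mul,
    star_sub, star_dot]
  ring

theorem qb_act_left : qb (actSp1 c d u) w = c * qb u w + d * star (qa u w) := by
  simp only [qa, qb, actSp1, add_dotProduct, sub_dotProduct, smul_dotProduct, smul_eq_mul,
    star_add, star_dot, star_star]
  ring

theorem qa_add_right : qa w (u + v) = qa w u + qa w v := by
  simp only [← star_qa _ w, qa_add_left, star_add]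

theorem qa_sub_right : qa w (u - v) = qa w u - qa w v := by
  simp only [← star_qa _ w, qa_sub_left, star_sub]

theorem qa_neg_right : qa w (-u) = -qa w u := by
  simp only [← star_qa _ w, qa_neg_left, star_neg]

theorem qa_smul_right : qa w (r • u) = r * qa w u := by
  simp [← star_qa _ w, qa_smul_left]

theorem qb_add_right : qb w (u + v) = qb w u + qb w v := by
  simp only [qb_swap w, qb_add_left]; ring

theorem qb_sub_right : qb w (u - v) = qb w u - qb w v := by
  simp only [qb_swap w, qb_sub_left]; ring

theorem qb_neg_right : qb w (-u) = -qb w u := by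
  simp only [qb_swap w, qb_neg_left]

theorem qb_smul_right : qb w (r • u) = r * qb w u := by
  simp only [qb_swap w, qb_smul_left]; ring

theorem qa_act_right : qa w (actSp1 c d u) = star c * qa w u + star d * qb w u := by
  rw [← star_qa, qa_act_left, ← star_qa u w, qb_swap u w]
  simp

theorem qb_act_right : qb w (actSp1 c d u) = c * qb w u - d * qa w u := by
  rw [qb_swap, qb_act_left, ← star_qa u w, qb_swap u w]
  ring

theorem pairA_eq : pairA u v = 2 * (qa u v).re := by
  simp only [pairA, inA, qa, Complex.add_re]; ring

theorem pairA_comm : pairA u v = pairA v u := by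
  rw [pairA_eq, pairA_eq, ← star_qa]; rfl

theorem qa_self : qa u u = (nsq u : ℂ) := by
  apply Complex.ext
  · rw [nsq, pairA_eq, Complex.ofReal_re]; ring
  · have := congrArg Complex.im (star_qa u u)
    rw [Complex.ofReal_im]
    have h : (star (qa u u)).im = -(qa u u).im := rfl
    linarith

theorem nsq_eq_sum : nsq u = ∑ i, Complex.normSq (u.1 i) + ∑ i, Complex.normSq (u.2 i) := by
  rw [nsq, pairA_eq]
  simp [qa, dotProduct, Complex.mul_conj]

theorem nsq_nonneg : 0 ≤ nsq u := by
  rw [nsq_eq_sum]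
  exact add_nonneg (Finset.sum_nonneg fun _ _ => Complex.normSq_nonneg _)
    (Finset.sum_nonneg fun _ _ => Complex.normSq_nonneg _)

theorem nsq_eq_zero {u : Fld n} : nsq u = 0 ↔ u = 0 := by
  rw [nsq_eq_sum, add_eq_zero_iff_of_nonneg (Finset.sum_nonneg fun _ _ => Complex.normSq_nonneg _)
    (Finset.sum_nonneg fun _ _ => Complex.normSq_nonneg _),
    Finset.sum_eq_zero_iff_of_nonneg fun _ _ => Complex.normSq_nonneg _,
    Finset.sum_eq_zero_iff_of_nonneg fun _ _ => Complex.normSq_nonneg _]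
  simp [Prod.ext_iff, funext_iff]

theorem nsq_smul : nsq (r • u) = r ^ 2 * nsq u := by
  have h : (nsq (r • u) : ℂ) = ((r ^ 2 * nsq u : ℝ) : ℂ) := by
    rw [← qa_self, qa_smul_left, qa_smul_right, qa_self]; push_cast; ring
  exact_mod_cast h

theorem sgRHS_eq (ε : ℝ) (h : Fld n) : sgRHS ε u h =
    ((1 + ε * rad h) / nsq h) • actSp1 (qa u h) (qb u h) h - (1 - ε * rad h) • u := rfl

theorem uOf_eq (ε : ℝ) (h v : Fld n) : uOf ε h v =
    -(kap ε h • v) + (kap ε h ^ 2 / (2 * (ε * rad h))) • actSp1 (qa v h) (qb v h) h := by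
  have h1 : star h.1 ⬝ᵥ v.1 + star h.2 ⬝ᵥ v.2 = qa v h := by
    simp only [qa, dotProduct_comm]
  have h2 : h.2 ⬝ᵥ v.1 - h.1 ⬝ᵥ v.2 = qb v h := by
    simp only [qb, dotProduct_comm]
  simp only [uOf, h1, h2]
  ext i <;> simp [actSp1] <;> ring

end

/-! ### The radical on the admissible domain -/

section

variable {n : ℕ} {ε : ℝ} {h : Fld n}

theorem Adm.rad_pos (hh : Adm ε h) : 0 < rad h := Real.sqrt_pos.2 (by linarith [hh.1])

theorem Adm.rad_sq (hh : Adm ε h) : rad h ^ 2 = 1 - nsq h := Real.sq_sqrt (by linarith [hh.1])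

theorem Adm.erad_sq (hε : ε = 1 ∨ ε = -1) (hh : Adm ε h) : (ε * rad h) ^ 2 = 1 - nsq h := by
  rw [mul_pow, hh.rad_sq]
  rcases hε with rfl | rfl <;> ring

theorem Adm.erad_ne (hε : ε = 1 ∨ ε = -1) (hh : Adm ε h) : ε * rad h ≠ 0 :=
  mul_ne_zero (by rcases hε with rfl | rfl <;> norm_num) hh.rad_pos.ne'

theorem Adm.one_sub_pos (hε : ε = 1 ∨ ε = -1) (hh : Adm ε h) : 0 < 1 - ε * rad h := by
  have h1 := hh.rad_pos
  have h2 := hh.rad_sq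
  rcases hε with rfl | rfl
  · have h3 : 0 < nsq h :=
      lt_of_le_of_ne (nsq_nonneg h) fun h0 => hh.2 rfl (nsq_eq_zero.1 h0.symm)
    nlinarith
  · linarith

theorem Adm.kap_pos (hε : ε = 1 ∨ ε = -1) (hh : Adm ε h) : 0 < kap ε h :=
  one_div_pos.2 (hh.one_sub_pos hε)

theorem Adm.kap_mul (hε : ε = 1 ∨ ε = -1) (hh : Adm ε h) : kap ε h * (1 - ε * rad h) = 1 :=
  one_div_mul_cancel (hh.one_sub_pos hε).ne'

/-- At h = 0 the quotient in `sgRHS` takes the default value 0 whereas `kap` is 1/2, but both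
multiply the zero vector. The form with `kap` is smooth across h = 0, so all the calculus uses it.
-/
theorem Adm.sgRHS_eq (hε : ε = 1 ∨ ε = -1) (hh : Adm ε h) (u : Fld n) : sgRHS ε u h =
    kap ε h • actSp1 (qa u h) (qb u h) h - (1 - ε * rad h) • u := by
  by_cases h0 : h = 0
  · subst h0
    rw [VectorSG.sgRHS_eq]
    simp [actSp1, ← Prod.zero_eq_mk]
  · rw [VectorSG.sgRHS_eq, kap_eq hε hh.1.le fun h1 => h0 (nsq_eq_zero.1 h1)]

/-- With `y = 1 - ε √(1 - |h|²)`, all the coefficients are rational in `y`. -/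
theorem Adm.exists_den (hε : ε = 1 ∨ ε = -1) (hh : Adm ε h) : ∃ y : ℝ, 0 < y ∧ y ≠ 1 ∧
    ε * rad h = 1 - y ∧ kap ε h = y⁻¹ ∧ nsq h = 2 * y - y ^ 2 :=
  ⟨1 - ε * rad h, hh.one_sub_pos hε, fun hy => hh.erad_ne hε (by linarith), by ring,
    one_div _, by linarith [hh.erad_sq hε]⟩

end

theorem act_fst {n : ℕ} (c d : ℂ) (p : Fld n) (i : Fin (n - 1)) :
    (actSp1 c d p).1 i = c * p.1 i + d * star (p.2 i) := rfl

theorem act_snd {n : ℕ} (c d : ℂ) (p : Fld n) (i : Fin (n - 1)) :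
    (actSp1 c d p).2 i = c * p.2 i - d * star (p.1 i) := rfl

/-- For fixed h the map u ↦ F(u, h) acts by 2(1 − y) on the quaternionic line of h and by −y on the
complement. `uOf` acts there by the reciprocals. -/
theorem eq_sgRHS_iff {n : ℕ} {ε : ℝ} {h : Fld n} (hε : ε = 1 ∨ ε = -1) (hh : Adm ε h)
    (u v : Fld n) : v = sgRHS ε u h ↔ u = uOf ε h v := by
  obtain ⟨y, hy, hy1, he, hk, hν⟩ := hh.exists_den hε
  rw [hh.sgRHS_eq hε, uOf_eq, he, hk]
  have hyc : (y : ℂ) ≠ 0 := by exact_mod_cast hy.ne'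
  have hyc1 : (1 : ℂ) - y ≠ 0 := by
    rw [sub_ne_zero]; exact_mod_cast hy1.symm
  constructor
  · rintro rfl
    simp only [qa_sub_left, qa_smul_left, qa_act_left, qb_sub_left, qb_smul_left, qb_act_left,
      qa_self, qb_self, hν]
    ext i <;>
    simp only [Prod.fst_add, Prod.snd_add, Prod.fst_neg, Prod.snd_neg, Prod.smul_fst,
      Prod.smul_snd, Prod.fst_sub, Prod.snd_sub, Pi.add_apply, Pi.sub_apply, Pi.neg_apply,
      Pi.smul_apply, act_fst, act_snd, Complex.real_smul] <;>
    push_cast <;> simp <;> field_simp <;> ring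
  · rintro hu
    rw [hu]
    simp only [qa_add_left, qa_neg_left, qa_smul_left, qa_act_left, qb_add_left, qb_neg_left,
      qb_smul_left, qb_act_left, qa_self, qb_self, hν]
    ext i <;>
    simp only [Prod.fst_add, Prod.snd_add, Prod.fst_neg, Prod.snd_neg, Prod.smul_fst,
      Prod.smul_snd, Prod.fst_sub, Prod.snd_sub, Pi.add_apply, Pi.sub_apply, Pi.neg_apply,
      Pi.smul_apply, act_fst, act_snd, Complex.real_smul] <;>
    push_cast <;> simp <;> field_simp <;> ring

/-! ### Calculus of bilinear maps between finite-dimensional spaces -/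

section

variable {D E F G : Type*} [NormedAddCommGroup D] [NormedSpace ℝ D]
  [NormedAddCommGroup E] [NormedSpace ℝ E] [FiniteDimensional ℝ E]
  [NormedAddCommGroup F] [NormedSpace ℝ F] [FiniteDimensional ℝ F]
  [NormedAddCommGroup G] [NormedSpace ℝ G]

theorem _root_.IsBilinearMap.isBounded {f : E → F → G} (hf : IsBilinearMap ℝ f) :
    IsBoundedBilinearMap ℝ fun p : E × F => f p.1 p.2 :=
  hf.toContinuousBilinearMap.isBoundedBilinearMap

theorem _root_.IsBilinearMap.hasDerivAt {f : E → F → G} (hf : IsBilinearMap ℝ f) {u : ℝ → E}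
    {v : ℝ → F} {u' : E} {v' : F} {x : ℝ} (hu : HasDerivAt u u' x) (hv : HasDerivAt v v' x) :
    HasDerivAt (fun x => f (u x) (v x)) (f (u x) v' + f u' (v x)) x :=
  HasFDerivAt.comp_hasDerivAt (l := fun p : E × F => f p.1 p.2) (f := fun x => (u x, v x)) x
    (hf.isBounded.hasFDerivAt (u x, v x)) (hu.prodMk hv)

theorem _root_.IsBilinearMap.contDiffOn {f : E → F → G} (hf : IsBilinearMap ℝ f) {u : D → E}
    {v : D → F} {s : Set D} {m : WithTop ℕ∞} (hu : ContDiffOn ℝ m u s) (hv : ContDiffOn ℝ m v s) :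
    ContDiffOn ℝ m (fun x => f (u x) (v x)) s :=
  hf.isBounded.contDiff.comp_contDiffOn (hu.prodMk hv)

end

section

variable {E F G : Type*} [AddCommGroup E] [Module ℝ E] [AddCommGroup F] [Module ℝ F]
  [AddCommGroup G] [Module ℝ G] {f : E → F → G}

theorem _root_.IsBilinearMap.neg_left (hf : IsBilinearMap ℝ f) (x : E) (y : F) :
    f (-x) y = -f x y := by
  rw [← neg_one_smul ℝ x, hf.smul_left, neg_one_smul]

theorem _root_.IsBilinearMap.neg_right (hf : IsBilinearMap ℝ f) (x : E) (y : F) :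
    f x (-y) = -f x y := by
  rw [← neg_one_smul ℝ y, hf.smul_right, neg_one_smul]

theorem _root_.IsBilinearMap.sub_left (hf : IsBilinearMap ℝ f) (x x' : E) (y : F) :
    f (x - x') y = f x y - f x' y := by
  rw [sub_eq_add_neg, hf.add_left, hf.neg_left, sub_eq_add_neg]

theorem _root_.IsBilinearMap.sub_right (hf : IsBilinearMap ℝ f) (x : E) (y y' : F) :
    f x (y - y') = f x y - f x y' := by
  rw [sub_eq_add_neg, hf.add_right, hf.neg_right, sub_eq_add_neg]

theorem _root_.IsBilinearMap.zero_left (hf : IsBilinearMap ℝ f) (y : F) : f 0 y = 0 := by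
  rw [← zero_smul ℝ (0 : E), hf.smul_left, zero_smul]

theorem _root_.IsBilinearMap.zero_right (hf : IsBilinearMap ℝ f) (x : E) : f x 0 = 0 := by
  rw [← zero_smul ℝ (0 : F), hf.smul_right, zero_smul]

end

variable {n : ℕ}

theorem bilin_qa : IsBilinearMap ℝ (qa (n := n)) where
  add_left := qa_add_left
  smul_left r u v := by rw [qa_smul_left, Complex.real_smul]
  add_right _ _ _ := qa_add_right _ _ _
  smul_right r u v := by rw [qa_smul_right, Complex.real_smul]

theorem bilin_qb : IsBilinearMap ℝ (qb (n := n)) where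
  add_left := qb_add_left
  smul_left r u v := by rw [qb_smul_left, Complex.real_smul]
  add_right _ _ _ := qb_add_right _ _ _
  smul_right r u v := by rw [qb_smul_right, Complex.real_smul]

theorem bilin_pairA : IsBilinearMap ℝ (pairA (n := n)) where
  add_left u v w := by simp only [pairA_eq, qa_add_left, Complex.add_re]; ring
  smul_left r u v := by simp [pairA_eq, qa_smul_left]; ring
  add_right u v w := by simp only [pairA_eq, qa_add_right, Complex.add_re]; ring
  smul_right r u v := by simp [pairA_eq, qa_smul_right]; ring

/-- The left action of the quaternions on pairs. -/
def actQ (c : ℂ × ℂ) (p : Fld n) : Fld n := actSp1 c.1 c.2 p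

theorem bilin_actQ : IsBilinearMap ℝ (actQ (n := n)) where
  add_left c d p := by ext i <;> simp [actQ, actSp1] <;> ring
  smul_left r c p := by ext i <;> simp [actQ, actSp1] <;> ring
  add_right c p q := by ext i <;> simp [actQ, actSp1] <;> ring
  smul_right r c p := by ext i <;> simp [actQ, actSp1] <;> ring

theorem brG_fst (u w : Fld n) : (brG u w).1 = (qa u w - qa w u, -(2 * qb u w)) := by
  ext
  · simp only [brG, inC, qa]; ring
  · simp only [brG, inS, qb, dotProduct_comm w.1, dotProduct_comm w.2]; ring

theorem bilin_brG : IsBilinearMap ℝ (brG (n := n)) where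
  add_left u v w := by
    refine Prod.ext ?_ (Prod.ext ?_ ?_)
    · simp only [Prod.fst_add, brG_fst, qa_add_left, qa_add_right, qb_add_left, Prod.mk_add_mk]
      ext <;> simp <;> ring
    all_goals
      ext i j; simp [brG, outC, outS, mconj, Matrix.vecMulVec_apply]; ring
  smul_left r u v := by
    refine Prod.ext ?_ (Prod.ext ?_ ?_)
    · simp only [Prod.smul_fst, brG_fst, qa_smul_left, qa_smul_right, qb_smul_left]
      ext <;> simp <;> ring
    all_goals
      ext i j; simp [brG, outC, outS, mconj, Matrix.vecMulVec_apply]; ring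
  add_right u v w := by
    refine Prod.ext ?_ (Prod.ext ?_ ?_)
    · simp only [Prod.fst_add, brG_fst, qa_add_left, qa_add_right, qb_add_right, Prod.mk_add_mk]
      ext <;> simp <;> ring
    all_goals
      ext i j; simp [brG, outC, outS, mconj, Matrix.vecMulVec_apply]; ring
  smul_right r u v := by
    refine Prod.ext ?_ (Prod.ext ?_ ?_)
    · simp only [Prod.smul_fst, brG_fst, qa_smul_left, qa_smul_right, qb_smul_right]
      ext <;> simp <;> ring
    all_goals
      ext i j; simp [brG, outC, outS, mconj, Matrix.vecMulVec_apply]; ring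

theorem bilin_brB : IsBilinearMap ℝ (brB (n := n)) where
  add_left u v V := by
    ext i <;> simp [brB, mconj, Matrix.vecMul, dotProduct, add_mul, Finset.sum_add_distrib] <;> ring
  smul_left r u V := by
    ext i <;> simp [brB, mconj, Matrix.vecMul, dotProduct, Finset.mul_sum, mul_assoc] <;>
      simp only [mul_add, mul_sub, Finset.mul_sum] <;> ring_nf
  add_right u V W := by
    ext i <;> simp [brB, mconj, Matrix.vecMul, dotProduct, mul_add, Finset.sum_add_distrib] <;> ring
  smul_right r u V := by
    ext i <;> simp [brB, mconj, Matrix.vecMul, dotProduct, Finset.mul_sum, mul_left_comm] <;>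
      simp only [mul_add, mul_sub, Finset.mul_sum] <;> ring_nf

theorem isHPar_brG (u w : Fld n) : IsHPar (brG u w) := by
  refine ⟨?_, ?_, ?_⟩
  · rw [brG_fst, ← star_qa u w]; simp
  · ext i j; simp [brG, outC, mconj, Matrix.vecMulVec_apply]; ring
  · ext i j; simp [brG, outS, mconj, Matrix.vecMulVec_apply]; ring

theorem brG_swap (u w : Fld n) : brG u w = -brG w u := by
  refine Prod.ext ?_ (Prod.ext ?_ ?_)
  · simp only [Prod.fst_neg, brG_fst, qb_swap u w]; ext <;> simp
  all_goals
    ext i j; simp [brG, outC, outS, mconj, Matrix.vecMulVec_apply]; ring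

/-- The quaternions are moved across the matrix part of `brG`. -/
theorem brG_act_snd (c d : ℂ) (u w : Fld n) :
    (brG (actSp1 c d u) w).2 = (brG u (actSp1 (star c) (-d) w)).2 := by
  refine Prod.ext ?_ ?_ <;>
  · ext i j
    simp [brG, outC, outS, mconj, Matrix.vecMulVec_apply, actSp1]
    ring

/-- With V = `brG h q`, the nonlocal term of ℋ is thereby expressed by Hermitian products alone, and
no matrices remain in the identity ℋ(w) = h. -/
theorem brB_brG (u h q : Fld n) : brB u (brG h q) =
    actSp1 (qa q h - qa h q) (2 * qb q h) u + actSp1 (qa u h) (qb u h) q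
      - actSp1 (qa u q) (qb u q) h := by
  have e1 : (brG h q).1.1 = qa h q - qa q h := by rw [brG_fst]
  have e2 : (brG h q).1.2 = 2 * qb q h := by rw [brG_fst, qb_swap h q]; ring
  ext i
  · simp only [brB, e1, e2]
    simp [brG, outC, outS, mconj, actSp1, qa, qb, Matrix.vecMulVec, Matrix.vecMul, dotProduct,
      mul_sub, mul_add, Finset.sum_add_distrib, Finset.mul_sum, Finset.sum_mul, sub_mul, add_mul]
    simp only [mul_comm, mul_left_comm, mul_assoc]
    ring
  · simp only [brB, e1, e2]
    simp [brG, outC, outS, mconj, actSp1, qa, qb, Matrix.vecMulVec, Matrix.vecMul, dotProduct,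
      mul_sub, mul_add, Finset.sum_add_distrib, Finset.mul_sum, Finset.sum_mul, sub_mul, add_mul]
    simp only [mul_comm, mul_left_comm, mul_assoc]
    ring

/-! ### Differentiation of the coefficients -/

section

variable {n : ℕ} {ε : ℝ}

theorem hasDerivAt_nsq {h : ℝ → Fld n} {h' : Fld n} {x : ℝ} (hd : HasDerivAt h h' x) :
    HasDerivAt (fun x => nsq (h x)) (pairA (h x) h') x := by
  refine ((bilin_pairA.hasDerivAt hd hd).div_const 2).congr_deriv ?_
  rw [pairA_comm h']; ring

theorem hasDerivAt_rad {h : ℝ → Fld n} {h' : Fld n} {x : ℝ} (hd : HasDerivAt h h' x)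
    (hh : nsq (h x) < 1) :
    HasDerivAt (fun x => rad (h x)) (-pairA (h x) h' / (2 * rad (h x))) x :=
  ((hasDerivAt_nsq hd).const_sub 1).sqrt (by linarith)

theorem hasDerivAt_den {h : ℝ → Fld n} {h' : Fld n} {x : ℝ} (hε : ε = 1 ∨ ε = -1)
    (hd : HasDerivAt h h' x) (hh : Adm ε (h x)) :
    HasDerivAt (fun x => 1 - ε * rad (h x)) (pairA (h x) h' / (2 * (ε * rad (h x)))) x := by
  refine (((hasDerivAt_rad hd hh.1).const_mul ε).const_sub 1).congr_deriv ?_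
  have h1 := hh.rad_pos.ne'
  rcases hε with rfl | rfl <;> field_simp

theorem hasDerivAt_kap {h : ℝ → Fld n} {h' : Fld n} {x : ℝ} (hε : ε = 1 ∨ ε = -1)
    (hd : HasDerivAt h h' x) (hh : Adm ε (h x)) :
    HasDerivAt (fun x => kap ε (h x))
      (-kap ε (h x) ^ 2 * (pairA (h x) h' / (2 * (ε * rad (h x))))) x := by
  have h1 := (hasDerivAt_den hε hd hh).inv (hh.one_sub_pos hε).ne'
  simp only [kap, one_div]
  refine h1.congr_deriv ?_
  rw [neg_div, neg_mul, inv_pow]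
  ring

theorem hasDerivAt_sgRHS {u h : ℝ → Fld n} {u' h' : Fld n} {x : ℝ} (hε : ε = 1 ∨ ε = -1)
    (hu : HasDerivAt u u' x) (hd : HasDerivAt h h' x) (hh : ∀ᶠ z in nhds x, Adm ε (h z)) :
    HasDerivAt (fun x => sgRHS ε (u x) (h x))
      (kap ε (h x) • (actSp1 (qa (u x) (h x)) (qb (u x) (h x)) h'
          + actSp1 (qa (u x) h' + qa u' (h x)) (qb (u x) h' + qb u' (h x)) (h x))
        + (-kap ε (h x) ^ 2 * (pairA (h x) h' / (2 * (ε * rad (h x))))) •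
          actSp1 (qa (u x) (h x)) (qb (u x) (h x)) (h x)
        - ((1 - ε * rad (h x)) • u' + (pairA (h x) h' / (2 * (ε * rad (h x)))) • u x)) x := by
  have hx := hh.self_of_nhds
  have h1 := bilin_actQ.hasDerivAt ((bilin_qa.hasDerivAt hu hd).prodMk
    (bilin_qb.hasDerivAt hu hd)) hd
  have h2 := ((hasDerivAt_kap hε hd hx).smul h1).sub ((hasDerivAt_den hε hd hx).smul hu)
  refine h2.congr_of_eventuallyEq ?_
  filter_upwards [hh] with z hz
  rw [hz.sgRHS_eq hε]
  rfl

end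

/-! ### The auxiliary linear equation -/

section

variable {n : ℕ}

/-- The coefficient of `h` in the auxiliary equation. -/
def auxCoef (ε : ℝ) (u h q : Fld n) : ℝ :=
  (1 + pairA u q + kap ε h ^ 2 * pairA (actSp1 (qa h u) (qb h u) q) h) / (2 * (ε * rad h))

/-- The right-hand side of the auxiliary equation for `q = uOf ε h w`. -/
def auxRHS (ε : ℝ) (u h q : Fld n) : Fld n :=
  -(kap ε h • (actSp1 (qa h u) (qb h u) q + actSp1 (qa h q) (qb h q) u)) + auxCoef ε u h q • h

variable {ε : ℝ}

theorem qa_ofReal (u v : Fld n) : ((pairA u v : ℝ) : ℂ) = qa u v + qa v u := by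
  rw [pairA_eq, ← star_qa u v]
  exact (Complex.add_conj _).symm ▸ rfl

/-- This makes `brG h q` an antiderivative of `brG u w` for w = F(q, h). The terms with −y cancel by
bilinearity. In the matrix part the multiple of h in `auxRHS` drops out by `brG h h = 0`, and the
rest cancels after moving quaternions across the bracket. The quaternion part is a direct
computation. -/
theorem sgRHS_brG {h : Fld n} (hε : ε = 1 ∨ ε = -1) (hh : Adm ε h) (u q : Fld n) :
    brG (sgRHS ε u h) q + brG h (auxRHS ε u h q) = brG u (sgRHS ε q h) := by
  obtain ⟨y, hy, hy1, he, hk, hν⟩ := hh.exists_den hε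
  have hself : brG h h = 0 := by
    have h2 : (2 : ℝ) • brG h h = 0 := by
      rw [two_smul]
      nth_rewrite 1 [brG_swap]
      exact neg_add_cancel _
    simpa using h2
  refine Prod.ext ?_ ?_
  · rw [hh.sgRHS_eq hε, hh.sgRHS_eq hε, auxRHS]
    simp only [Prod.fst_add, brG_fst, qa_sub_left, qa_smul_left, qa_act_left, qb_sub_left,
      qb_smul_left, qb_act_left, qa_sub_right, qa_smul_right, qa_act_right, qb_sub_right,
      qb_smul_right, qb_act_right, qa_add_left, qa_add_right, qa_neg_left, qa_neg_right,
      qb_add_right, qb_neg_right, qb_self, star_qa]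
    rw [qb_swap u h, qb_swap q h, qb_swap u q]
    ext <;> simp <;> ring
  · have e1 : (brG (actSp1 (qa u h) (qb u h) h) q).2 = (brG h (actSp1 (qa h u) (qb h u) q)).2 := by
      rw [brG_act_snd, star_qa, ← qb_swap]
    have e2 : (brG u (actSp1 (qa q h) (qb q h) h)).2
        = -(brG h (actSp1 (qa h q) (qb h q) u)).2 := by
      rw [brG_swap, Prod.snd_neg, brG_act_snd, star_qa, ← qb_swap]
    rw [hh.sgRHS_eq hε, hh.sgRHS_eq hε, auxRHS]
    have L := bilin_brG (n := n)
    simp only [sub_eq_add_neg, L.add_left, L.add_right, L.smul_left, L.smul_right, L.neg_left,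
      L.neg_right, hself, Prod.snd_add, Prod.snd_neg, Prod.smul_snd, smul_zero, Prod.snd_zero, e1, e2]
    module

/-- The vector form of a solution `q` of the auxiliary equation satisfies `h = w_x + brB u V`. -/
theorem hasDerivAt_sgRHS_aux {h q : ℝ → Fld n} {u : Fld n} {x : ℝ} (hε : ε = 1 ∨ ε = -1)
    (hh : ∀ᶠ z in nhds x, Adm ε (h z)) (hd : HasDerivAt h (sgRHS ε u (h x)) x) {q' : Fld n}
    (hq : HasDerivAt q q' x) :
    HasDerivAt (fun x => sgRHS ε (q x) (h x))
      (h x - brB u (brG (h x) (q x)) + sgRHS ε (q' - auxRHS ε u (h x) (q x)) (h x)) x := by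
  refine (hasDerivAt_sgRHS hε hq hd hh).congr_deriv ?_
  generalize hhx : h x = h0
  generalize q x = q0
  have hx := hh.self_of_nhds
  rw [hhx] at hx
  rw [hx.sgRHS_eq hε, hx.sgRHS_eq hε, brB_brG, auxRHS, auxCoef]
  obtain ⟨y, hy, hy1, he, hk, hν⟩ := hx.exists_den hε
  -- Self-adjointness and F(h, h) = 2 ε √(1 − |h|²) h give y_x = A(u, h) along h_x = F(u, h).
  have hp : pairA h0 (kap ε h0 • actSp1 (qa u h0) (qb u h0) h0 - (1 - ε * rad h0) • u)
      / (2 * (ε * rad h0)) = pairA u h0 := by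
    rw [he, hk, pairA_eq, pairA_eq]
    simp only [qa_sub_right, qa_smul_right, qa_act_right, qa_self, qb_self, hν]
    rw [← star_qa u h0]
    have : (1 : ℝ) - y ≠ 0 := sub_ne_zero.2 hy1.symm
    simp [-Complex.ofReal_sub, -Complex.ofReal_inv, -Complex.ofReal_mul]
    field_simp
    ring
  rw [hp, he, hk]
  have hyc : (y : ℂ) ≠ 0 := by exact_mod_cast hy.ne'
  have hyc1 : (1 : ℂ) - y ≠ 0 := by
    rw [sub_ne_zero]; exact_mod_cast hy1.symm
  simp only [qa_sub_left, qa_smul_left, qa_act_left, qb_sub_left, qb_smul_left, qb_act_left, qa_sub_right,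
      qa_smul_right, qa_act_right, qb_sub_right, qb_smul_right, qb_act_right, qa_add_left, qa_neg_left,
      qb_add_left, qb_neg_left, qa_self, qb_self, hν]
  have s1 := qb_swap h0 q0
  have s2 := qb_swap h0 u
  have s3 := qb_swap u q0
  ext i <;>
  simp only [Prod.fst_add, Prod.snd_add, Prod.fst_neg, Prod.snd_neg, Prod.smul_fst,
    Prod.smul_snd, Prod.fst_sub, Prod.snd_sub, Pi.add_apply, Pi.sub_apply, Pi.neg_apply,
    Pi.smul_apply, act_fst, act_snd, Complex.real_smul] <;>
  push_cast <;>
  simp only [qa_ofReal, qa_act_left, qa_act_right, s1, s2, s3] <;>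
  simp [conj_qa] <;>
  field_simp <;>
  ring

end

/-! ### The adjoint of the linearized system -/

section

variable {n : ℕ} {ε : ℝ}

/-- The first variation of `u`, paired with `w = sgRHS ε q h`, where `g_x` is the linearization of
`h_x = sgRHS ε u h` in the directions `g` and `δu`. -/
theorem pairA_variation {h : Fld n} (hε : ε = 1 ∨ ε = -1) (hh : Adm ε h) {u q g gx δu : Fld n}
    (hgx : gx = kap ε h • (actSp1 (qa u h) (qb u h) g
          + actSp1 (qa u g + qa δu h) (qb u g + qb δu h) h)
        + (-kap ε h ^ 2 * (pairA h g / (2 * (ε * rad h)))) • actSp1 (qa u h) (qb u h) h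
        - ((1 - ε * rad h) • δu + (pairA h g / (2 * (ε * rad h))) • u)) :
    pairA (sgRHS ε q h) δu =
      pairA q gx + pairA (auxRHS ε u h q) g - pairA h g / (2 * (ε * rad h)) := by
  -- Self-adjointness moves F(·, h) from q to δu, and F(δu, h) is g_x minus the derivative of F(u,
  -- ·) at h in the direction g. `auxRHS` is minus the adjoint of that derivative applied to q, plus
  -- h/(2 ε √(1 − |h|²)), which accounts for the last term.
  rw [hgx, hh.sgRHS_eq hε, auxRHS, auxCoef]
  obtain ⟨y, hy, hy1, he, hk, hν⟩ := hh.exists_den hε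
  rw [he, hk]
  have hyc : (y : ℂ) ≠ 0 := by exact_mod_cast hy.ne'
  have hyc1 : (1 : ℂ) - y ≠ 0 := by
    rw [sub_ne_zero]; exact_mod_cast hy1.symm
  apply Complex.ofReal_injective
  push_cast
  simp only [qa_ofReal, qa_sub_left, qa_smul_left, qa_act_left, qa_sub_right, qa_smul_right,
    qa_act_right, qa_add_left, qa_add_right, qa_neg_left, qa_neg_right]
  push_cast
  simp only [qa_ofReal, qa_act_left, qa_act_right, qb_swap h q, qb_swap h u, qb_swap g u,
    qb_swap h δu, qb_swap g q]
  simp [conj_qa]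
  field_simp
  ring

/-! ### Smoothness -/

variable {D : Type*} [NormedAddCommGroup D] [NormedSpace ℝ D] {s : Set D} {m : WithTop ℕ∞}
  {u h q : D → Fld n}

theorem contDiffOn_nsq (hh : ContDiffOn ℝ m h s) : ContDiffOn ℝ m (fun x => nsq (h x)) s :=
  (bilin_pairA.contDiffOn hh hh).div_const 2

theorem contDiffOn_rad (hh : ContDiffOn ℝ m h s) (h1 : ∀ x ∈ s, nsq (h x) < 1) :
    ContDiffOn ℝ m (fun x => rad (h x)) s :=
  (contDiffOn_const.sub (contDiffOn_nsq hh)).sqrt fun x hx => by linarith [h1 x hx]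

theorem contDiffOn_erad (hh : ContDiffOn ℝ m h s) (h1 : ∀ x ∈ s, Adm ε (h x)) :
    ContDiffOn ℝ m (fun x => ε * rad (h x)) s :=
  contDiffOn_const.mul (contDiffOn_rad hh fun x hx => (h1 x hx).1)

theorem contDiffOn_kap (hε : ε = 1 ∨ ε = -1) (hh : ContDiffOn ℝ m h s)
    (h1 : ∀ x ∈ s, Adm ε (h x)) : ContDiffOn ℝ m (fun x => kap ε (h x)) s :=
  contDiffOn_const.div (contDiffOn_const.sub (contDiffOn_erad hh h1)) fun x hx =>
    ((h1 x hx).one_sub_pos hε).ne'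

theorem contDiffOn_actQ {v w : D → Fld n} (hv : ContDiffOn ℝ m v s) (hw : ContDiffOn ℝ m w s)
    (hu : ContDiffOn ℝ m u s) :
    ContDiffOn ℝ m (fun x => actSp1 (qa (v x) (w x)) (qb (v x) (w x)) (u x)) s :=
  bilin_actQ.contDiffOn ((bilin_qa.contDiffOn hv hw).prodMk (bilin_qb.contDiffOn hv hw)) hu

theorem contDiffOn_sgRHS (hε : ε = 1 ∨ ε = -1) (hu : ContDiffOn ℝ m u s)
    (hh : ContDiffOn ℝ m h s) (h1 : ∀ x ∈ s, Adm ε (h x)) :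
    ContDiffOn ℝ m (fun x => sgRHS ε (u x) (h x)) s := by
  refine ContDiffOn.congr ?_ fun x hx => (h1 x hx).sgRHS_eq hε (u x)
  exact ((contDiffOn_kap hε hh h1).smul (contDiffOn_actQ hu hh hh)).sub
    ((contDiffOn_const.sub (contDiffOn_erad hh h1)).smul hu)

theorem contDiffOn_uOf (hε : ε = 1 ∨ ε = -1) (hu : ContDiffOn ℝ m u s)
    (hh : ContDiffOn ℝ m h s) (h1 : ∀ x ∈ s, Adm ε (h x)) :
    ContDiffOn ℝ m (fun x => uOf ε (h x) (u x)) s := by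
  simp only [uOf_eq]
  exact ((contDiffOn_kap hε hh h1).smul hu).neg.add
    ((((contDiffOn_kap hε hh h1).pow 2).div (contDiffOn_const.mul (contDiffOn_erad hh h1))
      fun x hx => mul_ne_zero two_ne_zero ((h1 x hx).erad_ne hε)).smul (contDiffOn_actQ hu hh hh))

theorem contDiffOn_auxRHS (hε : ε = 1 ∨ ε = -1) (hu : ContDiffOn ℝ m u s)
    (hh : ContDiffOn ℝ m h s) (hq : ContDiffOn ℝ m q s) (h1 : ∀ x ∈ s, Adm ε (h x)) :
    ContDiffOn ℝ m (fun x => auxRHS ε (u x) (h x) (q x)) s := by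
  have hk := contDiffOn_kap hε hh h1
  suffices hc : ContDiffOn ℝ m (fun x => auxCoef ε (u x) (h x) (q x)) s from
    (hk.smul ((contDiffOn_actQ hh hu hq).add (contDiffOn_actQ hh hq hu))).neg.add (hc.smul hh)
  exact ((contDiffOn_const.add (bilin_pairA.contDiffOn hu hq)).add
    ((hk.pow 2).mul (bilin_pairA.contDiffOn (contDiffOn_actQ hh hu hq) hh))).div
    (contDiffOn_const.mul (contDiffOn_erad hh h1))
      fun x hx => mul_ne_zero two_ne_zero ((h1 x hx).erad_ne hε)

end

/-! ### Linear differential equations on an open interval -/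

section

variable {E : Type*} [NormedAddCommGroup E] [NormedSpace ℝ E]

/-- Bootstrapping: the equation expresses the derivative through the solution, so each order of
smoothness yields the next. -/
theorem contDiffOn_of_hasDerivAt {X : Set ℝ} (hX : IsOpen X) {f : ℝ → E → E}
    (hf : ∀ (m : ℕ) (q : ℝ → E), ContDiffOn ℝ m q X → ContDiffOn ℝ m (fun x => f x (q x)) X)
    {q : ℝ → E} (hq : ∀ x ∈ X, HasDerivAt q (f x (q x)) x) : ContDiffOn ℝ ∞ q X := by
  rw [contDiffOn_infty]
  intro m
  induction m with
  | zero =>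
    exact contDiffOn_zero.2 fun x hx => (hq x hx).continuousAt.continuousWithinAt
  | succ m ih =>
    rw [Nat.cast_add, Nat.cast_one, contDiffOn_succ_iff_deriv_of_isOpen hX]
    refine ⟨fun x hx => (hq x hx).differentiableAt.differentiableWithinAt, by simp, ?_⟩
    exact (hf m q ih).congr fun x hx => (hq x hx).deriv

end

section

variable {E : Type*} [NormedAddCommGroup E] [NormedSpace ℝ E] {X : Set ℝ}

theorem intervalIntegrable_of_continuousOn {E : Type*} [NormedAddCommGroup E] {X : Set ℝ}
    (hX' : X.OrdConnected) {f : ℝ → E}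
    (hf : ContinuousOn f X) {a b : ℝ} (ha : a ∈ X) (hb : b ∈ X) :
    IntervalIntegrable f volume a b :=
  (hf.mono (hX'.uIcc_subset ha hb)).intervalIntegrable

theorem hasDerivAt_integral_of_continuousOn [CompleteSpace E] (hX : IsOpen X)
    (hX' : X.OrdConnected) {f : ℝ → E} (hf : ContinuousOn f X) {a x : ℝ} (ha : a ∈ X)
    (hx : x ∈ X) : HasDerivAt (fun x => ∫ s in a..x, f s) (f x) x :=
  intervalIntegral.integral_hasDerivAt_right (intervalIntegrable_of_continuousOn hX' hf ha hx)
    (hf.stronglyMeasurableAtFilter hX x hx) (hf.continuousAt (hX.mem_nhds hx))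

/-- Global solvability of linear differential equations on an open interval. -/
theorem exists_hasDerivAt_linear [CompleteSpace E] (hX : IsOpen X) (hX' : X.OrdConnected)
    {A : ℝ → E →L[ℝ] E} {b : ℝ → E} (hA : ContinuousOn A X) (hb : ContinuousOn b X) :
    ∃ q : ℝ → E, ∀ x ∈ X, HasDerivAt q (A x (q x) + b x) x := by
  classical
  rcases X.eq_empty_or_nonempty with rfl | ⟨a, ha⟩
  · exact ⟨0, fun x hx => hx.elim⟩
  -- The solution is sought as W v with v bounded. With L_x = K and W = cosh L, the integral of K W
  -- from a is sinh L, bounded by W on both sides of a. Thus no bound on the coefficients over X is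
  -- needed, and the factor 2 in K yields the contraction constant 1/2. Since W ≥ 1, the
  -- inhomogeneity b is controlled as well.
  let K : ℝ → ℝ := fun s => 2 * (‖A s‖ + ‖b s‖)
  have hK : ContinuousOn K X := continuousOn_const.mul (hA.norm.add hb.norm)
  let L : ℝ → ℝ := fun x => ∫ s in a..x, K s
  have hL : ∀ x ∈ X, HasDerivAt L (K x) x := fun x hx =>
    hasDerivAt_integral_of_continuousOn hX hX' hK ha hx
  have hLc : ContinuousOn L X := fun x hx => (hL x hx).continuousAt.continuousWithinAt
  let W : ℝ → ℝ := fun x => Real.cosh (L x)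
  have hW : ContinuousOn W X := Real.continuous_cosh.comp_continuousOn hLc
  have hW1 : ∀ x, 1 ≤ W x := fun x => Real.one_le_cosh _
  have hW0 : ∀ x, 0 < W x := fun x => Real.cosh_pos _
  have hKW : ∀ x ∈ X, |∫ s in a..x, K s * W s| ≤ W x := by
    intro x hx
    have h1 : ∫ s in a..x, K s * W s = Real.sinh (L x) - Real.sinh (L a) := by
      refine intervalIntegral.integral_eq_sub_of_hasDerivAt (f := fun x => Real.sinh (L x))
        (f' := fun s => K s * W s) (fun s hs => ?_)
        (intervalIntegrable_of_continuousOn hX' (hK.mul hW) ha hx)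
      rw [mul_comm]
      exact (hL s (hX'.uIcc_subset ha hx hs)).sinh
    have h2 : L a = 0 := intervalIntegral.integral_same
    rw [h1, h2, Real.sinh_zero, sub_zero, abs_le]
    have h3 := Real.cosh_sq (L x)
    have h4 := hW0 x
    constructor <;> nlinarith
  -- the integral operator, with the weight `W`
  let ext : (BoundedContinuousFunction X E) → ℝ → E := fun v s =>
    if hs : s ∈ X then v ⟨s, hs⟩ else 0
  have hext : ∀ v, ContinuousOn (ext v) X := by
    intro v
    rw [continuousOn_iff_continuous_domRestrict]
    refine v.continuous.congr fun x => ?_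
    simp [ext, Set.domRestrict]
  have hextn : ∀ v s, ‖ext v s‖ ≤ ‖v‖ := by
    intro v s
    by_cases hs : s ∈ X
    · simp only [ext, hs, dif_pos]; exact v.norm_coe_le_norm _
    · simp [ext, hs]
  let F : (BoundedContinuousFunction X E) → ℝ → E := fun v s => A s (W s • ext v s) + b s
  have hF : ∀ v, ContinuousOn (F v) X := fun v => (hA.clm_apply (hW.smul (hext v))).add hb
  have hI : ∀ v, ContinuousOn (fun x => ∫ s in a..x, F v s) X := fun v x hx =>
    (hasDerivAt_integral_of_continuousOn hX hX' (hF v) ha hx).continuousAt.continuousWithinAt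
  have bound : ∀ (G : ℝ → E) (C : ℝ), 0 ≤ C → (∀ s, ‖G s‖ ≤ C / 2 * (K s * W s)) →
      ∀ x ∈ X, ‖(W x)⁻¹ • ∫ s in a..x, G s‖ ≤ C / 2 := by
    intro G C hC hG x hx
    have h1 : ‖∫ s in a..x, G s‖ ≤ |∫ s in a..x, C / 2 * (K s * W s)| :=
      intervalIntegral.norm_integral_le_abs_of_norm_le (Filter.Eventually.of_forall hG)
        ((intervalIntegrable_of_continuousOn hX' (hK.mul hW) ha hx).const_mul _)
    rw [intervalIntegral.integral_const_mul, abs_mul, abs_of_nonneg (by positivity)] at h1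
    rw [norm_smul, norm_inv, Real.norm_of_nonneg (hW0 x).le, inv_mul_le_iff₀ (hW0 x)]
    nlinarith [hKW x hx]
  -- The Picard operator conjugated by multiplication with W, acting on bounded continuous functions
  -- on X.
  let T : BoundedContinuousFunction X E → BoundedContinuousFunction X E := fun v =>
    BoundedContinuousFunction.ofNormedAddCommGroup
      (fun x : X => (W x)⁻¹ • ∫ s in a..x, F v s)
      (continuousOn_iff_continuous_domRestrict.1
        ((hW.inv₀ fun x _ => (hW0 x).ne').smul (hI v))) ((‖v‖ + 1) / 2) (fun x => by
        refine bound _ (‖v‖ + 1) (by positivity) (fun s => ?_) x x.2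
        have h1 : ‖F v s‖ ≤ ‖A s‖ * (W s * ‖v‖) + ‖b s‖ := by
          refine (norm_add_le _ _).trans (add_le_add_left ((A s).le_opNorm_of_le ?_) _)
          rw [norm_smul, Real.norm_of_nonneg (hW0 s).le]
          exact mul_le_mul_of_nonneg_left (hextn v s) (hW0 s).le
        refine h1.trans ?_
        have h2 : ‖b s‖ ≤ ‖b s‖ * W s := le_mul_of_one_le_right (norm_nonneg _) (hW1 s)
        have h3 : 0 ≤ ‖A s‖ * W s := mul_nonneg (norm_nonneg _) (hW0 s).le
        have h4 : 0 ≤ ‖b s‖ * W s * ‖v‖ := by have := hW0 s; positivity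
        simp only [K]
        linarith)
  have hT : ContractingWith (1 / 2) T := by
    refine ⟨by norm_num, LipschitzWith.of_dist_le_mul fun v w => ?_⟩
    rw [BoundedContinuousFunction.dist_le (by positivity)]
    intro x
    have h1 : T v x - T w x = (W x)⁻¹ • ∫ s in a..x, (F v s - F w s) := by
      rw [intervalIntegral.integral_sub (intervalIntegrable_of_continuousOn hX' (hF v) ha x.2)
        (intervalIntegrable_of_continuousOn hX' (hF w) ha x.2), smul_sub]
      rfl
    rw [dist_eq_norm, h1]
    refine (bound _ (dist v w) dist_nonneg (fun s => ?_) x x.2).trans (by push_cast; linarith)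
    have h2 : F v s - F w s = A s (W s • ext (v - w) s) := by
      have : ext (v - w) s = ext v s - ext w s := by
        by_cases hs : s ∈ X <;> simp [ext, hs]
      simp only [F, this, smul_sub, map_sub]
      abel
    rw [h2, dist_eq_norm]
    have h3 : ‖A s (W s • ext (v - w) s)‖ ≤ ‖A s‖ * (W s * ‖v - w‖) := by
      refine (A s).le_opNorm_of_le ?_
      rw [norm_smul, Real.norm_of_nonneg (hW0 s).le]
      exact mul_le_mul_of_nonneg_left (hextn _ s) (hW0 s).le
    refine h3.trans ?_
    have h4 : 0 ≤ ‖b s‖ * W s * ‖v - w‖ := by have := hW0 s; positivity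
    simp only [K]
    linarith
  let v := ContractingWith.fixedPoint T hT
  have hv : T v = v := hT.fixedPoint_isFixedPt
  refine ⟨fun x => ∫ s in a..x, F v s, fun x hx => ?_⟩
  have h1 := hasDerivAt_integral_of_continuousOn hX hX' (hF v) ha hx
  have h2 : W x • ext v x = ∫ s in a..x, F v s := by
    have h3 : ext v x = (W x)⁻¹ • ∫ s in a..x, F v s := by
      have : ext v x = T v ⟨x, hx⟩ := by rw [hv]; simp [ext, hx]
      exact this
    rw [h3, smul_inv_smul₀ (hW0 x).ne']
  refine h1.congr_deriv ?_
  simp only [← h2, F]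

end

/-! ### Global solutions of the auxiliary equation -/

section

variable {n : ℕ} {ε : ℝ} {X : Set ℝ}

/-- The equation is affine in q. The value at q = 0 comes from the summand 1 in `auxCoef`, that is,
from the variation of the Hamiltonian density. -/
theorem auxRHS_isLinear (ε : ℝ) (u h : Fld n) :
    IsLinearMap ℝ fun q => auxRHS ε u h q - auxRHS ε u h 0 := by
  have Q := bilin_actQ (n := n)
  have ha := bilin_qa (n := n)
  have hb := bilin_qb (n := n)
  have hp := bilin_pairA (n := n)
  have e : ∀ q, auxRHS ε u h q - auxRHS ε u h 0 =
      -(kap ε h • (actQ (qa h u, qb h u) q + actQ (qa h q, qb h q) u)) +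
      ((pairA u q + kap ε h ^ 2 * pairA (actQ (qa h u, qb h u) q) h) / (2 * (ε * rad h))) • h := by
    intro q
    have h0 : actSp1 (qa h u) (qb h u) (0 : Fld n) = 0 := Q.zero_right (qa h u, qb h u)
    have h1 : actSp1 0 0 u = 0 := Q.zero_left u
    simp only [auxRHS, auxCoef, h0, h1, ha.zero_right, hb.zero_right, hp.zero_right, hp.zero_left,
      actQ]
    module
  constructor
  · intro p q
    rw [e, e, e]
    simp only [ha.add_right, hb.add_right, hp.add_right, ← Prod.mk_add_mk, Q.add_right,
      Q.add_left, hp.add_left]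
    module
  · intro c q
    rw [e, e]
    simp only [ha.smul_right, hb.smul_right, hp.smul_right, ← Prod.smul_mk, Q.smul_right,
      Q.smul_left, hp.smul_left, smul_eq_mul]
    module

theorem exists_auxRHS (hX : IsOpen X) (hX' : X.OrdConnected) (hε : ε = 1 ∨ ε = -1)
    {u h : ℝ → Fld n} (hu : ContDiffOn ℝ ∞ u X) (hh : ContDiffOn ℝ ∞ h X)
    (h1 : ∀ x ∈ X, Adm ε (h x)) :
    ∃ q : ℝ → Fld n, ∀ x ∈ X, HasDerivAt q (auxRHS ε (u x) (h x) (q x)) x := by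
  have hc : ∀ q : Fld n, ContinuousOn (fun x => auxRHS ε (u x) (h x) q) X := fun q =>
    (contDiffOn_auxRHS hε hu hh contDiffOn_const h1).continuousOn
  obtain ⟨q, hq⟩ := exists_hasDerivAt_linear hX hX'
    (A := fun x => (auxRHS_isLinear ε (u x) (h x)).mk'.toContinuousLinearMap)
    (continuousOn_clm_apply.2 fun q => (hc q).sub (hc 0)) (hc 0)
  refine ⟨q, fun x hx => (hq x hx).congr_deriv ?_⟩
  simp

end

/-! ### Functions of two variables -/

section

variable {E : Type*} [NormedAddCommGroup E] [NormedSpace ℝ E] {T X : Set ℝ} {f : ℝ → ℝ → E}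

theorem Smooth2.hasDerivAt_fst (hT : IsOpen T) (hX : IsOpen X) (hf : Smooth2 T X f) {t x : ℝ}
    (ht : t ∈ T) (hx : x ∈ X) :
    HasDerivAt (fun s => f s x) (fderiv ℝ (fun p : ℝ × ℝ => f p.1 p.2) (t, x) (1, 0)) t := by
  have h1 := ((hf.contDiffAt ((hT.prod hX).mem_nhds (Set.mk_mem_prod ht hx))).differentiableAt
    (by simp)).hasFDerivAt
  exact HasFDerivAt.comp_hasDerivAt (l := fun p : ℝ × ℝ => f p.1 p.2) (f := fun s => (s, x)) t h1
    ((hasDerivAt_id t).prodMk (hasDerivAt_const t x))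

theorem Smooth2.hasDerivAt_snd (hT : IsOpen T) (hX : IsOpen X) (hf : Smooth2 T X f) {t x : ℝ}
    (ht : t ∈ T) (hx : x ∈ X) :
    HasDerivAt (f t) (fderiv ℝ (fun p : ℝ × ℝ => f p.1 p.2) (t, x) (0, 1)) x := by
  have h1 := ((hf.contDiffAt ((hT.prod hX).mem_nhds (Set.mk_mem_prod ht hx))).differentiableAt
    (by simp)).hasFDerivAt
  exact HasFDerivAt.comp_hasDerivAt (l := fun p : ℝ × ℝ => f p.1 p.2) (f := fun y => (t, y)) x h1
    ((hasDerivAt_const x t).prodMk (hasDerivAt_id x))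

theorem Smooth2.hasDerivAt_Dt (hT : IsOpen T) (hX : IsOpen X) (hf : Smooth2 T X f) {t x : ℝ}
    (ht : t ∈ T) (hx : x ∈ X) : HasDerivAt (fun s => f s x) (Dt f t x) t :=
  (hf.hasDerivAt_fst hT hX ht hx).differentiableAt.hasDerivAt

theorem Smooth2.hasDerivAt_deriv (hT : IsOpen T) (hX : IsOpen X) (hf : Smooth2 T X f) {t x : ℝ}
    (ht : t ∈ T) (hx : x ∈ X) : HasDerivAt (f t) (deriv (f t) x) x :=
  (hf.hasDerivAt_snd hT hX ht hx).differentiableAt.hasDerivAt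

theorem Smooth2.fderiv_apply (hT : IsOpen T) (hX : IsOpen X) (hf : Smooth2 T X f) (v : ℝ × ℝ) :
    ContDiffOn ℝ ∞ (fun p => fderiv ℝ (fun p : ℝ × ℝ => f p.1 p.2) p v) (T ×ˢ X) :=
  (ContDiffOn.fderiv_of_isOpen (m := ∞) hf (hT.prod hX) (by simp)).clm_apply contDiffOn_const

theorem Smooth2.smooth2_Dt (hT : IsOpen T) (hX : IsOpen X) (hf : Smooth2 T X f) :
    Smooth2 T X (Dt f) :=
  (hf.fderiv_apply hT hX (1, 0)).congr fun _ hp => (hf.hasDerivAt_fst hT hX hp.1 hp.2).deriv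

theorem Smooth2.smooth2_deriv (hT : IsOpen T) (hX : IsOpen X) (hf : Smooth2 T X f) :
    Smooth2 T X (fun t x => deriv (f t) x) :=
  (hf.fderiv_apply hT hX (0, 1)).congr fun _ hp => (hf.hasDerivAt_snd hT hX hp.1 hp.2).deriv

theorem Smooth2.contDiffOn_snd (hf : Smooth2 T X f) {t : ℝ} (ht : t ∈ T) :
    ContDiffOn ℝ ∞ (f t) X :=
  ContDiffOn.comp (g := fun p : ℝ × ℝ => f p.1 p.2) hf
    (contDiffOn_const.prodMk contDiffOn_id) fun _ hx => ⟨ht, hx⟩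

/-- The mixed partial derivatives agree. -/
theorem Smooth2.hasDerivAt_mixed (hT : IsOpen T) (hX : IsOpen X) (hf : Smooth2 T X f) {t x : ℝ}
    (ht : t ∈ T) (hx : x ∈ X) :
    HasDerivAt (fun s => deriv (f s) x) (deriv (Dt f t) x) t := by
  have hm := (hT.prod hX).mem_nhds (Set.mk_mem_prod ht hx)
  have hsymm : IsSymmSndFDerivAt ℝ (fun p : ℝ × ℝ => f p.1 p.2) (t, x) :=
    (hf.contDiffAt hm).isSymmSndFDerivAt (by
      rw [minSmoothness_of_isRCLikeNormedField]
      exact WithTop.coe_le_coe.2 le_top)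
  have hd : DifferentiableAt ℝ (fderiv ℝ (fun p : ℝ × ℝ => f p.1 p.2)) (t, x) :=
    ((ContDiffOn.fderiv_of_isOpen (m := ∞) hf (hT.prod hX) (by simp)).contDiffAt
      hm).differentiableAt (by simp)
  have h1 : HasDerivAt (fun s => fderiv ℝ (fun p : ℝ × ℝ => f p.1 p.2) (s, x) (0, 1))
      (fderiv ℝ (fderiv ℝ (fun p : ℝ × ℝ => f p.1 p.2)) (t, x) (1, 0) (0, 1)) t :=
    (ContinuousLinearMap.apply ℝ E ((0, 1) : ℝ × ℝ)).hasFDerivAt.comp_hasDerivAt t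
      (HasFDerivAt.comp_hasDerivAt (l := fderiv ℝ (fun p : ℝ × ℝ => f p.1 p.2))
        (f := fun s => (s, x)) t hd.hasFDerivAt
        ((hasDerivAt_id t).prodMk (hasDerivAt_const t x)))
  have h2 : HasDerivAt (fun y => fderiv ℝ (fun p : ℝ × ℝ => f p.1 p.2) (t, y) (1, 0))
      (fderiv ℝ (fderiv ℝ (fun p : ℝ × ℝ => f p.1 p.2)) (t, x) (0, 1) (1, 0)) x :=
    (ContinuousLinearMap.apply ℝ E ((1, 0) : ℝ × ℝ)).hasFDerivAt.comp_hasDerivAt x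
      (HasFDerivAt.comp_hasDerivAt (l := fderiv ℝ (fun p : ℝ × ℝ => f p.1 p.2))
        (f := fun y => (t, y)) x hd.hasFDerivAt
        ((hasDerivAt_const x t).prodMk (hasDerivAt_id x)))
  have h3 : deriv (Dt f t) x =
      fderiv ℝ (fderiv ℝ (fun p : ℝ × ℝ => f p.1 p.2)) (t, x) (0, 1) (1, 0) := by
    refine (h2.congr_of_eventuallyEq ?_).deriv
    filter_upwards [hX.mem_nhds hx] with y hy
    exact (hf.hasDerivAt_fst hT hX ht hy).deriv
  rw [h3, ← hsymm.eq]
  refine h1.congr_of_eventuallyEq ?_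
  filter_upwards [hT.mem_nhds ht] with s hs
  exact (hf.hasDerivAt_snd hT hX hs hx).deriv

end

/-! ### Integrals of compactly supported functions on an open set -/

section

variable {E : Type*} [NormedAddCommGroup E] [NormedSpace ℝ E] {X K : Set ℝ}

theorem integrableOn_of_eq_zero {E : Type*} [NormedAddCommGroup E] {X K : Set ℝ} (hX : IsOpen X)
    (hK : IsCompact K) (hKX : K ⊆ X) {f : ℝ → E}
    (hf : ContinuousOn f X) (h0 : ∀ x ∈ X \ K, f x = 0) : IntegrableOn f X :=
  ((hf.mono hKX).integrableOn_compact hK).of_forall_sdiff_eq_zero hX.measurableSet h0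

theorem deriv_eq_zero_of_eq_zero (hX : IsOpen X) (hK : IsCompact K)
    {f : ℝ → E} {f' : E} (h0 : ∀ x ∈ X \ K, f x = 0) {x : ℝ} (hx : x ∈ X \ K)
    (hf : HasDerivAt f f' x) : f' = 0 := by
  refine hf.unique ((hasDerivAt_const x (0 : E)).congr_of_eventuallyEq ?_)
  filter_upwards [(hX.sdiff hK.isClosed).mem_nhds hx] with y hy
  exact h0 y hy

theorem integral_hasDerivAt_eq_zero (hX : IsOpen X) (hK : IsCompact K) (hKX : K ⊆ X)
    {f f' : ℝ → E} (hf : ∀ x ∈ X, HasDerivAt f (f' x) x) (hf' : ContinuousOn f' X)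
    (h0 : ∀ x ∈ X \ K, f x = 0) : ∫ x in X, f' x = 0 := by
  have hfc : ContinuousOn f X := fun x hx => (hf x hx).continuousAt.continuousWithinAt
  have h0' : ∀ x ∈ X \ K, f' x = 0 := fun x hx =>
    deriv_eq_zero_of_eq_zero hX hK h0 hx (hf x hx.1)
  rw [← integral_indicator hX.measurableSet]
  -- The extension by zero is differentiable on all of ℝ, since a point outside X has a
  -- neighbourhood disjoint from K, on which the extension vanishes.
  refine integral_eq_zero_of_hasDerivAt_of_integrable (f := X.indicator f) (fun x => ?_)
    ((integrable_indicator_iff hX.measurableSet).2 (integrableOn_of_eq_zero hX hK hKX hf' h0'))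
    ((integrable_indicator_iff hX.measurableSet).2 (integrableOn_of_eq_zero hX hK hKX hfc h0))
  by_cases hx : x ∈ X
  · rw [Set.indicator_of_mem hx]
    refine (hf x hx).congr_of_eventuallyEq ?_
    filter_upwards [hX.mem_nhds hx] with y hy
    exact Set.indicator_of_mem hy f
  · rw [Set.indicator_of_notMem hx]
    refine (hasDerivAt_const x (0 : E)).congr_of_eventuallyEq ?_
    filter_upwards [hK.isClosed.isOpen_compl.mem_nhds fun h => hx (hKX h)] with y hy
    by_cases hyX : y ∈ X
    · rw [Set.indicator_of_mem hyX, h0 y ⟨hyX, hy⟩]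
    · exact Set.indicator_of_notMem hyX f

theorem hasDerivAt_integral_smooth2 (hX : IsOpen X) (hK : IsCompact K) (hKX : K ⊆ X)
    {f : ℝ → ℝ → E} (hf : Smooth2 Set.univ X f) (h0 : ∀ s, ∀ x ∈ X \ K, f s x = 0) :
    HasDerivAt (fun s => ∫ x in X, f s x) (∫ x in X, Dt f 0 x) 0 := by
  have hD := hf.smooth2_Dt isOpen_univ hX
  have hD0 : ∀ s, ∀ x ∈ X \ K, Dt f s x = 0 := fun s x hx => by
    rw [Dt, funext fun s => h0 s x hx, deriv_const]
  obtain ⟨C, hC⟩ := ((isCompact_Icc (a := (-1 : ℝ)) (b := 1)).prod hK).exists_bound_of_continuousOn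
    (hD.continuousOn.mono (Set.prod_mono (Set.subset_univ _) hKX))
  have hm : ∀ {s : ℝ} {g : ℝ → E}, ContDiffOn ℝ ∞ g X →
      AEStronglyMeasurable g (volume.restrict X) := fun hg =>
    hg.continuousOn.aestronglyMeasurable hX.measurableSet
  refine (hasDerivAt_integral_of_dominated_loc_of_deriv_le (F' := Dt f)
    (bound := K.indicator fun _ => C) (s := Set.Icc (-1) 1)
    (Icc_mem_nhds (by norm_num) (by norm_num)) (Filter.Eventually.of_forall fun s =>
      hm (s := s) (hf.contDiffOn_snd (Set.mem_univ s))) ?_ ?_ ?_ ?_ ?_).2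
  · exact integrableOn_of_eq_zero hX hK hKX
      (hf.contDiffOn_snd (Set.mem_univ _)).continuousOn (h0 0)
  · exact hm (s := 0) (hD.contDiffOn_snd (Set.mem_univ 0))
  · refine (ae_restrict_mem hX.measurableSet).mono fun x hx s hs => ?_
    by_cases hxK : x ∈ K
    · rw [Set.indicator_of_mem hxK]
      exact hC (s, x) ⟨hs, hxK⟩
    · rw [Set.indicator_of_notMem hxK, hD0 s x ⟨hx, hxK⟩, norm_zero]
  · refine Integrable.integrableOn ?_
    rw [integrable_indicator_iff hK.measurableSet]
    exact integrableOn_const hK.measure_lt_top.ne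
  · exact (ae_restrict_mem hX.measurableSet).mono fun x hx s _ =>
      hf.hasDerivAt_Dt isOpen_univ hX (Set.mem_univ s) hx

end

/-! ### The variational derivative of the Hamiltonian -/

section

variable {n : ℕ} {ε κ : ℝ} {X K : Set ℝ}

theorem contDiffOn_deriv {E : Type*} [NormedAddCommGroup E] [NormedSpace ℝ E] (hX : IsOpen X)
    {f : ℝ → E} (hf : ContDiffOn ℝ ∞ f X) : ContDiffOn ℝ ∞ (deriv f) X :=
  hf.deriv_of_isOpen hX (by simp)

theorem hasDerivAt_of_contDiffOn {E : Type*} [NormedAddCommGroup E] [NormedSpace ℝ E]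
    (hX : IsOpen X) {f : ℝ → E} (hf : ContDiffOn ℝ ∞ f X) {x : ℝ} (hx : x ∈ X) :
    HasDerivAt f (deriv f x) x :=
  ((hf.contDiffAt (hX.mem_nhds hx)).differentiableAt (by simp)).hasDerivAt

/-- The first variation of the Hamiltonian, compared with the pairing of `w = sgRHS ε q h` with
the variation of `u`. -/
theorem hasDerivAt_hamiltonian (hX : IsOpen X) (hε : ε = 1 ∨ ε = -1)
    {η : ℝ → ℝ → Fld n} {u h q : ℝ → Fld n} (hη : Smooth2 Set.univ X η)
    (hA : ∀ s, ∀ x ∈ X, Adm ε (η s x)) (h0 : ∀ x ∈ X, η 0 x = h x)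
    (hu : ∀ x ∈ X, u x = uOf ε (h x) (deriv h x))
    (hK : IsCompact K) (hKX : K ⊆ X) (hs : ∀ s, ∀ x ∈ X \ K, η s x = h x)
    (hq : ContDiffOn ℝ ∞ q X) :
    HasDerivAt (fun s => ∫ x in X, (hamDensity κ ε (η s x) - hamDensity κ ε (h x)))
      (κ * ((∫ x in X, pairA (sgRHS ε (q x) (h x))
          (deriv (fun s => uOf ε (η s x) (deriv (η s) x)) 0))
        + ∫ x in X, pairA (deriv q x - auxRHS ε (u x) (h x) (q x)) (Dt η 0 x))) 0 := by
  have hh : ContDiffOn ℝ ∞ h X :=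
    (hη.contDiffOn_snd (Set.mem_univ 0)).congr fun x hx => (h0 x hx).symm
  have hhA : ∀ x ∈ X, Adm ε (h x) := fun x hx => h0 x hx ▸ hA 0 x hx
  have huc : ContDiffOn ℝ ∞ u X :=
    (contDiffOn_uOf hε (contDiffOn_deriv hX hh) hh hhA).congr hu
  have hη' := hη.smooth2_deriv isOpen_univ hX
  have hU : Smooth2 Set.univ X fun s x => uOf ε (η s x) (deriv (η s) x) :=
    contDiffOn_uOf hε hη' hη fun p hp => hA p.1 p.2 hp.2
  have hg : ContDiffOn ℝ ∞ (Dt η 0) X :=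
    (hη.smooth2_Dt isOpen_univ hX).contDiffOn_snd (Set.mem_univ 0)
  have hg0 : ∀ x ∈ X \ K, Dt η 0 x = 0 := fun x hx => by
    rw [Dt, funext fun s => hs s x hx, deriv_const]
  have hdens : Smooth2 Set.univ X fun s x => hamDensity κ ε (η s x) - hamDensity κ ε (h x) := by
    simp only [hamDensity, mul_assoc]
    refine (contDiffOn_const.mul (contDiffOn_erad hη fun p hp => hA p.1 p.2 hp.2)).sub
      (contDiffOn_const.mul (contDiffOn_erad (hh.comp contDiffOn_snd fun p hp => hp.2)
        fun p hp => hhA p.2 hp.2))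
  refine (hasDerivAt_integral_smooth2 hX hK hKX hdens fun s x hx => by
    rw [hs s x hx, sub_self]).congr_deriv ?_
  -- the pointwise identity
  have hRc := contDiffOn_auxRHS hε huc hh hq hhA
  have hq'c := contDiffOn_deriv hX hq
  have key : ∀ x ∈ X, pairA (sgRHS ε (q x) (h x))
      (deriv (fun s => uOf ε (η s x) (deriv (η s) x)) 0) = (pairA (q x) (deriv (Dt η 0) x)
      + pairA (deriv q x) (Dt η 0 x))
      - pairA (deriv q x - auxRHS ε (u x) (h x) (q x)) (Dt η 0 x)
      - pairA (h x) (Dt η 0 x) / (2 * (ε * rad (h x))) := by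
    intro x hx
    have e1 : HasDerivAt (fun s => deriv (η s) x) (deriv (Dt η 0) x) 0 :=
      hη.hasDerivAt_mixed isOpen_univ hX (Set.mem_univ 0) hx
    have e2 := hasDerivAt_sgRHS hε (hU.hasDerivAt_Dt isOpen_univ hX (Set.mem_univ 0) hx)
      (hη.hasDerivAt_Dt isOpen_univ hX (Set.mem_univ 0) hx)
      (Filter.Eventually.of_forall fun s => hA s x hx)
    -- By definition of the induced variation of u, every member of the family satisfies η_x = F(u,
    -- η). Differentiating in s therefore gives the linearized equation for g = η_s at s = 0.
    have e3 : (fun s => deriv (η s) x) =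
        fun s => sgRHS ε (uOf ε (η s x) (deriv (η s) x)) (η s x) :=
      funext fun s => (eq_sgRHS_iff hε (hA s x hx) _ _).2 rfl
    rw [e3] at e1
    have e4 : deriv (η 0) x = deriv h x := by
      refine Filter.EventuallyEq.deriv_eq ?_
      filter_upwards [hX.mem_nhds hx] with y hy using h0 y hy
    have e5 := e1.unique e2
    rw [e4, h0 x hx, ← hu x hx] at e5
    have e6 := pairA_variation hε (hhA x hx) (q := q x) e5
    refine e6.trans ?_
    rw [bilin_pairA.sub_left]
    ring
  have hdt : ∀ x ∈ X, Dt (fun s x => hamDensity κ ε (η s x) - hamDensity κ ε (h x)) 0 x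
      = κ * -(pairA (h x) (Dt η 0 x) / (2 * (ε * rad (h x)))) := by
    intro x hx
    have e1 := hasDerivAt_den hε (hη.hasDerivAt_Dt isOpen_univ hX (Set.mem_univ 0) hx)
      (hA 0 x hx)
    have e2 := (((e1.const_sub 1).const_mul κ).sub_const (hamDensity κ ε (h x))).deriv
    rw [h0 x hx] at e2
    rw [← e2]
    refine congrArg (fun f => deriv f 0) (funext fun s => ?_)
    simp only [hamDensity]
    ring
  rw [setIntegral_congr_fun hX.measurableSet hdt, integral_const_mul]
  congr 1
  have z0 : ∀ x ∈ X \ K, deriv (Dt η 0) x = 0 := fun x hx =>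
    deriv_eq_zero_of_eq_zero hX hK hg0 hx (hasDerivAt_of_contDiffOn hX hg hx.1)
  -- Integration by parts: the integrand is the x-derivative of A(q, g), and g vanishes off K.
  have i1 : ∫ x in X, (pairA (q x) (deriv (Dt η 0) x) + pairA (deriv q x) (Dt η 0 x)) = 0 := by
    refine integral_hasDerivAt_eq_zero hX hK hKX (f := fun x => pairA (q x) (Dt η 0 x))
      (fun x hx => bilin_pairA.hasDerivAt (hasDerivAt_of_contDiffOn hX hq hx)
        (hasDerivAt_of_contDiffOn hX hg hx)) ?_ fun x hx => by
        rw [hg0 x hx, bilin_pairA.zero_right]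
    exact ((bilin_pairA.contDiffOn hq (contDiffOn_deriv hX hg)).add
      (bilin_pairA.contDiffOn hq'c hg)).continuousOn
  have I1 : IntegrableOn (fun x => pairA (q x) (deriv (Dt η 0) x)
      + pairA (deriv q x) (Dt η 0 x)) X := by
    refine integrableOn_of_eq_zero hX hK hKX
      ((bilin_pairA.contDiffOn hq (contDiffOn_deriv hX hg)).add
      (bilin_pairA.contDiffOn hq'c hg)).continuousOn fun x hx => ?_
    rw [hg0 x hx, z0 x hx, bilin_pairA.zero_right, bilin_pairA.zero_right, add_zero]
  have I2 : IntegrableOn (fun x =>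
      pairA (deriv q x - auxRHS ε (u x) (h x) (q x)) (Dt η 0 x)) X := by
    refine integrableOn_of_eq_zero hX hK hKX
      (bilin_pairA.contDiffOn (hq'c.sub hRc) hg).continuousOn fun x hx => ?_
    rw [hg0 x hx, bilin_pairA.zero_right]
  have I3 : IntegrableOn (fun x => pairA (h x) (Dt η 0 x) / (2 * (ε * rad (h x)))) X := by
    refine integrableOn_of_eq_zero hX hK hKX
      ((bilin_pairA.contDiffOn hh hg).div (contDiffOn_const.mul (contDiffOn_erad hh hhA))
        fun x hx => mul_ne_zero two_ne_zero ((hhA x hx).erad_ne hε)).continuousOn fun x hx => ?_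
    rw [hg0 x hx, bilin_pairA.zero_right, zero_div]
  have e1 := integral_sub (I1.sub I2) I3
  have e2 := integral_sub I1 I2
  simp only [Pi.sub_apply] at e1
  rw [setIntegral_congr_fun hX.measurableSet key, e1, e2, i1, integral_neg]
  ring

theorem isVarDeriv_of_auxRHS (hX : IsOpen X) (hε : ε = 1 ∨ ε = -1) {u h q : ℝ → Fld n}
    (hu : ∀ x ∈ X, u x = uOf ε (h x) (deriv h x)) (hqc : ContDiffOn ℝ ∞ q X)
    (hq : ∀ x ∈ X, HasDerivAt q (auxRHS ε (u x) (h x) (q x)) x) :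
    IsVarDeriv κ ε X h fun x => sgRHS ε (q x) (h x) := by
  intro η K hη hA h0 hK hKX hs
  refine (hasDerivAt_hamiltonian hX hε hη hA h0 hu hK hKX hs hqc).congr_deriv ?_
  have : ∫ x in X, pairA (deriv q x - auxRHS ε (u x) (h x) (q x)) (Dt η 0 x) = 0 := by
    rw [setIntegral_congr_fun hX.measurableSet (g := fun _ => (0 : ℝ)) fun x hx => ?_]
    · simp
    · simp only [(hq x hx).deriv, sub_self, bilin_pairA.zero_left]
  rw [this, add_zero]

theorem isOpen_adm (ε : ℝ) : IsOpen {h : Fld n | Adm ε h} := by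
  have h1 : Continuous (nsq (n := n)) :=
    contDiffOn_univ.1 (contDiffOn_nsq (m := 0) (contDiff_id.contDiffOn)) |>.continuous
  have h2 : IsOpen {h : Fld n | ε = 1 → h ≠ 0} := by
    by_cases he : ε = 1
    · simpa [he] using isOpen_ne
    · simp [he]
  exact (isOpen_lt h1 continuous_const).inter h2

/-- The converse of `isVarDeriv_of_auxRHS`, by the fundamental lemma of the calculus of variations:
the defect e = q_x − `auxRHS` is orthogonal to every admissible variation of h, and test functions
in each constant direction v force e = 0. -/
theorem hasDerivAt_auxRHS_of_isVarDeriv (hX : IsOpen X) (hε : ε = 1 ∨ ε = -1) (hκ : κ ≠ 0)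
    {u h w : ℝ → Fld n} (hh : ContDiffOn ℝ ∞ h X) (hA : ∀ x ∈ X, Adm ε (h x))
    (hu : ∀ x ∈ X, u x = uOf ε (h x) (deriv h x)) (hw : ContDiffOn ℝ ∞ w X)
    (hv : IsVarDeriv κ ε X h w) {x : ℝ} (hx : x ∈ X) :
    HasDerivAt (fun x => uOf ε (h x) (w x))
      (auxRHS ε (u x) (h x) (uOf ε (h x) (w x))) x := by
  have hqc : ContDiffOn ℝ ∞ (fun x => uOf ε (h x) (w x)) X := contDiffOn_uOf hε hw hh hA
  set q := fun x => uOf ε (h x) (w x) with hq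
  have huc : ContDiffOn ℝ ∞ u X :=
    (contDiffOn_uOf hε (contDiffOn_deriv hX hh) hh hA).congr hu
  have hwq : ∀ x ∈ X, w x = sgRHS ε (q x) (h x) := fun x hx =>
    (eq_sgRHS_iff hε (hA x hx) _ _).2 rfl
  have hE : ContDiffOn ℝ ∞ (fun x => deriv q x - auxRHS ε (u x) (h x) (q x)) X :=
    (contDiffOn_deriv hX hqc).sub (contDiffOn_auxRHS hε huc hh hqc hA)
  set e := fun x => deriv q x - auxRHS ε (u x) (h x) (q x) with he
  suffices hz : e x = 0 by
    have := hasDerivAt_of_contDiffOn hX hqc hx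
    rwa [sub_eq_zero.1 hz] at this
  have main : ∀ v : Fld n, pairA (e x) v = 0 := by
    intro v
    have hec : ContDiffOn ℝ ∞ (fun x => pairA (e x) v) X :=
      bilin_pairA.contDiffOn hE contDiffOn_const
    suffices hae : ∀ᵐ y, y ∈ X → pairA (e y) v = 0 from
      Measure.eqOn_open_of_ae_eq (μ := volume) (g := fun _ => (0 : ℝ))
        ((ae_restrict_iff' hX.measurableSet).2 hae) hX hec.continuousOn continuousOn_const hx
    refine hX.ae_eq_zero_of_integral_contDiff_smul_eq_zero
      (hec.continuousOn.locallyIntegrableOn hX.measurableSet) fun ψ hψ hψc hψX => ?_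
    have hev : ∀ᶠ r in nhds (0 : ℝ), ∀ y ∈ tsupport ψ, Adm ε (h y + (r * ψ y) • v) := by
      refine hψc.isCompact.eventually_forall_of_forall_eventually fun y hy => ?_
      have hc : ContinuousAt (fun p : ℝ × ℝ => h p.2 + (p.1 * ψ p.2) • v) (0, y) := by
        have h1 : ContinuousAt h y := hh.continuousOn.continuousAt (hX.mem_nhds (hψX hy))
        have h2 : ContinuousAt (fun p : ℝ × ℝ => h p.2) (0, y) :=
          ContinuousAt.comp (f := Prod.snd) h1 continuousAt_snd
        have h3 : Continuous (fun p : ℝ × ℝ => (p.1 * ψ p.2) • v) :=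
          (continuous_fst.mul (hψ.continuous.comp continuous_snd)).smul continuous_const
        exact h2.add h3.continuousAt
      refine hc.eventually ((isOpen_adm ε).mem_nhds ?_)
      simpa using hA y (hψX hy)
    obtain ⟨δ, hδ, hball⟩ := Metric.eventually_nhds_iff.1 hev
    set r := δ / 2 with hr
    have hr0 : 0 < r := by positivity
    -- `IsVarDeriv` tests only families admissible for all s. The sine keeps the amplitude at most
    -- r, which compactness of the support makes harmless, and it has derivative 1 at 0.
    let η : ℝ → ℝ → Fld n := fun s y => h y + (r * Real.sin s * ψ y) • v
    have hη : Smooth2 Set.univ X η := by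
      refine ContDiffOn.add (hh.comp contDiffOn_snd fun p hp => hp.2) ?_
      refine ContDiff.contDiffOn ?_
      exact ((contDiff_const.mul (Real.contDiff_sin.comp contDiff_fst)).mul
        (hψ.comp contDiff_snd)).smul contDiff_const
    have hψ0 : ∀ y, y ∉ tsupport ψ → ψ y = 0 := fun y hy => image_eq_zero_of_notMem_tsupport hy
    have hηA : ∀ s, ∀ y ∈ X, Adm ε (η s y) := by
      intro s y hy
      by_cases hyK : y ∈ tsupport ψ
      · refine hball ?_ y hyK
        rw [Real.dist_eq, sub_zero, abs_mul, abs_of_pos hr0]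
        have := mul_le_mul_of_nonneg_left (Real.abs_sin_le_one s) hr0.le
        linarith
      · simpa [η, hψ0 y hyK] using hA y hy
    have hη0 : ∀ y ∈ X, η 0 y = h y := fun y _ => by simp [η]
    have hηK : ∀ s, ∀ y ∈ X \ tsupport ψ, η s y = h y := fun s y hy => by
      simp [η, hψ0 y hy.2]
    have d1 := hasDerivAt_hamiltonian (κ := κ) hX hε hη hηA hη0 hu hψc.isCompact hψX hηK hqc
    have d2 := hv η (tsupport ψ) hη hηA hη0 hψc.isCompact hψX hηK
    have d3 := d1.unique d2
    rw [mul_right_inj' hκ] at d3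
    have d4 : ∫ y in X, pairA (w y) (deriv (fun s => uOf ε (η s y) (deriv (η s) y)) 0) =
        ∫ y in X, pairA (sgRHS ε (q y) (h y))
          (deriv (fun s => uOf ε (η s y) (deriv (η s) y)) 0) :=
      setIntegral_congr_fun hX.measurableSet fun y hy => by rw [hwq y hy]
    have d5 : ∫ y in X, pairA (e y) (Dt η 0 y) = 0 := by
      rw [d4] at d3
      exact add_eq_left.1 d3
    have d6 : ∀ y, Dt η 0 y = (r * ψ y) • v := fun y => by
      have := ((((Real.hasDerivAt_sin 0).const_mul r).mul_const (ψ y)).smul_const v).const_add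
        (h y)
      rw [Real.cos_zero, mul_one] at this
      exact this.deriv
    have d7 : ∫ y in X, pairA (e y) (Dt η 0 y) = r * ∫ y in X, ψ y • pairA (e y) v := by
      rw [← integral_const_mul]
      refine integral_congr_ae (Filter.Eventually.of_forall fun y => ?_)
      simp only [d6, bilin_pairA.smul_right, smul_eq_mul]
      ring
    rw [d7, mul_eq_zero, or_iff_right hr0.ne'] at d5
    rw [← d5, ← integral_indicator hX.measurableSet]
    refine integral_congr_ae (Filter.Eventually.of_forall fun y => ?_)
    by_cases hy : y ∈ X
    · simp [Set.indicator_of_mem hy]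
    · simp [Set.indicator_of_notMem hy, hψ0 y fun h => hy (hψX h)]
  have h1 := main (e x)
  exact nsq_eq_zero.1 (by rw [nsq, h1, zero_div])

/-- The Hamiltonian operator maps `w = sgRHS ε q h` to `h` if `q` solves the auxiliary equation. -/
theorem isHop_of_auxRHS (hX : IsOpen X) (hε : ε = 1 ∨ ε = -1)
    {u h q w : ℝ → Fld n} (hh : ContDiffOn ℝ ∞ h X) (hA : ∀ x ∈ X, Adm ε (h x))
    (hu : ∀ x ∈ X, u x = uOf ε (h x) (deriv h x))
    (hq : ∀ x ∈ X, HasDerivAt q (auxRHS ε (u x) (h x) (q x)) x)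
    (hw : ∀ x ∈ X, w x = sgRHS ε (q x) (h x)) :
    IsHop X u w (fun x => brG (h x) (q x)) h := by
  intro x hx
  have hd : HasDerivAt h (sgRHS ε (u x) (h x)) x := by
    have := hasDerivAt_of_contDiffOn hX hh hx
    rwa [(eq_sgRHS_iff hε (hA x hx) _ _).2 (hu x hx)] at this
  refine ⟨isHPar_brG _ _, ?_, ?_⟩
  · refine (bilin_brG.hasDerivAt hd (hq x hx)).congr_deriv ?_
    rw [add_comm, sgRHS_brG hε (hA x hx), hw x hx]
  · have h1 := hasDerivAt_sgRHS_aux hε (Filter.eventually_of_mem (hX.mem_nhds hx) hA) hd (hq x hx)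
    have h2 : deriv w x = deriv (fun x => sgRHS ε (q x) (h x)) x := by
      refine Filter.EventuallyEq.deriv_eq ?_
      filter_upwards [hX.mem_nhds hx] with y hy using hw y hy
    have h3 : sgRHS ε (0 : Fld n) (h x) = 0 := by
      rw [(hA x hx).sgRHS_eq hε, bilin_qa.zero_left, bilin_qb.zero_left]
      simp [actSp1, ← Prod.zero_eq_mk]
    rw [h2, h1.deriv, sub_self, h3, add_zero, sub_add_cancel]

theorem exists_isVarDeriv (hX : IsOpen X) (hX' : X.OrdConnected) (hε : ε = 1 ∨ ε = -1)
    {u h : ℝ → Fld n} (hh : ContDiffOn ℝ ∞ h X)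
    (hA : ∀ x ∈ X, Adm ε (h x) ∧ u x = uOf ε (h x) (deriv h x)) :
    ∃ w : ℝ → Fld n, ContDiffOn ℝ ∞ w X ∧ IsVarDeriv κ ε X h w := by
  have h1 : ∀ x ∈ X, Adm ε (h x) := fun x hx => (hA x hx).1
  have hu : ∀ x ∈ X, u x = uOf ε (h x) (deriv h x) := fun x hx => (hA x hx).2
  have huc : ContDiffOn ℝ ∞ u X :=
    (contDiffOn_uOf hε (contDiffOn_deriv hX hh) hh h1).congr hu
  obtain ⟨q, hq⟩ := exists_auxRHS hX hX' hε huc hh h1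
  have hqc : ContDiffOn ℝ ∞ q X := contDiffOn_of_hasDerivAt hX
    (f := fun x q => auxRHS ε (u x) (h x) q) (fun m p hp =>
      contDiffOn_auxRHS hε (huc.of_le (by exact_mod_cast le_top))
        (hh.of_le (by exact_mod_cast le_top)) hp h1) hq
  exact ⟨_, contDiffOn_sgRHS hε hqc hh h1, isVarDeriv_of_auxRHS hX hε hu hqc hq⟩

theorem exists_isHop (hX : IsOpen X) (hε : ε = 1 ∨ ε = -1) (hκ : κ ≠ 0)
    {u h w : ℝ → Fld n} (hh : ContDiffOn ℝ ∞ h X)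
    (hA : ∀ x ∈ X, Adm ε (h x) ∧ u x = uOf ε (h x) (deriv h x)) (hw : ContDiffOn ℝ ∞ w X)
    (hv : IsVarDeriv κ ε X h w) : ∃ V : ℝ → Par n, IsHop X u w V h :=
  ⟨_, isHop_of_auxRHS hX hε hh (fun x hx => (hA x hx).1) (fun x hx => (hA x hx).2)
    (fun _ hx => hasDerivAt_auxRHS_of_isVarDeriv hX hε hκ hh (fun x hx => (hA x hx).1)
      (fun x hx => (hA x hx).2) hw hv hx)
    fun x hx => (eq_sgRHS_iff hε (hA x hx).1 _ _).2 rfl⟩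

end

/-! ### The Lie algebra `𝔰𝔭(n)` as complex matrices -/

section

variable {n : ℕ}

/-- The index set of the complex `2n × 2n` matrices. -/
abbrev BigIdx (n : ℕ) : Type := Fin 2 ⊕ (Fin (n - 1) ⊕ Fin (n - 1))

/-- Complex `2n × 2n` matrices. -/
abbrev BigMat (n : ℕ) : Type := Matrix (BigIdx n) (BigIdx n) ℂ

/-- A quaternionic row vector as a complex matrix with two rows. -/
def rowM (w : Fld n) : Matrix (Fin 2) (Fin (n - 1) ⊕ Fin (n - 1)) ℂ :=
  Matrix.of ![Sum.elim w.1 w.2, Sum.elim (star w.2) (-star w.1)]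

/-- The quaternion acting from the left as a complex matrix. -/
def quatM (V : Par n) : Matrix (Fin 2) (Fin 2) ℂ :=
  !![-V.1.1, V.1.2; -star V.1.2, -star V.1.1]

/-- The quaternionic matrix acting from the right as a complex matrix. -/
def symM (V : Par n) : Matrix (Fin (n - 1) ⊕ Fin (n - 1)) (Fin (n - 1) ⊕ Fin (n - 1)) ℂ :=
  Matrix.fromBlocks V.2.1 V.2.2 (-mconj V.2.2) (mconj V.2.1)

/-- The element of `𝔰𝔭(n)` with coordinates `w ∈ 𝔥_⊥` and `V ∈ 𝔥_∥`. -/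
def spM (p : Fld n × Par n) : BigMat n :=
  Matrix.fromBlocks (quatM p.2) (rowM p.1) (-(rowM p.1)ᴴ) (-symM p.2)

theorem isLinear_spM : IsLinearMap ℝ (spM (n := n)) where
  map_add p q := by
    ext (i | i | i) (j | j | j) <;>
    (try fin_cases i) <;> (try fin_cases j) <;>
    simp [spM, quatM, rowM, symM, mconj] <;> ring
  map_smul r p := by
    ext (i | i | i) (j | j | j) <;>
    (try fin_cases i) <;> (try fin_cases j) <;>
    simp [spM, quatM, rowM, symM, mconj]

theorem rowM_brB (u : Fld n) (V : Par n) :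
    rowM (brB u V) = quatM V * rowM u + rowM u * symM V := by
  ext i (j | j) <;> fin_cases i <;>
    simp [rowM, quatM, symM, brB, mconj, Matrix.vecMul, dotProduct] <;> ring

theorem quatM_brG (u w : Fld n) :
    quatM (brG u w) = rowM w * (rowM u)ᴴ - rowM u * (rowM w)ᴴ := by
  ext i j
  simp only [Matrix.sub_apply, Matrix.mul_apply, Fintype.sum_sum_type, Matrix.conjTranspose_apply]
  fin_cases i <;> fin_cases j <;>
    simp [rowM, quatM, brG, inC, inS, dotProduct, mul_comm] <;>
    ring

theorem symM_brG (u w : Fld n) :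
    symM (brG u w) = (rowM u)ᴴ * rowM w - (rowM w)ᴴ * rowM u := by
  ext (i | i) (j | j) <;>
    simp [rowM, symM, brG, outC, outS, mconj, Matrix.mul_apply, Fin.sum_univ_two,
      Matrix.vecMulVec_apply] <;> ring

theorem IsHPar.quatM_conjTranspose {V : Par n} (hV : IsHPar V) : (quatM V)ᴴ = -quatM V := by
  have h1 : star V.1.1 = -V.1.1 := by
    apply Complex.ext <;> simp [hV.1]
  ext i j
  fin_cases i <;> fin_cases j <;> simp [quatM] <;> simpa [neg_eq_iff_eq_neg, eq_comm] using h1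

theorem IsHPar.symM_conjTranspose {V : Par n} (hV : IsHPar V) : (symM V)ᴴ = -symM V := by
  have h1 : ∀ i j, star (V.2.1 j i) = -V.2.1 i j := fun i j => congrFun (congrFun hV.2.1 i) j
  have h2 : ∀ i j, V.2.2 j i = V.2.2 i j := fun i j => congrFun (congrFun hV.2.2 i) j
  ext (i | i) (j | j)
  · simpa [symM] using h1 i j
  · simp [symM, mconj, h2]
  · simp [symM, mconj, h2]
  · simpa [symM, mconj] using congrArg star (h1 i j)

/-- Bracketing with an element of 𝔥_⊥ exchanges 𝔥_⊥ and 𝔥_∥, so the two nonlocal ingredients `brB`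
and `brG` of ℋ are the two components of a single commutator. -/
theorem spM_comm {w u : Fld n} {V : Par n} (hV : IsHPar V) :
    spM (w, V) * spM (u, 0) - spM (u, 0) * spM (w, V) = spM (brB u V, -brG u w) := by
  have hq : quatM (0 : Par n) = 0 := by
    ext i j; fin_cases i <;> fin_cases j <;> simp [quatM]
  have hs : symM (0 : Par n) = 0 := by
    ext (i | i) (j | j) <;> simp [symM, mconj]
  have hqn : quatM (-brG u w) = -quatM (brG u w) := by
    ext i j; fin_cases i <;> fin_cases j <;> simp [quatM]
  have hsn : symM (-brG u w) = -symM (brG u w) := by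
    ext (i | i) (j | j) <;> simp [symM, mconj]
  simp only [spM, hq, hs, hqn, hsn, Matrix.fromBlocks_multiply, sub_eq_add_neg,
    Matrix.fromBlocks_neg, Matrix.fromBlocks_add, rowM_brB, quatM_brG, symM_brG,
    Matrix.conjTranspose_add, Matrix.conjTranspose_mul, hV.quatM_conjTranspose,
    hV.symM_conjTranspose]
  congr 1 <;> simp only [Matrix.mul_neg, Matrix.neg_mul, Matrix.mul_zero, Matrix.zero_mul,
    neg_neg, neg_add, neg_zero, zero_add, add_zero] <;> abel

/-- The real trace form. -/
def trK (A B : BigMat n) : ℝ := (A * B).trace.re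

theorem bilin_trK : IsBilinearMap ℝ (trK (n := n)) where
  add_left A B C := by simp [trK, add_mul]
  smul_left r A B := by simp [trK]
  add_right A B C := by simp [trK, mul_add]
  smul_right r A B := by simp [trK]

theorem bilin_comm : IsBilinearMap ℝ (fun A B : BigMat n => A * B - B * A) where
  add_left A B C := by noncomm_ring
  smul_left r A B := by simp [smul_sub]
  add_right A B C := by noncomm_ring
  smul_right r A B := by simp [smul_sub]

theorem trK_comm (A B : BigMat n) : trK A B = trK B A := by
  rw [trK, Matrix.trace_mul_comm, trK]

theorem trK_cycle (A B C : BigMat n) : trK A (B * C - C * B) = trK B (C * A - A * C) := by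
  simp only [trK, mul_sub, Matrix.trace_sub, Complex.sub_re]
  rw [← mul_assoc, Matrix.trace_mul_comm (A * B) C, ← mul_assoc, ← mul_assoc, ← mul_assoc,
    Matrix.trace_mul_comm (A * C) B, ← mul_assoc, Matrix.trace_mul_comm (C * A) B, ← mul_assoc]

/-- 𝔥_∥ is trace-orthogonal to 𝔥_⊥, so V does not contribute. The constant −2 is the origin of the
factors −1/2 in the boundary terms below. -/
theorem trK_spM (w f : Fld n) (V : Par n) : trK (spM (w, V)) (spM (f, 0)) = -2 * pairA w f := by
  have hq : quatM (0 : Par n) = 0 := by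
    ext i j; fin_cases i <;> fin_cases j <;> simp [quatM]
  have hs : symM (0 : Par n) = 0 := by
    ext (i | i) (j | j) <;> simp [symM, mconj]
  simp only [trK, spM, hq, hs, Matrix.fromBlocks_multiply]
  rw [pairA_eq, Matrix.trace]
  simp only [Fintype.sum_sum_type, Matrix.diag_apply, Matrix.fromBlocks_apply₁₁,
    Matrix.fromBlocks_apply₂₂, Matrix.add_apply, Matrix.mul_apply, Fin.sum_univ_two,
    Matrix.neg_apply, Matrix.conjTranspose_apply, Matrix.zero_apply, Fintype.sum_sum_type]
  simp [rowM, qa, dotProduct, Finset.sum_add_distrib, mul_comm]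
  ring

theorem trK_spM_zero (f : Fld n) (V : Par n) : trK (spM (f, 0)) (spM (0, V)) = 0 := by
  rw [trK_comm, trK_spM, bilin_pairA.zero_left, mul_zero]

end

/-! ### The Hamiltonian operator is skew and satisfies the Jacobi identity -/

section

variable {n : ℕ} {X : Set ℝ} {u : ℝ → Fld n}

/-- The commutator of `2n × 2n` matrices. -/
def commM (A B : BigMat n) : BigMat n := A * B - B * A

theorem commM_leibniz (A B C : BigMat n) :
    commM (commM A B) C = commM (commM A C) B + commM A (commM B C) := by
  simp only [commM]; noncomm_ring

theorem commM_swap (A B : BigMat n) : commM A B = -commM B A := by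
  simp only [commM, neg_sub]

theorem trK_commM_cycle (A B C : BigMat n) : trK A (commM B C) = trK B (commM C A) :=
  trK_cycle A B C

theorem trK_commM_left (A B C : BigMat n) : trK (commM A C) B = -trK A (commM B C) := by
  rw [trK_comm, trK_commM_cycle, commM_swap C B, bilin_trK.neg_right]

theorem hasDerivAt_spM {p : ℝ → Fld n × Par n} {p' : Fld n × Par n} {x : ℝ}
    (hp : HasDerivAt p p' x) : HasDerivAt (fun x => spM (p x)) (spM p') x :=
  (LinearMap.toContinuousLinearMap isLinear_spM.mk').hasFDerivAt.comp_hasDerivAt x hp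

variable {w w₁ w₂ w₃ f f₁ f₂ f₃ : ℝ → Fld n} {V V₁ V₂ V₃ Z Z₂₃ Z₃₁ Z₁₂ : ℝ → Par n}

theorem IsHop.continuousOn (hX : IsOpen X) (hu : ContDiffOn ℝ ∞ u X) (hw : ContDiffOn ℝ ∞ w X)
    (h : IsHop X u w V f) : ContinuousOn f X := by
  have hV : ContinuousOn V X := fun x hx => (h x hx).2.1.continuousAt.continuousWithinAt
  have h1 : ContinuousOn (fun x => brB (u x) (V x)) X :=
    contDiffOn_zero.1 (bilin_brB.contDiffOn (m := 0) (contDiffOn_zero.2 hu.continuousOn)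
      (contDiffOn_zero.2 hV))
  exact ((contDiffOn_deriv hX hw).continuousOn.add h1).congr fun x hx => (h x hx).2.2

/-- The equation f = ℋ w together with that of its potential is the covariant derivative A_x + [A,
U] = F in 𝔰𝔭(n). The skewness and Jacobi proofs use ℋ in this form. -/
theorem IsHop.hasDerivAt_spM (hX : IsOpen X) (hw : ContDiffOn ℝ ∞ w X) (h : IsHop X u w V f)
    {x : ℝ} (hx : x ∈ X) : HasDerivAt (fun x => spM (w x, V x))
      (spM (f x, 0) - commM (spM (w x, V x)) (spM (u x, 0))) x := by
  obtain ⟨h1, h2, h3⟩ := h x hx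
  refine (VectorSG.hasDerivAt_spM ((hasDerivAt_of_contDiffOn hX hw hx).prodMk h2)).congr_deriv ?_
  rw [commM, spM_comm h1, ← isLinear_spM.map_sub, h3]
  simp

theorem IsLinPot.hasDerivAt_spM (h : IsLinPot X f w Z) {x : ℝ} (hx : x ∈ X) :
    HasDerivAt (fun x => spM (0, Z x)) (spM (0, brG (f x) (w x))) x :=
  VectorSG.hasDerivAt_spM ((hasDerivAt_const x (0 : Fld n)).prodMk (h x hx).2)

theorem continuousOn_pairA (hw : ContinuousOn w X) (hf : ContinuousOn f X) :
    ContinuousOn (fun x => pairA (w x) (f x)) X :=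
  contDiffOn_zero.1 (bilin_pairA.contDiffOn (m := 0) (contDiffOn_zero.2 hw) (contDiffOn_zero.2 hf))

theorem continuousOn_brB (hw : ContinuousOn w X) (hV : ContinuousOn V X) :
    ContinuousOn (fun x => brB (w x) (V x)) X :=
  contDiffOn_zero.1 (bilin_brB.contDiffOn (m := 0) (contDiffOn_zero.2 hw) (contDiffOn_zero.2 hV))

/-- By invariance of the trace form the U-terms cancel in the derivative of tr(A₁A₂), and what
remains is the integrand up to the factor −2. -/
theorem IsTest.skew (hX : IsOpen X) (hu : ContDiffOn ℝ ∞ u X) (h₁ : IsTest X u w₁ V₁ f₁)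
    (h₂ : IsTest X u w₂ V₂ f₂) :
    (∫ x in X, pairA (w₁ x) (f₂ x)) + (∫ x in X, pairA (w₂ x) (f₁ x)) = 0 := by
  obtain ⟨hw₁, hH₁, K₁, hK₁, hKX₁, hz₁⟩ := h₁
  obtain ⟨hw₂, hH₂, K₂, hK₂, hKX₂, hz₂⟩ := h₂
  have c₁ := hH₁.continuousOn hX hu hw₁
  have c₂ := hH₂.continuousOn hX hu hw₂
  have i₁ : IntegrableOn (fun x => pairA (w₁ x) (f₂ x)) X :=
    integrableOn_of_eq_zero hX hK₁ hKX₁ (continuousOn_pairA hw₁.continuousOn c₂) fun x hx => by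
      rw [(hz₁ x hx).1, bilin_pairA.zero_left]
  have i₂ : IntegrableOn (fun x => pairA (w₂ x) (f₁ x)) X :=
    integrableOn_of_eq_zero hX hK₂ hKX₂ (continuousOn_pairA hw₂.continuousOn c₁) fun x hx => by
      rw [(hz₂ x hx).1, bilin_pairA.zero_left]
  rw [← integral_add i₁ i₂]
  refine integral_hasDerivAt_eq_zero hX hK₁ hKX₁
    (f := fun x => -(1 / 2) * trK (spM (w₁ x, V₁ x)) (spM (w₂ x, V₂ x))) (fun x hx => ?_)
    ((continuousOn_pairA hw₁.continuousOn c₂).add (continuousOn_pairA hw₂.continuousOn c₁))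
    fun x hx => ?_
  · refine ((bilin_trK.hasDerivAt (hH₁.hasDerivAt_spM hX hw₁ hx)
      (hH₂.hasDerivAt_spM hX hw₂ hx)).const_mul _).congr_deriv ?_
    rw [bilin_trK.sub_left, bilin_trK.sub_right, trK_commM_left, trK_spM,
      trK_comm (spM (f₁ x, 0)), trK_spM]
    ring
  · rw [(hz₁ x hx).1, (hz₁ x hx).2, ← Prod.zero_eq_mk, isLinear_spM.map_zero,
      bilin_trK.zero_left, mul_zero]

/-- The middle term is the derivative of the potential Z. It cancels the 𝔥_∥ part of the first
commutator, so that the whole sum lies in 𝔥_⊥ and is detected by `trK_spM`. -/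
theorem jac_integrand {w₁ w₃ f₂ u : Fld n} {V₁ V₃ Z : Par n} (hV₃ : IsHPar V₃) (hZ : IsHPar Z) :
    -2 * pairA w₁ (brB f₂ V₃ + brB u Z) =
      trK (spM (w₁, V₁)) (commM (spM (w₃, V₃)) (spM (f₂, 0)))
        + trK (spM (w₁, V₁)) (spM (0, brG f₂ w₃))
        + trK (spM (w₁, V₁)) (commM (spM (0, Z)) (spM (u, 0))) := by
  rw [commM, commM, spM_comm hV₃, spM_comm hZ, ← bilin_trK.add_right, ← bilin_trK.add_right,
    ← isLinear_spM.map_add, ← isLinear_spM.map_add, ← trK_spM _ _ V₁, bilin_brG.zero_right]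
  simp

theorem IsTest.jacobi (hX : IsOpen X) (hu : ContDiffOn ℝ ∞ u X) (h₁ : IsTest X u w₁ V₁ f₁)
    (h₂ : IsTest X u w₂ V₂ f₂) (h₃ : IsTest X u w₃ V₃ f₃) (hZ₂₃ : IsLinPot X f₂ w₃ Z₂₃)
    (hZ₃₁ : IsLinPot X f₃ w₁ Z₃₁) (hZ₁₂ : IsLinPot X f₁ w₂ Z₁₂) :
    jacTerm X u w₁ f₂ V₃ Z₂₃ + jacTerm X u w₂ f₃ V₁ Z₃₁ + jacTerm X u w₃ f₁ V₂ Z₁₂ = 0 := by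
  obtain ⟨hw₁, hH₁, K₁, hK₁, hKX₁, hz₁⟩ := h₁
  obtain ⟨hw₂, hH₂, K₂, hK₂, hKX₂, hz₂⟩ := h₂
  obtain ⟨hw₃, hH₃, K₃, hK₃, hKX₃, hz₃⟩ := h₃
  have hK := (hK₁.union hK₂).union hK₃
  have hKX := Set.union_subset (Set.union_subset hKX₁ hKX₂) hKX₃
  set K := K₁ ∪ K₂ ∪ K₃ with hKdef
  have z₁ : ∀ x ∈ X \ K, w₁ x = 0 ∧ V₁ x = 0 := fun x hx =>
    hz₁ x ⟨hx.1, fun h => hx.2 (Or.inl (Or.inl h))⟩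
  have z₂ : ∀ x ∈ X \ K, w₂ x = 0 ∧ V₂ x = 0 := fun x hx =>
    hz₂ x ⟨hx.1, fun h => hx.2 (Or.inl (Or.inr h))⟩
  have z₃ : ∀ x ∈ X \ K, w₃ x = 0 ∧ V₃ x = 0 := fun x hx =>
    hz₃ x ⟨hx.1, fun h => hx.2 (Or.inr h)⟩
  have cf₁ := hH₁.continuousOn hX hu hw₁
  have cf₂ := hH₂.continuousOn hX hu hw₂
  have cf₃ := hH₃.continuousOn hX hu hw₃
  have cV : ∀ {w f : ℝ → Fld n} {V : ℝ → Par n}, IsHop X u w V f → ContinuousOn V X :=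
    fun h x hx => (h x hx).2.1.continuousAt.continuousWithinAt
  have cZ : ∀ {w f : ℝ → Fld n} {Z : ℝ → Par n}, IsLinPot X f w Z → ContinuousOn Z X :=
    fun h x hx => (h x hx).2.continuousAt.continuousWithinAt
  have c₁ := continuousOn_pairA hw₁.continuousOn ((continuousOn_brB cf₂ (cV hH₃)).add
    (continuousOn_brB hu.continuousOn (cZ hZ₂₃)))
  have c₂ := continuousOn_pairA hw₂.continuousOn ((continuousOn_brB cf₃ (cV hH₁)).add
    (continuousOn_brB hu.continuousOn (cZ hZ₃₁)))
  have c₃ := continuousOn_pairA hw₃.continuousOn ((continuousOn_brB cf₁ (cV hH₂)).add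
    (continuousOn_brB hu.continuousOn (cZ hZ₁₂)))
  have i₁ := integrableOn_of_eq_zero hX hK hKX c₁ fun x hx => by
    rw [(z₁ x hx).1, bilin_pairA.zero_left]
  have i₂ := integrableOn_of_eq_zero hX hK hKX c₂ fun x hx => by
    rw [(z₂ x hx).1, bilin_pairA.zero_left]
  have i₃ := integrableOn_of_eq_zero hX hK hKX c₃ fun x hx => by
    rw [(z₃ x hx).1, bilin_pairA.zero_left]
  have e := integral_add (i₁.add i₂) i₃
  have e' := integral_add i₁ i₂
  simp only [Pi.add_apply] at e e'
  rw [jacTerm, jacTerm, jacTerm, ← e', ← e]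
  -- The primitive combines the invariant trilinear form in A₁, A₂, A₃ with one pairing for each
  -- linearized potential. The potentials Z need not have compact support, but every term contains
  -- some Aᵢ, which does.
  refine integral_hasDerivAt_eq_zero hX hK hKX
    (f := fun x => -(1 / 2) * (trK (spM (w₁ x, V₁ x)) (commM (spM (w₃ x, V₃ x)) (spM (w₂ x, V₂ x)))
      + trK (spM (w₁ x, V₁ x)) (spM (0, Z₂₃ x)) + trK (spM (w₂ x, V₂ x)) (spM (0, Z₃₁ x))
      + trK (spM (w₃ x, V₃ x)) (spM (0, Z₁₂ x)))) (fun x hx => ?_) ((c₁.add c₂).add c₃)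
    fun x hx => ?_
  · have d₁ := hH₁.hasDerivAt_spM hX hw₁ hx
    have d₂ := hH₂.hasDerivAt_spM hX hw₂ hx
    have d₃ := hH₃.hasDerivAt_spM hX hw₃ hx
    refine ((((bilin_trK.hasDerivAt d₁ (bilin_comm.hasDerivAt d₃ d₂)).add
      (bilin_trK.hasDerivAt d₁ (hZ₂₃.hasDerivAt_spM hx))).add
      (bilin_trK.hasDerivAt d₂ (hZ₃₁.hasDerivAt_spM hx))).add
      (bilin_trK.hasDerivAt d₃ (hZ₁₂.hasDerivAt_spM hx))).const_mul (-(1 / 2)) |>.congr_deriv ?_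
    have j₁ := jac_integrand (w₁ := w₁ x) (w₃ := w₃ x) (f₂ := f₂ x) (u := u x) (V₁ := V₁ x)
      (hH₃ x hx).1 (hZ₂₃ x hx).1
    have j₂ := jac_integrand (w₁ := w₂ x) (w₃ := w₁ x) (f₂ := f₃ x) (u := u x) (V₁ := V₂ x)
      (hH₁ x hx).1 (hZ₃₁ x hx).1
    have j₃ := jac_integrand (w₁ := w₃ x) (w₃ := w₂ x) (f₂ := f₁ x) (u := u x) (V₁ := V₃ x)
      (hH₂ x hx).1 (hZ₁₂ x hx).1
    have o₁ := trK_spM_zero (f₁ x) (Z₂₃ x)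
    have o₂ := trK_spM_zero (f₂ x) (Z₃₁ x)
    have o₃ := trK_spM_zero (f₃ x) (Z₁₂ x)
    change -(1 / 2) * (trK _ (commM _ _ + commM _ _) + trK _ (commM _ _) + _ + _ + _) = _
    generalize spM (w₁ x, V₁ x) = A₁ at *
    generalize spM (w₂ x, V₂ x) = A₂ at *
    generalize spM (w₃ x, V₃ x) = A₃ at *
    generalize spM (f₁ x, 0) = F₁ at *
    generalize spM (f₂ x, 0) = F₂ at *
    generalize spM (f₃ x, 0) = F₃ at *
    generalize spM (u x, 0) = U at *
    generalize spM (0, Z₂₃ x) = B₁ at *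
    generalize spM (0, Z₃₁ x) = B₂ at *
    generalize spM (0, Z₁₂ x) = B₃ at *
    have L : IsBilinearMap ℝ (commM (n := n)) := bilin_comm
    have M := bilin_trK (n := n)
    have k₁ := trK_commM_left A₁ B₁ U
    have k₂ := trK_commM_left A₂ B₂ U
    have k₃ := trK_commM_left A₃ B₃ U
    have k₄ := trK_commM_left A₁ (commM A₃ A₂) U
    -- Leibniz's rule for the bracket with U, combined with invariance in `k₄`, cancels all terms
    -- containing U but no potential. The terms F₁B₁, F₂B₂, F₃B₃ vanish by orthogonality of 𝔥_⊥ and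
    -- 𝔥_∥.
    have k₅ : trK A₁ (commM (commM A₃ A₂) U) =
        trK A₁ (commM (commM A₃ U) A₂) + trK A₁ (commM A₃ (commM A₂ U)) := by
      rw [commM_leibniz, M.add_right]
    have k₆ : trK A₁ (commM F₃ A₂) = trK A₂ (commM A₁ F₃) :=
      (trK_commM_cycle A₂ A₁ F₃).symm
    have k₇ : trK F₁ (commM A₃ A₂) = trK A₃ (commM A₂ F₁) := trK_commM_cycle F₁ A₃ A₂
    simp only [L.sub_left, L.sub_right, M.sub_left, M.sub_right, M.add_right, k₁, k₂, k₃, k₄, k₅,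
      k₆, k₇, o₁, o₂, o₃]
    linarith
  · have hs : spM (n := n) (0, 0) = 0 := by rw [← Prod.zero_eq_mk, isLinear_spM.map_zero]
    rw [(z₁ x hx).1, (z₁ x hx).2, (z₂ x hx).1, (z₂ x hx).2, (z₃ x hx).1, (z₃ x hx).2, hs,
      bilin_trK.zero_left, bilin_trK.zero_left, bilin_trK.zero_left, bilin_trK.zero_left]
    ring

theorem isCosymplecticAt (hX : IsOpen X) (hu : ContDiffOn ℝ ∞ u X) : IsCosymplecticAt X u :=
  ⟨fun _ _ _ _ _ _ h₁ h₂ => h₁.skew hX hu h₂,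
    fun _ _ _ _ _ _ _ _ _ _ _ _ h₁ h₂ h₃ g₁ g₂ g₃ => h₁.jacobi hX hu h₂ h₃ g₁ g₂ g₃⟩

end

/-! ### The conservation law of the `-1` flow -/

section

variable {n : ℕ}

theorem rho_pos (hn : 2 ≤ n) : 0 < rho n := by
  have : (2 : ℝ) ≤ n := by exact_mod_cast hn
  unfold rho; linarith

theorem sqrt_rho_pos (hn : 2 ≤ n) : 0 < Real.sqrt (rho n) := Real.sqrt_pos.2 (rho_pos hn)

theorem sqrt_rho_sq (hn : 2 ≤ n) : Real.sqrt (rho n) ^ 2 = rho n := Real.sq_sqrt (rho_pos hn).le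

theorem trace_mul_vecMulVec' (M : Mat n) (a b : Vec n) :
    (M * Matrix.vecMulVec a b).trace = b ⬝ᵥ (M *ᵥ a) := by
  rw [Matrix.mul_vecMulVec, Matrix.trace_vecMulVec, dotProduct_comm]

/-- The polar form of `h_∥² + |H₁|² + |H₂|²`. -/
def parForm (H P : Mat n × Mat n) : ℝ :=
  (-Complex.I * H.1.trace).re * (-Complex.I * P.1.trace).re + (-(H.1 * P.1).trace).re
    + (-(mconj H.2 * P.2).trace).re

theorem bilin_parForm : IsBilinearMap ℝ (parForm (n := n)) where
  add_left H H' P := by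
    have : mconj (H.2 + H'.2) = mconj H.2 + mconj H'.2 := by ext; simp [mconj]
    simp [parForm, add_mul, this]; ring
  smul_left r H P := by
    have : mconj (r • H.2) = r • mconj H.2 := by ext; simp [mconj]
    simp [parForm, this]; ring
  add_right H P P' := by simp [parForm, mul_add]; ring
  smul_right r H P := by simp [parForm]; ring

theorem parForm_comm (H P : Mat n × Mat n) : parForm H P = parForm P H := by
  have h1 : (mconj H.2 * P.2).trace = star ((mconj P.2 * H.2).trace) := by
    rw [Matrix.trace_mul_comm]
    simp [mconj, Matrix.trace, Matrix.mul_apply]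
  simp only [parForm, h1, Matrix.trace_mul_comm H.1]
  simp
  ring

theorem conserved_eq (h : Fld n) (H : Mat n × Mat n) :
    conserved h H = nsq h + parForm H H / (2 * rho n) := by
  rw [conserved, parForm, sq]

/-- The value of `i √ρ h_x` prescribed by `𝒥 h = 0`. -/
def rhsJ (u : Fld n) (H : Mat n × Mat n) : Fld n :=
  (H.1.trace • u.1 + u.1 ᵥ* H.1 + u.2 ᵥ* mconj H.2,
    H.1.trace • u.2 - u.2 ᵥ* mconj H.1 + u.1 ᵥ* H.2)

theorem zero_eq_valJ_iff (u hx : Fld n) (H : Mat n × Mat n) :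
    0 = valJ u hx H ↔ hx = -((Real.sqrt (rho n))⁻¹ • (Complex.I • rhsJ u H)) := by
  have e : valJ u hx H = hx + (Real.sqrt (rho n))⁻¹ • (Complex.I • rhsJ u H) := by
    ext i <;> simp [valJ, rhsJ] <;> ring
  rw [e, eq_comm, add_eq_zero_iff_eq_neg]

theorem star_dot_mulVec (M : Mat n) (x y : Vec n) :
    star (x ⬝ᵥ (M *ᵥ y)) = star x ⬝ᵥ (mconj M *ᵥ star y) := by
  simp [dotProduct, Matrix.mulVec, mconj]

/-- Invariance of the metric: the map u ↦ i `rhsJ u H`, paired with h, equals H paired with the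
bracket of u and h. Hence the two contributions to the derivative of the conserved quantity cancel.
-/
theorem pairA_rhsJ {H : Mat n × Mat n} (hH : IsMPar H) (u h : Fld n) :
    pairA h (Complex.I • rhsJ u H) =
      parForm H (outC (Complex.I • h.1) u.1 + (outC (Complex.I • h.2) u.2)ᵀ,
        -outA u.2 (Complex.I • h.1) + outA (Complex.I • h.2) u.1) := by
  obtain ⟨H1, H2⟩ := H
  obtain ⟨hH1, hH2⟩ := hH
  simp only at hH1 hH2
  have g1 : ∀ x y : Vec n, x ⬝ᵥ (H1 *ᵥ y) = -star (star y ⬝ᵥ (H1 *ᵥ star x)) := by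
    intro x y
    have e : H1 = -H1ᴴ := by rw [hH1, neg_neg]
    rw [star_dot_mulVec, star_star, star_star]
    conv_lhs => rw [e]
    rw [Matrix.neg_mulVec, dotProduct_neg, Matrix.dotProduct_mulVec, ← Matrix.mulVec_transpose,
      dotProduct_comm]
    rfl
  have g2 : ∀ x y : Vec n, x ⬝ᵥ (H2 *ᵥ y) = -(y ⬝ᵥ (H2 *ᵥ x)) := by
    intro x y
    have e : H2 = -H2ᵀ := by rw [hH2, neg_neg]
    conv_lhs => rw [e]
    rw [Matrix.neg_mulVec, dotProduct_neg, Matrix.dotProduct_mulVec, Matrix.vecMul_transpose,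
      dotProduct_comm]
  have ht : star H1.trace = -H1.trace := by
    rw [← Matrix.trace_conjTranspose, hH1, Matrix.trace_neg]
  have m1 : ∀ x y : Vec n, x ⬝ᵥ (mconj H1 *ᵥ y) = star (star x ⬝ᵥ (H1 *ᵥ star y)) := by
    intro x y; rw [star_dot_mulVec, star_star, star_star]
  have m2 : ∀ x y : Vec n, x ⬝ᵥ (mconj H2 *ᵥ y) = star (star x ⬝ᵥ (H2 *ᵥ star y)) := by
    intro x y; rw [star_dot_mulVec, star_star, star_star]
  have hre : H1.trace.re = 0 := by
    have := congrArg Complex.re ht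
    simp at this; linarith
  rw [pairA_comm, pairA_eq]
  simp only [qa, rhsJ, parForm, outC, outA, Prod.smul_mk, smul_dotProduct, add_dotProduct,
    sub_dotProduct, ← Matrix.dotProduct_mulVec, m1, m2, Matrix.transpose_sub,
    Matrix.transpose_vecMulVec, mul_add, mul_sub, Matrix.mul_neg, Matrix.trace_add,
    Matrix.trace_sub, Matrix.trace_neg, trace_mul_vecMulVec', Matrix.trace_vecMulVec,
    star_smul, Matrix.mulVec_smul, dotProduct_smul, star_star]
  have d1 : star u.1 ⬝ᵥ h.1 = star (u.1 ⬝ᵥ star h.1) := by rw [star_dot, star_star]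
  have d2 : h.2 ⬝ᵥ star u.2 = star (u.2 ⬝ᵥ star h.2) := by
    rw [star_dot, star_star, dotProduct_comm]
  rw [g1 h.1 (star u.1), g1 (star h.2) u.2, g2 h.1 (star u.2), g2 (star h.2) u.1, d1, d2,
    dotProduct_comm (star h.1), star_star, star_star]
  generalize u.1 ⬝ᵥ H1 *ᵥ star h.1 = a1
  generalize star u.2 ⬝ᵥ H1 *ᵥ h.2 = a2
  generalize star u.2 ⬝ᵥ H2 *ᵥ h.1 = a3
  generalize u.1 ⬝ᵥ H2 *ᵥ star h.2 = a4
  generalize u.1 ⬝ᵥ star h.1 = a5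
  generalize u.2 ⬝ᵥ star h.2 = a6
  simp [hre]
  ring

theorem hasDerivAt_conserved (hn : 2 ≤ n) {X : Set ℝ} (hX : IsOpen X) {u h : ℝ → Fld n}
    {H : ℝ → Mat n × Mat n} (hh : ContDiffOn ℝ ∞ h X) (hJ : IsJ X u h H (fun _ => 0)) {x : ℝ}
    (hx : x ∈ X) : HasDerivAt (fun y => conserved (h y) (H y)) 0 x := by
  obtain ⟨h1, h2, h3⟩ := hJ x hx
  simp only [conserved_eq]
  refine ((hasDerivAt_nsq (hasDerivAt_of_contDiffOn hX hh hx)).add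
    ((bilin_parForm.hasDerivAt h2 h2).div_const _)).congr_deriv ?_
  have hp : potH (u x) (h x) = Real.sqrt (rho n) •
      (outC (Complex.I • (h x).1) (u x).1 + (outC (Complex.I • (h x).2) (u x).2)ᵀ,
        -outA (u x).2 (Complex.I • (h x).1) + outA (Complex.I • (h x).2) (u x).1) := rfl
  rw [(zero_eq_valJ_iff _ _ _).1 h3, parForm_comm (potH _ _), hp, bilin_parForm.smul_right,
    ← pairA_rhsJ h1, bilin_pairA.neg_right, bilin_pairA.smul_right]
  have hs := sqrt_rho_pos hn
  have hs2 := sqrt_rho_sq hn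
  set s := Real.sqrt (rho n)
  rw [← hs2]
  simp only [smul_eq_mul]
  field_simp
  ring

end

/-! ### The ansatz -/

section

variable {n : ℕ}

theorem ansatz_fst (α β γ : ℝ) (h : Fld n) : (ansatz α β γ h).1 =
    (Complex.I * α) • (Matrix.vecMulVec (star h.1) h.1 + Matrix.vecMulVec h.2 (star h.2))
      + (Complex.I * β) • (1 : Mat n) := by
  ext i j
  simp [ansatz, outC, Matrix.vecMulVec_apply]
  ring

theorem ansatz_snd (α β γ : ℝ) (h : Fld n) : (ansatz α β γ h).2 =
    (Complex.I * γ) • (Matrix.vecMulVec (star h.1) h.2 - Matrix.vecMulVec h.2 (star h.1)) := by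
  ext i j
  simp [ansatz, outA, Matrix.vecMulVec_apply]
  ring

theorem mconj_ansatz_fst (α β γ : ℝ) (h : Fld n) : mconj (ansatz α β γ h).1 =
    -(Complex.I * α) • (Matrix.vecMulVec h.1 (star h.1) + Matrix.vecMulVec (star h.2) h.2)
      - (Complex.I * β) • (1 : Mat n) := by
  ext i j
  rw [ansatz_fst]
  by_cases hij : i = j <;> simp [mconj, Matrix.vecMulVec_apply, hij]
  ring

theorem mconj_ansatz_snd (α β γ : ℝ) (h : Fld n) : mconj (ansatz α β γ h).2 =
    (Complex.I * γ) • (Matrix.vecMulVec (star h.2) h.1 - Matrix.vecMulVec h.1 (star h.2)) := by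
  ext i j
  rw [ansatz_snd]
  simp [mconj, Matrix.vecMulVec_apply]
  ring

theorem isMPar_ansatz (α β γ : ℝ) (h : Fld n) : IsMPar (ansatz α β γ h) := by
  constructor
  · rw [ansatz_fst]
    simp [Matrix.conjTranspose_vecMulVec, add_comm]
  · rw [ansatz_snd]
    simp [Matrix.transpose_vecMulVec, ← smul_neg]

theorem trace_ansatz (hn : 2 ≤ n) (α β γ : ℝ) (h : Fld n) :
    (ansatz α β γ h).1.trace = Complex.I * ((α * nsq h + (n - 1) * β : ℝ) : ℂ) := by
  have e : ((nsq h : ℝ) : ℂ) = h.1 ⬝ᵥ star h.1 + h.2 ⬝ᵥ star h.2 := (qa_self h).symm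
  have h1 : ((n - 1 : ℕ) : ℂ) = n - 1 := by
    rw [Nat.cast_sub (by omega)]; simp
  push_cast
  rw [e]
  simp [ansatz, outC, Matrix.trace_vecMulVec, Matrix.trace_one, h1, dotProduct_comm]
  ring

theorem ansatz_smul {c : ℝ} (hc : c ≠ 0) (α β : ℝ) (h : Fld n) :
    ansatz α β α h = c • ansatz (c * α) (β / c) (c * α) (c⁻¹ • h) := by
  have hc' : (c : ℂ) ≠ 0 := by exact_mod_cast hc
  refine Prod.ext ?_ ?_ <;> ext i j
  · simp [ansatz, outC, Matrix.vecMulVec_apply]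
    field_simp
  · simp [ansatz, outA, Matrix.vecMulVec_apply]
    field_simp

end

/-! ### The ansatz in the flow equation and in the conserved quantity -/

section

variable {n : ℕ}

/-- The choice γ = α makes the outer products of H₁ and H₂ combine into the single quaternionic term
⟨u, h⟩h. The trace supplies (n − 1)β, and the scalar part of H₁ the remaining β. -/
theorem rhsJ_ansatz (hn : 2 ≤ n) (α β : ℝ) (u h : Fld n) :
    Complex.I • rhsJ u (ansatz α β α h) =
      -(α • actSp1 (qa u h) (qb u h) h + (α * nsq h + n * β) • u) := by
  have e1 : u.2 ⬝ᵥ h.1 = h.1 ⬝ᵥ u.2 := dotProduct_comm _ _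
  rw [rhsJ, trace_ansatz hn, mconj_ansatz_fst, mconj_ansatz_snd, ansatz_fst, ansatz_snd]
  simp only [Matrix.vecMul_add, Matrix.vecMul_sub, Matrix.vecMul_smul, Matrix.vecMul_vecMulVec,
    Matrix.vecMul_one, Matrix.vecMul_neg, neg_smul, Matrix.vecMul_neg]
  ext i <;> simp [actSp1, qa, qb] <;> ring_nf <;> simp only [Complex.I_sq] <;> ring_nf

theorem dot_star_self {m : Type*} [Fintype m] (x : m → ℂ) :
    x ⬝ᵥ star x = ((∑ i, Complex.normSq (x i) : ℝ) : ℂ) := by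
  simp [dotProduct, Complex.mul_conj]

/-- The terms |h₁ · h₂|² from H₁ and H₂ cancel because γ = α. What is left of h_∥² + |H₁|² + |H₂|²
is 2|h|²(α²|h|² + nβα) + n(n − 1)β² = −2ρ|h|² + n(n − 1)β², and division by 2ρ = 16(n − 1) gives the
value. -/
theorem conserved_ansatz (hn : 2 ≤ n) {α β : ℝ} {h : Fld n}
    (hq : α ^ 2 * nsq h + n * β * α + rho n = 0) :
    conserved h (ansatz α β α h) = n * (β / 4) ^ 2 := by
  have h1 : ((n - 1 : ℕ) : ℂ) = n - 1 := by
    rw [Nat.cast_sub (by omega)]; simp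
  have hx := dot_star_self h.1
  have hy := dot_star_self h.2
  set x : ℝ := ∑ i, Complex.normSq (h.1 i)
  set y : ℝ := ∑ i, Complex.normSq (h.2 i)
  have hxy : nsq h = x + y := nsq_eq_sum h
  have hs : star h.1 ⬝ᵥ star h.2 = star (h.1 ⬝ᵥ h.2) := by rw [star_dot]
  have hz := Complex.mul_conj (h.1 ⬝ᵥ h.2)
  set z := Complex.normSq (h.1 ⬝ᵥ h.2)
  have e1 : ((ansatz α β α h).1 * (ansatz α β α h).1).trace
      = ((-(α ^ 2 * (x ^ 2 + y ^ 2 + 2 * z) + 2 * α * β * (x + y) + (n - 1) * β ^ 2) : ℝ) : ℂ) := by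
    rw [ansatz_fst]
    simp only [mul_add, add_mul, Matrix.mul_smul, Matrix.smul_mul, smul_add,
      Matrix.trace_add, Matrix.trace_smul, trace_mul_vecMulVec', Matrix.vecMulVec_mulVec,
      Matrix.trace_vecMulVec, Matrix.trace_one, mul_one, one_mul]
    simp [h1, hs, hx, hy, dotProduct_comm (star h.1) h.1, dotProduct_comm (star h.2) h.2,
      dotProduct_comm (star h.2) (star h.1)]
    rw [← hz]
    linear_combination ((α : ℂ) ^ 2 * (x ^ 2 + y ^ 2
      + 2 * (h.1 ⬝ᵥ h.2 * (starRingEnd ℂ) (h.1 ⬝ᵥ h.2)))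
      + 2 * α * β * (x + y) + (n - 1) * (β : ℂ) ^ 2) * Complex.I_sq
  have e2 : (mconj (ansatz α β α h).2 * (ansatz α β α h).2).trace
      = ((-(2 * α ^ 2 * (x * y - z)) : ℝ) : ℂ) := by
    rw [mconj_ansatz_snd, ansatz_snd]
    simp only [mul_sub, sub_mul, Matrix.mul_smul, Matrix.smul_mul, smul_sub,
      Matrix.trace_sub, Matrix.trace_smul, trace_mul_vecMulVec', Matrix.vecMulVec_mulVec]
    simp [hs, hx, hy, dotProduct_comm (star h.1) h.1, dotProduct_comm (star h.2) h.2,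
      dotProduct_comm h.2 h.1, dotProduct_comm (star h.2) (star h.1)]
    rw [← hz]
    linear_combination (2 * (α : ℂ) ^ 2 * (x * y
      - (h.1 ⬝ᵥ h.2 * (starRingEnd ℂ) (h.1 ⬝ᵥ h.2)))) * Complex.I_sq
  have e3 : -Complex.I * (Complex.I * ((α * nsq h + (n - 1) * β : ℝ) : ℂ))
      = ((α * nsq h + (n - 1) * β : ℝ) : ℂ) := by
    linear_combination (-((α * nsq h + (n - 1) * β : ℝ) : ℂ)) * Complex.I_sq
  rw [conserved, trace_ansatz hn, e1, e2, e3, Complex.neg_re, Complex.neg_re, Complex.ofReal_re,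
    Complex.ofReal_re, Complex.ofReal_re]
  have hr := (rho_pos hn).ne'
  have hr8 : rho n = 8 * ((n : ℝ) - 1) := rfl
  rw [hxy] at hq ⊢
  field_simp
  rw [hr8] at hq ⊢
  linear_combination 32 * (x + y) * hq

theorem bilin_ansatz : IsBilinearMap ℝ (fun h g : Fld n =>
    (((1 / 2 : ℝ) • (outC h.1 (Complex.I • g.1) + (outC h.2 (Complex.I • g.2))ᵀ),
      outA h.2 (Complex.I • g.1)) : Mat n × Mat n)) where
  add_left h h' g := by
    refine Prod.ext ?_ ?_ <;> ext i j <;> simp [outC, outA, Matrix.vecMulVec_apply] <;> ring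
  smul_left r h g := by
    refine Prod.ext ?_ ?_ <;> ext i j <;> simp [outC, outA, Matrix.vecMulVec_apply] <;> ring
  add_right h g g' := by
    refine Prod.ext ?_ ?_ <;> ext i j <;> simp [outC, outA, Matrix.vecMulVec_apply] <;> ring
  smul_right r h g := by
    refine Prod.ext ?_ ?_ <;> ext i j <;> simp [outC, outA, Matrix.vecMulVec_apply] <;> ring

/-- The α_x term cancels the contribution of ⟨u, h⟩h to h_x, because in the quadratic expression
only twice the real part of ⟨u, h⟩ survives. The remaining −(√ρ/α)u yields `potH`. -/
theorem hasDerivAt_ansatz (hn : 2 ≤ n) {α : ℝ → ℝ} {β : ℝ} {u : Fld n} {h : ℝ → Fld n} {x : ℝ}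
    (hα0 : α x ≠ 0)
    (hα : HasDerivAt α (-(α x ^ 2 / Real.sqrt (rho n) * pairA u (h x))) x)
    (hh : HasDerivAt h ((α x / Real.sqrt (rho n)) • actSp1 (qa u (h x)) (qb u (h x)) (h x)
      - (Real.sqrt (rho n) / α x) • u) x) :
    HasDerivAt (fun x => ansatz (α x) β (α x) (h x)) (potH u (h x)) x := by
  have hd := ((hα.smul (bilin_ansatz.hasDerivAt hh hh)).add_const
    ((((β : ℂ) * Complex.I) • (1 : Mat n), 0) : Mat n × Mat n))
  have e : (fun x => ansatz (α x) β (α x) (h x)) = fun y => α y • (fun h g : Fld n =>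
    (((1 / 2 : ℝ) • (outC h.1 (Complex.I • g.1) + (outC h.2 (Complex.I • g.2))ᵀ),
      outA h.2 (Complex.I • g.1)) : Mat n × Mat n)) (h y) (h y)
      + ((((β : ℂ) * Complex.I) • (1 : Mat n), 0) : Mat n × Mat n) := by
    funext y
    refine Prod.ext ?_ ?_
    · simp [ansatz, smul_smul, div_eq_mul_inv]
    · simp [ansatz]
  rw [e]
  refine hd.congr_deriv ?_
  have hp : ((pairA u (h x) : ℝ) : ℂ) = qa u (h x) + star (qa u (h x)) := by
    rw [qa_ofReal, star_qa]
  have hs := (sqrt_rho_pos hn).ne'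
  have hs' : ((Real.sqrt (rho n) : ℝ) : ℂ) ≠ 0 := by exact_mod_cast hs
  have ha' : ((α x : ℝ) : ℂ) ≠ 0 := by exact_mod_cast hα0
  set s := Real.sqrt (rho n) with hsdef
  generalize h x = g at *
  generalize α x = a at *
  generalize qa u g = q at *
  generalize qb u g = r at *
  refine Prod.ext ?_ ?_ <;> ext i j <;>
    simp [potH, outC, outA, Matrix.vecMulVec_apply, actSp1, hp, ← hsdef] <;> field_simp <;> ring

end

/-! ### Reduction of the nonlocal equation to a local one -/

section

variable {n : ℕ}

/-- The equation for H_x imposes nothing new: the quadratic relation determines α_x along the local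
equation for h, and that value is the one needed in `hasDerivAt_ansatz`. -/
theorem isJ_ansatz_iff (hn : 2 ≤ n) {X : Set ℝ} (hX : IsOpen X) {u h : ℝ → Fld n} {α : ℝ → ℝ}
    {β : ℝ} (hh : ContDiffOn ℝ ∞ h X) (hα : ContDiffOn ℝ ∞ α X)
    (hq : ∀ x ∈ X, α x ^ 2 * nsq (h x) + n * β * α x + rho n = 0 ∧
      2 * α x * nsq (h x) + n * β ≠ 0) :
    IsJ X u h (fun x => ansatz (α x) β (α x) (h x)) (fun _ => 0) ↔
      ∀ x ∈ X, deriv h x = (α x / Real.sqrt (rho n)) •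
        actSp1 (qa (u x) (h x)) (qb (u x) (h x)) (h x) - (Real.sqrt (rho n) / α x) • u x := by
  have hs := sqrt_rho_pos hn
  have hs2 := sqrt_rho_sq hn
  have hα0 : ∀ x ∈ X, α x ≠ 0 := by
    intro x hx h0
    have := (hq x hx).1
    rw [h0] at this
    have hr := rho_pos hn
    norm_num at this
    exact hr.ne' this
  have key : ∀ x ∈ X, (0 = valJ (u x) (deriv h x) (ansatz (α x) β (α x) (h x)) ↔
      deriv h x = (α x / Real.sqrt (rho n)) •
        actSp1 (qa (u x) (h x)) (qb (u x) (h x)) (h x) - (Real.sqrt (rho n) / α x) • u x) := by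
    intro x hx
    have e : α x * nsq (h x) + n * β = -(Real.sqrt (rho n) ^ 2 / α x) := by
      rw [hs2]
      have := (hq x hx).1
      field_simp [hα0 x hx]
      linarith
    rw [zero_eq_valJ_iff, rhsJ_ansatz hn, e, smul_neg, neg_neg, smul_add, smul_smul, smul_smul,
      sub_eq_add_neg, ← neg_smul]
    have e1 : (Real.sqrt (rho n))⁻¹ * α x = α x / Real.sqrt (rho n) := by ring
    have e2 : (Real.sqrt (rho n))⁻¹ * -(Real.sqrt (rho n) ^ 2 / α x)
        = -(Real.sqrt (rho n) / α x) := by field_simp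
    rw [e1, e2]
  constructor
  · intro hJ x hx
    exact (key x hx).1 (hJ x hx).2.2
  · intro hd x hx
    have hhx := hasDerivAt_of_contDiffOn hX hh hx
    have hαx := hasDerivAt_of_contDiffOn hX hα hx
    rw [hd x hx] at hhx
    refine ⟨isMPar_ansatz _ _ _ _, ?_, (key x hx).2 (hd x hx)⟩
    refine hasDerivAt_ansatz hn (hα0 x hx) (hαx.congr_deriv ?_) hhx
    have hz : HasDerivAt (fun y => α y ^ 2 * nsq (h y) + n * β * α y + rho n) 0 x := by
      refine (hasDerivAt_const x (0 : ℝ)).congr_of_eventuallyEq ?_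
      filter_upwards [hX.mem_nhds hx] with y hy using (hq y hy).1
    have hz' := (((hαx.pow 2).mul (hasDerivAt_nsq hhx)).add
      (hαx.const_mul (n * β))).add_const (rho n)
    have hu := hz'.unique hz
    have hp : pairA (h x) ((α x / Real.sqrt (rho n)) •
        actSp1 (qa (u x) (h x)) (qb (u x) (h x)) (h x) - (Real.sqrt (rho n) / α x) • u x)
        = (α x * nsq (h x) / Real.sqrt (rho n) - Real.sqrt (rho n) / α x) * pairA (u x) (h x) := by
      rw [pairA_comm, pairA_eq, pairA_eq, qa_sub_left, qa_smul_left, qa_smul_left, qa_act_left,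
        qa_self, qb_self]
      simp
      ring
    rw [hp] at hu
    have hq2 := (hq x hx).2
    have hq1 := (hq x hx).1
    rw [← hs2] at hq1
    set s := Real.sqrt (rho n)
    set ν := nsq (h x)
    set P := pairA (u x) (h x)
    have h0 := hα0 x hx
    simp at hu
    field_simp at hu
    -- The first factor is the derivative of the quadratic relation with respect to α, nonzero by
    -- hypothesis. The second is the desired formula for α_x.
    have hm : (2 * α x * ν + n * β) * (deriv α x * s + α x ^ 2 * P) = 0 := by
      linear_combination hu + α x * P * hq1
    have hm' := (mul_eq_zero.1 hm).resolve_left hq2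
    field_simp
    linear_combination hm'

end

/-! ### Equivalent forms of the system and its Hamiltonian form -/

section

variable {n : ℕ}

theorem isSG_iff_isMinusOneFlow (hn : 2 ≤ n) {T X : Set ℝ} (hT : IsOpen T) (hX : IsOpen X) {ε : ℝ}
    (hε : ε = 1 ∨ ε = -1) {u : ℝ → ℝ → Fld n} (hu : Smooth2 T X u)
    (hA : ∀ t ∈ T, ∀ x ∈ X, Adm ε (Dt u t x)) :
    IsSG ε T X u ↔ IsMinusOneFlow T X u (Dt u) (fun t x =>
      ansatz (Real.sqrt (rho n) * kap ε (Dt u t x)) (-(2 * Real.sqrt (rho n)) / n)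
        (Real.sqrt (rho n) * kap ε (Dt u t x)) (Dt u t x)) := by
  have hs := sqrt_rho_pos hn
  have hs2 := sqrt_rho_sq hn
  have hn0 : (n : ℝ) ≠ 0 := by positivity
  have hD := hu.smooth2_Dt hT hX
  have key : ∀ t ∈ T, (IsJ X (u t) (Dt u t) (fun x =>
      ansatz (Real.sqrt (rho n) * kap ε (Dt u t x)) (-(2 * Real.sqrt (rho n)) / n)
        (Real.sqrt (rho n) * kap ε (Dt u t x)) (Dt u t x)) (fun _ => 0) ↔
      ∀ x ∈ X, deriv (Dt u t) x = sgRHS ε (u t x) (Dt u t x)) := by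
    intro t ht
    have hDt := hD.contDiffOn_snd ht
    rw [isJ_ansatz_iff hn hX hDt (contDiffOn_const.mul (contDiffOn_kap hε hDt (hA t ht)))]
    · refine forall₂_congr fun x hx => ?_
      obtain ⟨y, hy, hy1, he, hk, hν⟩ := (hA t ht x hx).exists_den hε
      rw [(hA t ht x hx).sgRHS_eq hε, hk, he, mul_div_cancel_left₀ _ hs.ne']
      have e2 : Real.sqrt (rho n) / (Real.sqrt (rho n) * y⁻¹) = 1 - (1 - y) := by
        field_simp; ring
      rw [e2]
    · intro x hx
      obtain ⟨y, hy, hy1, he, hk, hν⟩ := (hA t ht x hx).exists_den hε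
      rw [hk, hν]
      -- In terms of y the relation is ρ(2y − y²)/y² − 2ρ/y + ρ = 0, and the nondegeneracy factor
      -- computed next is a multiple of 1 − y.
      refine ⟨by rw [← hs2, Real.sqrt_sq hs.le]; field_simp; ring, ?_⟩
      have : 2 * (Real.sqrt (rho n) * y⁻¹) * (2 * y - y ^ 2) + n * (-(2 * Real.sqrt (rho n)) / n)
          = 2 * Real.sqrt (rho n) * (1 - y) := by field_simp; ring
      rw [this]
      exact mul_ne_zero (by positivity) (sub_ne_zero.2 hy1.symm)
  exact ⟨fun h => ⟨fun _ _ _ _ => rfl, fun t ht => (key t ht).2 (h t ht)⟩,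
    fun h t ht => (key t ht).1 (h.2 t ht)⟩

theorem isSG_iff_eq_uOf {T X : Set ℝ} {ε : ℝ} (hε : ε = 1 ∨ ε = -1) {u : ℝ → ℝ → Fld n}
    (hA : ∀ t ∈ T, ∀ x ∈ X, Adm ε (Dt u t x)) :
    IsSG ε T X u ↔ ∀ t ∈ T, ∀ x ∈ X, u t x = uOf ε (Dt u t x) (deriv (Dt u t) x) :=
  forall₂_congr fun t ht => forall₂_congr fun x hx => eq_sgRHS_iff hε (hA t ht x hx) _ _

theorem isHamiltonianFlow {T X : Set ℝ} (hT : IsOpen T) (hX : IsOpen X) (hX' : X.OrdConnected)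
    {κ ε : ℝ} (hκ : κ ≠ 0) (hε : ε = 1 ∨ ε = -1) {u : ℝ → ℝ → Fld n} (hu : Smooth2 T X u)
    (hA : ∀ t ∈ T, ∀ x ∈ X, Adm ε (Dt u t x)) (hsg : IsSG ε T X u) :
    IsHamiltonianFlow κ ε T X u (Dt u) := by
  have hU := (isSG_iff_eq_uOf hε hA).1 hsg
  have hA' : ∀ t ∈ T, ∀ x ∈ X,
      Adm ε (Dt u t x) ∧ u t x = uOf ε (Dt u t x) (deriv (Dt u t) x) :=
    fun t ht x hx => ⟨hA t ht x hx, hU t ht x hx⟩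
  refine ⟨hA', fun t ht => ?_⟩
  have hh := (hu.smooth2_Dt hT hX).contDiffOn_snd ht
  obtain ⟨w, hw, hv⟩ := exists_isVarDeriv (κ := κ) hX hX' hε hh (hA' t ht)
  obtain ⟨V, hV⟩ := exists_isHop hX hε hκ hh (hA' t ht) hw hv
  exact ⟨w, V, hw, hv, hV⟩

/-! ### Normalization of the ansatz -/

/-- The quadratic relation is solved for its linear term. Positivity of ρ makes cα positive, so
neither c nor α vanishes. -/
theorem ansatz_scale_pos (hn : 2 ≤ n) {α β c : ℝ} {h : Fld n}
    (hc : c = -(n * β) / (2 * Real.sqrt (rho n)))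
    (hq : α ^ 2 * nsq h + n * β * α + rho n = 0) :
    2 * Real.sqrt (rho n) * (c * α) = α ^ 2 * nsq h + rho n ∧ 0 < c * α := by
  have hs := sqrt_rho_pos hn
  have h1 : 2 * Real.sqrt (rho n) * (c * α) = α ^ 2 * nsq h + rho n := by
    rw [hc]; field_simp; linarith
  refine ⟨h1, ?_⟩
  have h2 : 0 < 2 * Real.sqrt (rho n) * (c * α) := by
    rw [h1]
    have := rho_pos hn
    have := nsq_nonneg h
    positivity
  exact (mul_pos_iff_of_pos_left (by positivity)).1 h2

theorem ansatz_scale_ratio (hn : 2 ≤ n) {β c : ℝ} (hc : c = -(n * β) / (2 * Real.sqrt (rho n)))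
    (hc0 : c ≠ 0) : β / c = -(2 * Real.sqrt (rho n)) / n := by
  have hs := sqrt_rho_pos hn
  have hn0 : (n : ℝ) ≠ 0 := by positivity
  rw [div_eq_div_iff hc0 hn0, hc]
  field_simp

theorem ansatz_scale_kap (hn : 2 ≤ n) {α β c ε : ℝ} {h : Fld n}
    (hc : c = -(n * β) / (2 * Real.sqrt (rho n)))
    (hq : α ^ 2 * nsq h + n * β * α + rho n = 0) (hε : ε = 1 ∨ ε = -1)
    (hpos : 0 < ε * (α ^ 2 * nsq h - rho n)) :
    Adm ε (c⁻¹ • h) ∧ c * α = Real.sqrt (rho n) * kap ε (c⁻¹ • h) := by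
  have hs := sqrt_rho_pos hn
  have hs2 := sqrt_rho_sq hn
  have hr := rho_pos hn
  obtain ⟨h1, h2⟩ := ansatz_scale_pos hn hc hq
  have hα : α ≠ 0 := right_ne_zero_of_mul h2.ne'
  have hc0 : c ≠ 0 := left_ne_zero_of_mul h2.ne'
  have hsum : 0 < α ^ 2 * nsq h + rho n := by rw [← h1]; positivity
  have he : ε ^ 2 = 1 := by rcases hε with rfl | rfl <;> norm_num
  -- Since 2√ρ cα = α²|h|² + ρ, the number 1 − |h/c|² is the square of (α²|h|² − ρ)/(α²|h|² + ρ).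
  -- The sign ε selects the positive square root.
  set r := ε * (α ^ 2 * nsq h - rho n) / (α ^ 2 * nsq h + rho n) with hrdef
  have hr0 : 0 < r := div_pos hpos hsum
  have hν : 1 - nsq (c⁻¹ • h) = r ^ 2 := by
    have e1 : nsq (c⁻¹ • h) = α ^ 2 * nsq h / (c * α) ^ 2 := by
      rw [nsq_smul]; field_simp
    have e2 : c * α = (α ^ 2 * nsq h + rho n) / (2 * Real.sqrt (rho n)) := by
      rw [← h1]; field_simp
    rw [e1, e2, hrdef, div_pow, div_pow, mul_pow, mul_pow, hs2, he]
    field_simp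
    ring
  have hrad : rad (c⁻¹ • h) = r := by rw [rad, hν, Real.sqrt_sq hr0.le]
  have hA : Adm ε (c⁻¹ • h) := by
    refine ⟨by nlinarith, fun h1 h0 => ?_⟩
    have : h = 0 := (smul_eq_zero.1 h0).resolve_left (inv_ne_zero hc0)
    rw [h1, nsq_eq_zero.2 this] at hpos
    linarith
  refine ⟨hA, ?_⟩
  have e3 : 1 - ε * rad (c⁻¹ • h) = 2 * Real.sqrt (rho n) ^ 2 / (α ^ 2 * nsq h + rho n) := by
    rw [hrad, hrdef, hs2]
    field_simp
    linear_combination (rho n - α ^ 2 * nsq h) * he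
  rw [kap, e3, ← h1]
  field_simp

theorem sgRHS_inv_smul {ε c α s : ℝ} {h : Fld n} (hε : ε = 1 ∨ ε = -1) (hc : c ≠ 0) (hs : s ≠ 0)
    (hA : Adm ε (c⁻¹ • h)) (hα : c * α = s * kap ε (c⁻¹ • h)) (u : Fld n) :
    sgRHS ε u (c⁻¹ • h) =
      c⁻¹ • ((α / s) • actSp1 (qa u h) (qb u h) h - (s / α) • u) := by
  have hk := (hA.kap_pos hε).ne'
  have hα0 : α ≠ 0 := right_ne_zero_of_mul (hα ▸ mul_ne_zero hs hk)
  have e1 : kap ε (c⁻¹ • h) = c * α / s := by rw [hα]; field_simp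
  have e2 : 1 - ε * rad (c⁻¹ • h) = s / (c * α) := by
    rw [hα, div_mul_cancel_left₀ hs]
    exact eq_inv_of_mul_eq_one_right (hA.kap_mul hε)
  have hc' : (c : ℂ) ≠ 0 := by exact_mod_cast hc
  have hs' : (s : ℂ) ≠ 0 := by exact_mod_cast hs
  have ha' : (α : ℂ) ≠ 0 := by exact_mod_cast hα0
  rw [hA.sgRHS_eq hε, e1, e2, qa_smul_right, qb_smul_right]
  ext i <;> simp [act_fst, act_snd] <;> field_simp

theorem exists_sign {Y : Type*} [TopologicalSpace Y] {S : Set Y} (hS : IsPreconnected S)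
    {f : Y → ℝ} (hf : ContinuousOn f S) (h0 : ∀ p ∈ S, f p ≠ 0) :
    ∃ ε : ℝ, (ε = 1 ∨ ε = -1) ∧ ∀ p ∈ S, 0 < ε * f p := by
  by_cases h : ∃ p ∈ S, 0 < f p
  · obtain ⟨p, hp, hfp⟩ := h
    refine ⟨1, Or.inl rfl, fun q hq => ?_⟩
    rw [one_mul]
    by_contra hq0
    obtain ⟨r, hr, hr0⟩ := hS.intermediate_value hq hp hf ⟨not_lt.1 hq0, hfp.le⟩
    exact h0 r hr hr0
  · push Not at h
    refine ⟨-1, Or.inr rfl, fun q hq => ?_⟩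
    have := lt_of_le_of_ne (h q hq) (h0 q hq)
    linarith

theorem isSG_comp {T X T' : Set ℝ} (hT : IsOpen T) (hX : IsOpen X) {ε : ℝ}
    {u h : ℝ → ℝ → Fld n} {c θ : ℝ → ℝ} (hu : Smooth2 T X u)
    (huh : ∀ t ∈ T, ∀ x ∈ X, Dt u t x = h t x)
    (hd : ∀ t ∈ T, ∀ x ∈ X, deriv (fun y => (c t)⁻¹ • h t y) x
      = sgRHS ε (u t x) ((c t)⁻¹ • h t x))
    (hθ : ∀ τ ∈ T', θ τ ∈ T ∧ HasDerivAt θ (c (θ τ))⁻¹ τ) :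
    IsSG ε T' X (fun τ x => u (θ τ) x) := by
  intro τ hτ x hx
  obtain ⟨h1, h2⟩ := hθ τ hτ
  have hD : ∀ y ∈ X, Dt (fun τ x => u (θ τ) x) τ y = (c (θ τ))⁻¹ • h (θ τ) y := by
    intro y hy
    rw [← huh _ h1 y hy]
    exact ((hu.hasDerivAt_Dt hT hX h1 hy).scomp τ h2).deriv
  rw [hD x hx, ← hd _ h1 x hx]
  exact Filter.EventuallyEq.deriv_eq (Filter.eventuallyEq_of_mem (hX.mem_nhds hx) hD)

end

/-! ### Invariance under `Sp(1) × Sp(n-1)` -/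

section

variable {n : ℕ}

theorem rowM_injective : Function.Injective (rowM (n := n)) := by
  intro p q h
  ext i
  · simpa [rowM] using congrFun (congrFun h 0) (Sum.inl i)
  · simpa [rowM] using congrFun (congrFun h 0) (Sum.inr i)

theorem rowM_add (p q : Fld n) : rowM (p + q) = rowM p + rowM q := by
  ext i (j | j) <;> fin_cases i <;> simp [rowM]
  ring

theorem rowM_smul (r : ℝ) (p : Fld n) : rowM (r • p) = r • rowM p := by
  ext i (j | j) <;> fin_cases i <;> simp [rowM]

/-- The quaternion `c + d j` as a complex matrix. -/
def quatU (c d : ℂ) : Matrix (Fin 2) (Fin 2) ℂ := !![c, d; -star d, star c]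

theorem rowM_actSp1 (c d : ℂ) (p : Fld n) : rowM (actSp1 c d p) = quatU c d * rowM p := by
  ext i (j | j) <;> fin_cases i <;> simp [rowM, quatU, actSp1, Matrix.mul_apply] <;> ring

/-- In the complex matrix model the Hermitian product is an honest matrix product, so the invariance
statements follow from associativity and unitarity. -/
theorem rowM_mul_conjTranspose (u w : Fld n) :
    rowM u * (rowM w)ᴴ = quatU (qa u w) (qb u w) := by
  ext i j
  simp only [Matrix.mul_apply, Fintype.sum_sum_type, Matrix.conjTranspose_apply]
  fin_cases i <;> fin_cases j <;> simp [rowM, quatU, qa, qb, dotProduct] <;> ring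

theorem rowM_actSp (C D : Mat n) (p : Fld n) :
    rowM (actSp C D p) = rowM p * (Matrix.fromBlocks C D (-mconj D) (mconj C))ᴴ := by
  ext i (j | j) <;> fin_cases i <;>
    simp [rowM, actSp, mconj, Matrix.mul_apply, Matrix.vecMul, dotProduct]
  exact add_comm _ _

theorem IsSp1.quatU_mul {c d : ℂ} (h : IsSp1 c d) : (quatU c d)ᴴ * quatU c d = 1 := by
  have e : c * (starRingEnd ℂ) c + d * (starRingEnd ℂ) d = 1 := by
    rw [Complex.mul_conj, Complex.mul_conj, ← Complex.ofReal_add, h, Complex.ofReal_one]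
  ext i j
  fin_cases i <;> fin_cases j <;> simp [quatU, Matrix.mul_apply] <;>
    first | linear_combination e | ring

/-- The action of `Sp(1) × Sp(n-1)` as a real linear map. -/
def actL (c d : ℂ) (C D : Mat n) : Fld n →ₗ[ℝ] Fld n where
  toFun p := actSp C D (actSp1 c d p)
  map_add' p q := rowM_injective (by
    simp only [rowM_actSp, rowM_actSp1, rowM_add, Matrix.mul_add, Matrix.add_mul])
  map_smul' r p := rowM_injective (by
    simp only [rowM_actSp, rowM_actSp1, rowM_smul, Matrix.mul_smul, Matrix.smul_mul,
      RingHom.id_apply])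

variable {c d : ℂ} {C D : Mat n}

theorem rowM_actL (p : Fld n) : rowM (actL c d C D p)
    = quatU c d * rowM p * (Matrix.fromBlocks C D (-mconj D) (mconj C))ᴴ := by
  rw [actL, LinearMap.coe_mk, AddHom.coe_mk, rowM_actSp, rowM_actSp1]

theorem IsSp.mul_actL (hS : IsSp C D) (u w : Fld n) :
    rowM (actL c d C D u) * (rowM (actL c d C D w))ᴴ
      = quatU c d * (rowM u * (rowM w)ᴴ) * (quatU c d)ᴴ := by
  have hS' := Matrix.mem_unitaryGroup_iff'.1 hS
  rw [Matrix.star_eq_conjTranspose] at hS'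
  rw [rowM_actL, rowM_actL]
  set S := Matrix.fromBlocks C D (-mconj D) (mconj C)
  calc _ = quatU c d * rowM u * (Sᴴ * S) * (rowM w)ᴴ * (quatU c d)ᴴ := by
        simp only [Matrix.conjTranspose_mul, Matrix.conjTranspose_conjTranspose, Matrix.mul_assoc]
    _ = _ := by rw [hS', Matrix.mul_one, Matrix.mul_assoc (quatU c d)]

theorem two_nsq (u : Fld n) : ((2 * nsq u : ℝ) : ℂ) = (rowM u * (rowM u)ᴴ).trace := by
  rw [rowM_mul_conjTranspose, qa_self, Matrix.trace_fin_two]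
  simp [quatU]
  ring

theorem nsq_actL (h1 : IsSp1 c d) (hS : IsSp C D) (p : Fld n) :
    nsq (actL c d C D p) = nsq p := by
  have h := two_nsq (actL c d C D p)
  rw [hS.mul_actL, Matrix.trace_mul_comm, ← Matrix.mul_assoc, h1.quatU_mul, Matrix.one_mul,
    ← two_nsq] at h
  have h' : 2 * nsq (actL c d C D p) = 2 * nsq p := by exact_mod_cast h
  linarith

theorem actL_injective (h1 : IsSp1 c d) (hS : IsSp C D) :
    Function.Injective (actL c d C D) := by
  rw [injective_iff_map_eq_zero]
  intro p hp
  rw [← nsq_eq_zero, ← nsq_actL h1 hS p, hp, nsq_eq_zero]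

/-- If p and S are the matrices of the two group elements, ⟨u, h⟩ becomes p⟨u, h⟩p*, and p⟨u, h⟩p* ·
p h S* = p⟨u, h⟩h S*. The scalar coefficients depend only on |h|. -/
theorem sgRHS_actL (h1 : IsSp1 c d) (hS : IsSp C D) (ε : ℝ) (u h : Fld n) :
    sgRHS ε (actL c d C D u) (actL c d C D h) = actL c d C D (sgRHS ε u h) := by
  have hr : rad (actL c d C D h) = rad h := by rw [rad, nsq_actL h1 hS, rad]
  have ha : actSp1 (qa (actL c d C D u) (actL c d C D h)) (qb (actL c d C D u) (actL c d C D h))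
      (actL c d C D h) = actL c d C D (actSp1 (qa u h) (qb u h) h) := by
    refine rowM_injective ?_
    rw [rowM_actSp1, ← rowM_mul_conjTranspose, hS.mul_actL, rowM_actL, rowM_actL, rowM_actSp1,
      ← rowM_mul_conjTranspose]
    set S := Matrix.fromBlocks C D (-mconj D) (mconj C)
    calc _ = quatU c d * (rowM u * (rowM h)ᴴ) * ((quatU c d)ᴴ * quatU c d) * rowM h * Sᴴ := by
          simp only [Matrix.mul_assoc]
      _ = _ := by simp only [h1.quatU_mul, Matrix.mul_one, Matrix.mul_assoc]
  rw [sgRHS_eq, sgRHS_eq, ha, hr, nsq_actL h1 hS, map_sub, map_smul, map_smul]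

theorem isSG_actL_iff {T X : Set ℝ} (hT : IsOpen T) (hX : IsOpen X) (h1 : IsSp1 c d)
    (hS : IsSp C D) (ε : ℝ) {u : ℝ → ℝ → Fld n} (hu : Smooth2 T X u) :
    IsSG ε T X (fun t x => actL c d C D (u t x)) ↔ IsSG ε T X u := by
  have hd : ∀ {f : ℝ → Fld n} {f' : Fld n} {s : ℝ}, HasDerivAt f f' s →
      HasDerivAt (fun y => actL c d C D (f y)) (actL c d C D f') s := fun hf =>
    (LinearMap.toContinuousLinearMap (actL c d C D)).hasFDerivAt.comp_hasDerivAt _ hf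
  have hD : ∀ t ∈ T, ∀ x ∈ X, Dt (fun t x => actL c d C D (u t x)) t x
      = actL c d C D (Dt u t x) :=
    fun t ht x hx => (hd (hu.hasDerivAt_Dt hT hX ht hx)).deriv
  refine forall₂_congr fun t ht => forall₂_congr fun x hx => ?_
  have e : deriv (fun y => Dt (fun t x => actL c d C D (u t x)) t y) x
      = actL c d C D (deriv (Dt u t) x) := by
    rw [Filter.EventuallyEq.deriv_eq (Filter.eventuallyEq_of_mem (hX.mem_nhds hx) (hD t ht))]
    exact (hd ((hu.smooth2_Dt hT hX).hasDerivAt_deriv hT hX ht hx)).deriv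
  rw [e, hD t ht x hx, sgRHS_actL h1 hS, (actL_injective h1 hS).eq_iff]

end

end

end VectorSG

/-! ### Assembly of the theorem -/

theorem mainTheorem7 (n : ℕ) (hn : 2 ≤ n) (T X : Set ℝ)
    (hT : IsOpen T) (hT' : T.OrdConnected) (hX : IsOpen X) (hX' : X.OrdConnected) :
    -- conservation law of the `-1` flow
    (∀ (u h : ℝ → VectorSG.Fld n) (H : ℝ → VectorSG.Mat n × VectorSG.Mat n),
      ContDiffOn ℝ ∞ u X → ContDiffOn ℝ ∞ h X →
      VectorSG.IsJ X u h H (fun _ => 0) →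
      ∀ x ∈ X, HasDerivAt (fun y => VectorSG.conserved (h y) (H y)) 0 x) ∧
    -- reduction by the ansatz, and normalization of `β` by a conformal scaling of `t`
    (∀ (u h : ℝ → ℝ → VectorSG.Fld n) (α : ℝ → ℝ → ℝ) (β c : ℝ → ℝ),
      VectorSG.Smooth2 T X u → VectorSG.Smooth2 T X h → VectorSG.Smooth2 T X α →
      (∀ t, c t = -(n * β t) / (2 * Real.sqrt (VectorSG.rho n))) →
      (∀ t ∈ T, ∀ x ∈ X,
        α t x ^ 2 * VectorSG.nsq (h t x) + n * β t * α t x + VectorSG.rho n = 0 ∧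
        2 * α t x * VectorSG.nsq (h t x) + n * β t ≠ 0) →
      (∀ t ∈ T, ∀ x ∈ X,
        VectorSG.conserved (h t x) (VectorSG.ansatz (α t x) (β t) (α t x) (h t x))
            = n * (β t / 4) ^ 2 ∧
        c t ≠ 0 ∧ β t / c t = -(2 * Real.sqrt (VectorSG.rho n)) / n ∧
        VectorSG.ansatz (α t x) (β t) (α t x) (h t x)
          = c t • VectorSG.ansatz (c t * α t x) (β t / c t) (c t * α t x)
              ((c t)⁻¹ • h t x)) ∧
      ∃ ε : ℝ, (ε = 1 ∨ ε = -1) ∧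
        (∀ t ∈ T, ∀ x ∈ X,
          VectorSG.Adm ε ((c t)⁻¹ • h t x) ∧
          c t * α t x = Real.sqrt (VectorSG.rho n) * VectorSG.kap ε ((c t)⁻¹ • h t x) ∧
          (h t x ≠ 0 → c t * α t x = Real.sqrt (VectorSG.rho n) *
            ((1 + ε * VectorSG.rad ((c t)⁻¹ • h t x)) / VectorSG.nsq ((c t)⁻¹ • h t x)))) ∧
        ((∀ t ∈ T, VectorSG.IsJ X (u t) (h t)
            (fun x => VectorSG.ansatz (α t x) (β t) (α t x) (h t x)) (fun _ => 0)) ↔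
          ∀ t ∈ T, ∀ x ∈ X, deriv (fun y => (c t)⁻¹ • h t y) x
            = VectorSG.sgRHS ε (u t x) ((c t)⁻¹ • h t x)) ∧
        (VectorSG.IsMinusOneFlow T X u h
            (fun t x => VectorSG.ansatz (α t x) (β t) (α t x) (h t x)) →
          ∀ (T' : Set ℝ) (θ : ℝ → ℝ),
            (∀ τ ∈ T', θ τ ∈ T ∧ HasDerivAt θ (c (θ τ))⁻¹ τ) →
            VectorSG.IsSG ε T' X (fun τ x => u (θ τ) x))) ∧
    (∀ ε : ℝ, (ε = 1 ∨ ε = -1) →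
      -- the vector SG system is the `-1` flow with the normalized ansatz
      (∀ u : ℝ → ℝ → VectorSG.Fld n, VectorSG.Smooth2 T X u →
        (∀ t ∈ T, ∀ x ∈ X, VectorSG.Adm ε (VectorSG.Dt u t x)) →
        (VectorSG.IsSG ε T X u ↔
          VectorSG.IsMinusOneFlow T X u (VectorSG.Dt u) (fun t x =>
            VectorSG.ansatz
              (Real.sqrt (VectorSG.rho n) * VectorSG.kap ε (VectorSG.Dt u t x))
              (-(2 * Real.sqrt (VectorSG.rho n)) / n)
              (Real.sqrt (VectorSG.rho n) * VectorSG.kap ε (VectorSG.Dt u t x))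
              (VectorSG.Dt u t x))) ∧
        (VectorSG.IsSG ε T X u ↔
          ∀ t ∈ T, ∀ x ∈ X,
            u t x = VectorSG.uOf ε (VectorSG.Dt u t x) (deriv (VectorSG.Dt u t) x))) ∧
      -- invariance under `Sp(1) × Sp(n-1)`
      (∀ (c d : ℂ) (C D : VectorSG.Mat n), VectorSG.IsSp1 c d → VectorSG.IsSp C D →
        (∀ p : VectorSG.Fld n,
          VectorSG.nsq (VectorSG.actSp C D (VectorSG.actSp1 c d p)) = VectorSG.nsq p) ∧
        ∀ u : ℝ → ℝ → VectorSG.Fld n, VectorSG.Smooth2 T X u →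
          (VectorSG.IsSG ε T X
              (fun t x => VectorSG.actSp C D (VectorSG.actSp1 c d (u t x))) ↔
            VectorSG.IsSG ε T X u)) ∧
      -- Hamiltonian structure: every variational derivative of `H^(-1)` is mapped to `h` by `ℋ`
      (∀ (κ : ℝ), κ ≠ 0 → ∀ u h : ℝ → VectorSG.Fld n, ContDiffOn ℝ ∞ h X →
        (∀ x ∈ X, VectorSG.Adm ε (h x) ∧ u x = VectorSG.uOf ε (h x) (deriv h x)) →
        (∃ w : ℝ → VectorSG.Fld n, ContDiffOn ℝ ∞ w X ∧ VectorSG.IsVarDeriv κ ε X h w) ∧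
        ∀ w : ℝ → VectorSG.Fld n, ContDiffOn ℝ ∞ w X → VectorSG.IsVarDeriv κ ε X h w →
          ∃ V : ℝ → VectorSG.Par n, VectorSG.IsHop X u w V h) ∧
      (∀ (κ : ℝ), κ ≠ 0 → ∀ u : ℝ → ℝ → VectorSG.Fld n, VectorSG.Smooth2 T X u →
        (∀ t ∈ T, ∀ x ∈ X, VectorSG.Adm ε (VectorSG.Dt u t x)) →
        VectorSG.IsSG ε T X u →
        VectorSG.IsHamiltonianFlow κ ε T X u (VectorSG.Dt u))) ∧
    -- `ℋ` is a Hamiltonian operator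
    (∀ u : ℝ → VectorSG.Fld n, ContDiffOn ℝ ∞ u X → VectorSG.IsCosymplecticAt X u) := by
  have hTX : IsPreconnected (T ×ˢ X) := hT'.isPreconnected.prod hX'.isPreconnected
  refine ⟨fun u h H _ hh hJ x hx => VectorSG.hasDerivAt_conserved hn hX hh hJ hx, ?_,
    fun ε hε => ⟨fun u hu hA => ⟨VectorSG.isSG_iff_isMinusOneFlow hn hT hX hε hu hA,
      VectorSG.isSG_iff_eq_uOf hε hA⟩,
    fun c d C D h1 hS => ⟨fun p => VectorSG.nsq_actL h1 hS p,
      fun u hu => VectorSG.isSG_actL_iff hT hX h1 hS ε hu⟩,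
    fun κ hκ u h hh hA => ⟨VectorSG.exists_isVarDeriv hX hX' hε hh hA,
      fun w hw hv => VectorSG.exists_isHop hX hε hκ hh hA hw hv⟩,
    fun κ hκ u hu hA hsg => VectorSG.isHamiltonianFlow hT hX hX' hκ hε hu hA hsg⟩,
    fun u hu => VectorSG.isCosymplecticAt hX hu⟩
  intro u h α β c hu hh hα hc hq
  have hs := VectorSG.sqrt_rho_pos hn
  have hc0 : ∀ t ∈ T, ∀ x ∈ X, c t ≠ 0 := fun t ht x hx =>
    left_ne_zero_of_mul (VectorSG.ansatz_scale_pos hn (hc t) (hq t ht x hx).1).2.ne'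
  refine ⟨fun t ht x hx => ⟨VectorSG.conserved_ansatz hn (hq t ht x hx).1, hc0 t ht x hx,
    VectorSG.ansatz_scale_ratio hn (hc t) (hc0 t ht x hx),
    VectorSG.ansatz_smul (hc0 t ht x hx) _ _ _⟩, ?_⟩
  -- By the quadratic relation, α(2α|h|² + nβ) = α²|h|² − ρ, so the nondegeneracy hypothesis keeps
  -- this function from vanishing. Its constant sign on the connected set T × X is the branch ε.
  obtain ⟨ε, hε, hpos⟩ := VectorSG.exists_sign hTX
    (f := fun p : ℝ × ℝ => α p.1 p.2 ^ 2 * VectorSG.nsq (h p.1 p.2) - VectorSG.rho n)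
    ((((ContDiffOn.continuousOn hα).pow 2).mul
      (VectorSG.contDiffOn_nsq hh).continuousOn).sub continuousOn_const) (by
      rintro ⟨t, x⟩ ⟨ht, hx⟩ h0
      obtain ⟨h1, h2⟩ := hq t ht x hx
      have hα0 := right_ne_zero_of_mul
        (VectorSG.ansatz_scale_pos hn (hc t) (hq t ht x hx).1).2.ne'
      refine mul_ne_zero hα0 h2 ?_
      simp only at h0
      linear_combination h0 + h1)
  have hk := fun t (ht : t ∈ T) x (hx : x ∈ X) => VectorSG.ansatz_scale_kap hn (hc t)
    (hq t ht x hx).1 hε (hpos (t, x) ⟨ht, hx⟩)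
  have hJ : (∀ t ∈ T, VectorSG.IsJ X (u t) (h t)
        (fun x => VectorSG.ansatz (α t x) (β t) (α t x) (h t x)) (fun _ => 0)) ↔
      ∀ t ∈ T, ∀ x ∈ X, deriv (fun y => (c t)⁻¹ • h t y) x
        = VectorSG.sgRHS ε (u t x) ((c t)⁻¹ • h t x) := by
    refine forall₂_congr fun t ht => ?_
    rw [VectorSG.isJ_ansatz_iff hn hX (VectorSG.Smooth2.contDiffOn_snd hh ht)
      (VectorSG.Smooth2.contDiffOn_snd hα ht) (hq t ht)]
    refine forall₂_congr fun x hx => ?_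
    have hd : deriv (fun y => (c t)⁻¹ • h t y) x = (c t)⁻¹ • deriv (h t) x :=
      (HasDerivAt.fun_const_smul ((c t)⁻¹)
        (VectorSG.Smooth2.hasDerivAt_deriv hT hX hh ht hx)).deriv
    rw [hd, VectorSG.sgRHS_inv_smul hε (hc0 t ht x hx) hs.ne' (hk t ht x hx).1 (hk t ht x hx).2,
      (smul_right_injective _ (inv_ne_zero (hc0 t ht x hx))).eq_iff]
  refine ⟨ε, hε, fun t ht x hx => ⟨(hk t ht x hx).1, (hk t ht x hx).2, fun h0 => ?_⟩, hJ,
    fun hflow T' θ hθ => VectorSG.isSG_comp hT hX hu hflow.1 (hJ.1 hflow.2) hθ⟩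
  rw [(hk t ht x hx).2, VectorSG.kap_eq hε (hk t ht x hx).1.1.le fun h1 => ?_]
  exact smul_ne_zero (inv_ne_zero (hc0 t ht x hx)) h0 (VectorSG.nsq_eq_zero.1 h1)
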